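/- \textbf{Setting.} A (finite) Tanner square complex $T$ has a vertex set $V_X\sqcup V_Q\sqcup V_Z$ ($X$-checks, qubits, $Z$-checks) and square faces with boundary cycles $(x,q_0,z,q_1)$, $x\in V_X$, $q_0\ne q_1\in V_Q$, $z\in V_Z$; its edges are the sides of its faces. Its code is $C(T):\mathbb F_2^{V_X}\xrightarrow{\delta^0}\mathbb F_2^{V_Q}\xrightarrow{\delta^1}\mathbb F_2^{V_Z}$ with $\delta$ the adjacency maps, and $B^2(C(T))=\operatorname{im}\delta^1$. We write $|\cdot|$ for the Hamming weight. Fix an odd integer $\ell=2m+1\ge 3$. Let $U_X$ be the square complex with vertices $(a,b,h)$, $0\le a,b\le \ell$, $h\in\{0,1,2\}$, where $h=1$ is allowed only if $a=2m$ or $b=2m$. Its faces are the unit squares in the two layers $h=0$, $h=2$ and in the two walls $\{a=2m\}$, $\{b=2m\}$ ($0\le h\le 2$). A vertex is an $X$-check, a qubit or a $Z$-check according to whether $0$, $1$ or $2$ of its coordinates are odd. The complex $\mathcal R_X(T)$ is obtained from $T$ by replacing every face $(x,q_0,z,q_1)$ with a copy of $U_X$, its corners $x,q_0,q_1,z$ being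 placed at $(a,b)=(0,0),(\ell,0),(0,\ell),(\ell,\ell)$, and gluing copies along the parts lying over common edges and vertices of $T$ (heights, and distances along the edge, being preserved). $\mathcal R_Z$ is the same construction with the roles of $X$ and $Z$ exchanged. Let $T_{(0)}$ be the Tanner square complex of the $[\![5,1,2]\!]$ surface code (the $3\times3$ grid of vertices with its four unit squares as faces: qubits at the four corners and the centre, $X$-checks at the midpoints of two opposite sides, $Z$-checks at the midpoints of the other two), and let $T_{(2k)}=(\mathcal R_Z\circ\mathcal R_X)^{k}(T_{(0)})$, $T_{(2k+1)}=\mathcal R_X(T_{(2k)})$, $C_{(i)}=C(T_{(i)})$. Let $i=2k+1$, $k\ge0$, be an $\mathcal R_X$ level. The vertices of $T_{(i)}$ are partitioned into local complexes $Y_v$ indexed by the vertices $v$ of $T_{(i-1)}$: the vertex $(a,b,h)$ of the copy of $U_X$ replacing $(x,q_0,z,q_1)$ belongs to $Y_x$ if $a,b\le 2m$, to $Y_{q_0}$ if $a=\ell$, $b\le 2m$, to $Y_{q_1}$ if $a\le 2m$, $b=\ell$, and to $Y_z$ if $a=b=\ell$. The cochain map $\mathcal F_{\mathcal R_X}:C_{(i-1)}\to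 C_{(i)}$ sends the basis element $x$, $q$, $z$ to the sum of all vertices of degree $0$ in $Y_x$, of degree $1$ in $Y_q$, of degree $2$ in $Y_z$, respectively (degree $0,1,2$ meaning $X$-check, qubit, $Z$-check). For vertices $u,v$ of $T_{(i-1)}$ let $\mathrm{dist}(u,v)\in\mathbb N\cup\{\infty\}$ be the least length of a path from $u$ to $v$ along edges directed from $V_X$ to $V_Q$ and from $V_Q$ to $V_Z$, and for $\sigma\in C^2_{(i)}$ put $\xi_v(r)=\sum_{v':\,\mathrm{dist}(v',v)\le r}\sigma|_{Y_{v'}}$. A map $\sigma\mapsto(\sigma',f)$ is \emph{locally computable} if $f=\sum_v f_v$ with $f|_{Y_v}=f_v$, where each $f_v$ is a function of $\xi_v(1)$ only, and each value $\sigma'_z$, $z\in V_Z$, is a function of $\xi_z(2)$ only. \textbf{Theorem.} For every odd $\ell\ge3$ and every $\mathcal R_X$ level $i=2k+1$ there is a locally computable map $\sigma\mapsto(\sigma',f)$ from $B^2(C_{(i)})$ to $B^2(C_{(i-1)})\times C^1_{(i)}$ such that, for all $\sigma\in B^2(C_{(i)})$, $$\sigma=\delta^1_{i}f+\mathcal F_{\mathcal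 R_X}(\sigma'),\qquad |\sigma'|\le\tfrac12|\sigma|.$$ -/

import Mathlib

open scoped Classical

noncomputable section

/-! ### Tanner square complexes and their CSS codes -/

/-- A (finite, purely two-dimensional) Tanner square complex.  Vertices carry a degree: `X`-checks
have degree `0`, qubits degree `1` and `Z`-checks degree `2`.  A face `f` is a square with boundary
cycle `(x f, q₀ f, z f, q₁ f)`.  Its edges are the sides of its faces. -/
structure TannerComplex where
  V : Type
  F : Type
  finV : Finite V
  finF : Finite F
  deg : V → ℕ
  x : F → V
  q₀ : F → V
  q₁ : F → V
  z : F → V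
  deg_x : ∀ f, deg (x f) = 0
  deg_q₀ : ∀ f, deg (q₀ f) = 1
  deg_q₁ : ∀ f, deg (q₁ f) = 1
  deg_z : ∀ f, deg (z f) = 2
  q_ne : ∀ f, q₀ f ≠ q₁ f

namespace TannerComplex

instance (T : TannerComplex) : Finite T.V := T.finV
instance (T : TannerComplex) : Finite T.F := T.finF
instance (T : TannerComplex) : Fintype T.V := Fintype.ofFinite _

/-- The edges of `T` (the Tanner graph), each directed from `V_X` to `V_Q` or from `V_Q` to `V_Z`:
they are the sides of the squares. -/
def Adj (T : TannerComplex) (u w : T.V) : Prop :=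
  ∃ f : T.F, (u = T.x f ∧ w = T.q₀ f) ∨ (u = T.x f ∧ w = T.q₁ f) ∨
    (u = T.q₀ f ∧ w = T.z f) ∨ (u = T.q₁ f ∧ w = T.z f)

/-- Vertices of degree `i`: `V_X`, `V_Q`, `V_Z` for `i = 0, 1, 2`. -/
abbrev VDeg (T : TannerComplex) (i : ℕ) : Type := {v : T.V // T.deg v = i}

/-- The cochain space `C^i = 𝔽₂^{V_i}` of the code of `T`. -/
abbrev C (T : TannerComplex) (i : ℕ) : Type := T.VDeg i → ZMod 2

/-- The coboundary map `δ^i : C^i → C^{i+1}`, the adjacency map of the Tanner graph. -/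
def δ (T : TannerComplex) (i : ℕ) : T.C i →ₗ[ZMod 2] T.C (i + 1) where
  toFun c w := ∑ u : T.VDeg i, if T.Adj u.1 w.1 then c u else 0
  map_add' c d := by
    ext w
    simp only [Pi.add_apply, ← Finset.sum_add_distrib]
    exact Finset.sum_congr rfl fun u _ => by split_ifs <;> simp
  map_smul' r c := by
    ext w
    simp [Finset.mul_sum]

/-- The space of (Pauli-`X` error) syndromes `B² = im δ¹`. -/
def B2 (T : TannerComplex) : Submodule (ZMod 2) (T.C 2) := LinearMap.range (T.δ 1)

/-- The dual complex: the roles of `X`-checks and `Z`-checks are exchanged. -/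
def dual (T : TannerComplex) : TannerComplex where
  V := T.V
  F := T.F
  finV := T.finV
  finF := T.finF
  deg v := 2 - T.deg v
  x := T.z
  q₀ := T.q₀
  q₁ := T.q₁
  z := T.x
  deg_x f := by simp [T.deg_z f]
  deg_q₀ f := by simp [T.deg_q₀ f]
  deg_q₁ f := by simp [T.deg_q₁ f]
  deg_z f := by simp [T.deg_x f]
  q_ne := T.q_ne

/-- The level-`0` complex: the `[[5,1,2]]` surface code on the `3 × 3` grid.  The four corners and
the centre are qubits, the midpoints of the top and bottom rows are `X`-checks, the midpoints of the
left and right columns are `Z`-checks, and the faces are the four unit squares. -/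
def surfaceCode : TannerComplex where
  V := Fin 3 × Fin 3
  F := Bool × Bool
  finV := inferInstance
  finF := inferInstance
  deg v := 1 + v.1.val % 2 - v.2.val % 2
  x f := (if f.1 then 2 else 0, 1)
  q₀ f := (if f.1 then 2 else 0, if f.2 then 2 else 0)
  q₁ _ := (1, 1)
  z f := (1, if f.2 then 2 else 0)
  deg_x f := by rcases f with ⟨_ | _, _ | _⟩ <;> rfl
  deg_q₀ f := by rcases f with ⟨_ | _, _ | _⟩ <;> rfl
  deg_q₁ f := by rcases f with ⟨_ | _, _ | _⟩ <;> rfl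
  deg_z f := by rcases f with ⟨_ | _, _ | _⟩ <;> rfl
  q_ne f := by rcases f with ⟨_ | _, _ | _⟩ <;> decide

/-! ### The replacement step

Write `ℓ = 2 m + 1`.  The square complex `U_X` has the vertices `(a, b, h)` with `0 ≤ a, b ≤ ℓ`
and `h ∈ {0, 1, 2}`; `h = 0` and `h = 2` are the two layers, and the intermediate height `h = 1`
occurs only on the two walls `a = 2 m` and `b = 2 m`.  The corners `x, q₀, q₁, z` of the square
being replaced sit at `(a, b) = (0, 0), (ℓ, 0), (0, ℓ), (ℓ, ℓ)`.  The degree of a vertex is the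
number of its odd coordinates. -/

/-- The vertices of `U_X`. -/
def slab (m : ℕ) : Finset (ℕ × ℕ × ℕ) :=
  (Finset.range (2 * m + 2) ×ˢ Finset.range (2 * m + 2) ×ˢ Finset.range 3).filter
    fun p => p.2.2 = 1 → p.1 = 2 * m ∨ p.2.1 = 2 * m

/-- Index set of the unit squares of `U_X`: `inl (i, j, s)` is the square `[i, i+1] × [j, j+1]` of
the layer `h = 2 s`; `inr (false, j, s)` is the square `[j, j+1] × [s, s+1]` of the wall `a = 2 m`;
`inr (true, i, s)` is the square `[i, i+1] × [s, s+1]` of the wall `b = 2 m`. -/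
abbrev SlabSquare (m : ℕ) : Type :=
  (Fin (2 * m + 1) × Fin (2 * m + 1) × Fin 2) ⊕ (Bool × Fin (2 * m + 1) × Fin 2)

/-- The end point of the unit interval `[i, i+1]` whose parity is `ε ∈ {0, 1}`. -/
def endpt (i ε : ℕ) : ℕ := if i % 2 = ε then i else i + 1

/-- The corner of a unit square of `U_X` whose two varying coordinates have parities `ε`, `ε'`. -/
def squareCorner (m : ℕ) (S : SlabSquare m) (ε ε' : ℕ) : ℕ × ℕ × ℕ :=
  match S with
  | .inl (i, j, s) => (endpt i ε, endpt j ε', 2 * s)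
  | .inr (false, j, s) => (2 * m, endpt j ε, endpt s ε')
  | .inr (true, i, s) => (endpt i ε, 2 * m, endpt s ε')

/-- Names for the vertices of the glued complex.  A vertex of a copy of `U_X` lying on a corner
subcomplex is named by the corresponding vertex `v` of `T` and its height; one lying on a boundary
subcomplex by the corresponding edge `u → w` of `T`, the distance `k` from the end `u`, and the
height; every other one by the face being replaced and its three coordinates. -/
inductive Label (T : TannerComplex) : Type
  | onVertex (v : T.V) (h : ℕ)
  | onEdge (u w : T.V) (k h : ℕ)
  | onFace (f : T.F) (a b h : ℕ)

/-- The name of the vertex `(a, b, h)` of the copy of `U_X` that replaces `f`.  Vertices of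
different copies are glued exactly if their names agree. -/
def place (T : TannerComplex) (m : ℕ) (f : T.F) (p : ℕ × ℕ × ℕ) : T.Label :=
  if p.1 = 0 then
    if p.2.1 = 0 then .onVertex (T.x f) p.2.2
    else if p.2.1 = 2 * m + 1 then .onVertex (T.q₁ f) p.2.2
    else .onEdge (T.x f) (T.q₁ f) p.2.1 p.2.2
  else if p.1 = 2 * m + 1 then
    if p.2.1 = 0 then .onVertex (T.q₀ f) p.2.2
    else if p.2.1 = 2 * m + 1 then .onVertex (T.z f) p.2.2
    else .onEdge (T.q₀ f) (T.z f) p.2.1 p.2.2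
  else
    if p.2.1 = 0 then .onEdge (T.x f) (T.q₀ f) p.1 p.2.2
    else if p.2.1 = 2 * m + 1 then .onEdge (T.q₁ f) (T.z f) p.1 p.2.2
    else .onFace f p.1 p.2.1 p.2.2

/-- The degree of a vertex of the glued complex. -/
def labelDeg (T : TannerComplex) : T.Label → ℕ
  | .onVertex v h => T.deg v + h % 2
  | .onEdge u _ k h => T.deg u + k % 2 + h % 2
  | .onFace _ a b h => a % 2 + b % 2 + h % 2

/-- The vertex `v` of `T` whose local complex `Y_v` contains the given vertex of the glued complex.
With `f` containing `x`: `Y_x` consists of the `(a, b, h)` with `a, b ≤ 2 m`, that is, of the cells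
of two subdivided copies of `X_x` and of the cylinder over the subdivided `∂X_x`.  `Y_q` lies over
the vertex `q` and the edges from `q` to `V_Z`, and `Y_z` consists of two points over `z`. -/
def labelOwner (T : TannerComplex) : T.Label → T.V
  | .onVertex v _ => v
  | .onEdge u _ _ _ => u
  | .onFace f _ _ _ => T.x f

theorem labelDeg_place (T : TannerComplex) (m : ℕ) (f : T.F) (p : ℕ × ℕ × ℕ) :
    T.labelDeg (T.place m f p) = p.1 % 2 + p.2.1 % 2 + p.2.2 % 2 := by
  have hx := T.deg_x f
  have hq₀ := T.deg_q₀ f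
  have hq₁ := T.deg_q₁ f
  have hz := T.deg_z f
  unfold place
  split_ifs <;> simp only [labelDeg] <;> omega

theorem place_injective (T : TannerComplex) (m : ℕ) (f : T.F) :
    Function.Injective (T.place m f) := by
  rintro ⟨a, b, h⟩ ⟨a', b', h'⟩ hp
  have hx := T.deg_x f
  have hq₀ := T.deg_q₀ f
  have hq₁ := T.deg_q₁ f
  have hz := T.deg_z f
  have hq := T.q_ne f
  simp only [place] at hp
  grind

theorem endpt_zero_mod (i : ℕ) : endpt i 0 % 2 = 0 := by
  unfold endpt; split_ifs <;> omega

theorem endpt_one_mod (i : ℕ) : endpt i 1 % 2 = 1 := by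
  unfold endpt; split_ifs <;> omega

theorem endpt_cases (i ε : ℕ) : endpt i ε = i ∨ endpt i ε = i + 1 := by
  unfold endpt; split_ifs <;> simp

theorem squareCorner_mem (m : ℕ) (S : SlabSquare m) (ε ε' : ℕ) :
    squareCorner m S ε ε' ∈ slab m := by
  rcases S with ⟨i, j, s⟩ | ⟨_ | _, i, s⟩
  · have := endpt_cases i ε
    have := endpt_cases j ε'
    simp only [squareCorner, slab, Finset.mem_filter, Finset.mem_product, Finset.mem_range]
    omega
  all_goals
    have := endpt_cases i ε
    have := endpt_cases s ε'
    have := i.isLt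
    have := s.isLt
    simp only [squareCorner, slab, Finset.mem_filter, Finset.mem_product, Finset.mem_range,
      true_or, or_true, implies_true, and_true]
    omega

/-- The four corners of a unit square of the copy of `U_X` replacing `f`, as glued vertices. -/
def glued (T : TannerComplex) (m : ℕ) (g : T.F × SlabSquare m) (ε ε' : ℕ) :
    {L : T.Label // ∃ f : T.F, ∃ p ∈ slab m, L = T.place m f p} :=
  ⟨T.place m g.1 (squareCorner m g.2 ε ε'), g.1, _, squareCorner_mem m g.2 ε ε', rfl⟩

/-- The replacement step `𝓡_X` with subdivision parameter `ℓ = 2 m + 1`: every face of `T` is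
replaced with a copy of `U_X`, and adjacent copies are glued along boundary and corner
subcomplexes. -/
def RX (m : ℕ) (T : TannerComplex) : TannerComplex where
  V := {L : T.Label // ∃ f : T.F, ∃ p ∈ slab m, L = T.place m f p}
  F := T.F × SlabSquare m
  finV := by
    refine Finite.of_surjective
      (fun g : T.F × slab m => ⟨T.place m g.1 g.2.1, g.1, g.2.1, g.2.2, rfl⟩) ?_
    rintro ⟨_, f, p, hp, rfl⟩
    exact ⟨(f, ⟨p, hp⟩), rfl⟩
  finF := inferInstance
  deg L := T.labelDeg L.1
  x g := T.glued m g 0 0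
  q₀ g := T.glued m g 1 0
  q₁ g := T.glued m g 0 1
  z g := T.glued m g 1 1
  deg_x g := by
    rcases g with ⟨f, ⟨i, j, s⟩ | ⟨_ | _, i, s⟩⟩ <;>
      simp [glued, labelDeg_place, squareCorner, endpt_zero_mod]
  deg_q₀ g := by
    rcases g with ⟨f, ⟨i, j, s⟩ | ⟨_ | _, i, s⟩⟩ <;>
      simp [glued, labelDeg_place, squareCorner, endpt_zero_mod, endpt_one_mod]
  deg_q₁ g := by
    rcases g with ⟨f, ⟨i, j, s⟩ | ⟨_ | _, i, s⟩⟩ <;>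
      simp [glued, labelDeg_place, squareCorner, endpt_zero_mod, endpt_one_mod]
  deg_z g := by
    rcases g with ⟨f, ⟨i, j, s⟩ | ⟨_ | _, i, s⟩⟩ <;>
      simp [glued, labelDeg_place, squareCorner, endpt_one_mod]
  q_ne g h := by
    have h' := T.place_injective m g.1 (Subtype.ext_iff.mp h)
    rcases g with ⟨f, ⟨i, j, s⟩ | ⟨_ | _, i, s⟩⟩ <;>
      simp only [squareCorner, Prod.mk.injEq] at h'
    · have := endpt_zero_mod i; have := endpt_one_mod i; omega
    · have := endpt_zero_mod i; have := endpt_one_mod i; omega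
    · have := endpt_zero_mod i; have := endpt_one_mod i; omega

/-- The replacement step `𝓡_Z`: the same construction with `X` and `Z` exchanged. -/
def RZ (m : ℕ) (T : TannerComplex) : TannerComplex := (RX m T.dual).dual

/-- The Tanner square complex at level `2 k`, namely `(𝓡_Z ∘ 𝓡_X)^k` of the surface code. -/
def evenLevel (m : ℕ) : ℕ → TannerComplex
  | 0 => surfaceCode
  | k + 1 => RZ m (RX m (evenLevel m k))

/-! ### Structure of an `𝓡_X` level over the previous level -/

/-- The vertices of `RX m T` are distributed over the local complexes `Y_v`, `v` a vertex of `T`. -/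
def owner (T : TannerComplex) (m : ℕ) (p : (RX m T).V) : T.V := T.labelOwner p.1

/-- The cochain map `𝓕_{𝓡_X} : C(T) → C(RX m T)`.  The local complexes satisfy
`H⁰(C_x) = 𝔽₂`, `H¹(C_q) = 𝔽₂`, `H²(C_z) = 𝔽₂²`, and a basis element `x`, `q`, `z` of `C(T)` is sent
to the all-one cochain on `C_x^0`, `C_q^1`, `C_z^2`: the cochain `1` on `Y_x`, the cochain `1` on
`Y_q`, and the diagonal element `(1, 1)` of `C_z^2`, respectively. -/
def lift (T : TannerComplex) (m i : ℕ) : T.C i →ₗ[ZMod 2] (RX m T).C i where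
  toFun c p := if h : T.deg (T.owner m p.1) = i then c ⟨T.owner m p.1, h⟩ else 0
  map_add' c d := by
    ext p
    by_cases h : T.deg (T.owner m p.1) = i <;> simp [h]
  map_smul' r c := by
    ext p
    by_cases h : T.deg (T.owner m p.1) = i <;> simp [h]

/-- The restriction `c|_{Y_v}` of a cochain to a local complex, extended by zero. -/
def restr (T : TannerComplex) (m : ℕ) {i : ℕ} (v : T.V) (c : (RX m T).C i) : (RX m T).C i :=
  fun p => if T.owner m p.1 = v then c p else 0

/-- There is a directed path of length `n` from `u` to `w` in the Tanner graph of `T`. -/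
def DirPath (T : TannerComplex) : ℕ → T.V → T.V → Prop
  | 0, u, w => u = w
  | n + 1, u, w => ∃ v, T.DirPath n u v ∧ T.Adj v w

/-- The directed distance, `⊤` if there is no directed path. -/
def dirDist (T : TannerComplex) (u w : T.V) : ℕ∞ :=
  ⨅ (n : ℕ) (_ : T.DirPath n u w), (n : ℕ∞)

/-- `ξ_v(r)`: the part of the syndrome in the local complexes `Y_{v'}` with directed distance from
`v'` to `v` at most `r`. -/
def nearby (T : TannerComplex) (m : ℕ) (v : T.V) (r : ℕ) (σ : (RX m T).C 2) : (RX m T).C 2 :=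
  ∑ v' : T.V with T.dirDist v' v ≤ r, T.restr m v' σ

/-- The correction is a sum of local components, the one at `v` being supported on `Y_v` and
depending only on the syndrome within directed distance `1`. -/
def CorrectionLocal (T : TannerComplex) (m : ℕ) (f : (RX m T).B2 → (RX m T).C 1) : Prop :=
  ∃ φ : T.V → (RX m T).C 2 → (RX m T).C 1, ∀ σ : (RX m T).B2,
    f σ = ∑ v : T.V, φ v (T.nearby m v 1 σ) ∧
    ∀ v : T.V, T.restr m v (f σ) = φ v (T.nearby m v 1 σ)

/-- The value of the coarse-grained syndrome at `z` depends only on the syndrome within directed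
distance `2`. -/
def SyndromeLocal (T : TannerComplex) (m : ℕ) (s : (RX m T).B2 → T.B2) : Prop :=
  ∃ ψ : T.VDeg 2 → (RX m T).C 2 → ZMod 2, ∀ (σ : (RX m T).B2) (z : T.VDeg 2),
    (s σ).1 z = ψ z (T.nearby m z.1 2 σ)

end TannerComplex

end

noncomputable section

namespace TannerComplex

/-! ### Unit steps and unit squares of the slab -/

/-! Picture `Y_x` as two copies (the layers `h = 0, 2`) of the subdivided star of `x`, joined along
their rims by a wall; `Y_q` as two copies of a star graph with one arm for each edge `q → z`, the
two copies of each arm joined at the tip; and `Y_z` as two points. Coboundaries flow only from `Y_x`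
to `Y_q` to `Y_z` (`owner_of_adj`). The correction first clears every `Y_x`, then every `Y_q`, each
time by a local cochain that emits into later local complexes at most as many excitations as it
removes (`Fills`). So the weight never grows (`hammingNorm_add_δ_le`), and the final syndrome lives
on the `Y_z`. There it takes equal values on the two points over each `z`, so the coarse syndrome
has at most half the weight (`two_mul_hammingNorm_le`).

In `Y_x` (`exists_fills_x`), write `σ = δ g` and change `g` by a coboundary so that it vanishes on
the vertical edges of the wall and, in the layer `t` with fewer excitations, on one of the two
directions. Each emission from layer `t` is then a row sum of syndromes, hence charged to an
excitation of its row. An emission from the other layer is charged either to an excited wall check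
or to the same row of layer `t`. This uses the excitations of layer `t` at most twice and those of
the wall at most once, which suffices by the choice of `t`.

In `Y_q` (`exists_fills_q`), there are two candidates, differing by the constant `1`. If `g` agrees
at the two centres, the candidate vanishing there emits only through arms containing an excitation.
Otherwise every loop formed by the two copies of an arm contains an excitation, and the better of
the two candidates emits at most once per arm on average.

That the remainder is a lift needs cohomology. A cochain closed on all `Y_x` is cohomologous to one
vanishing there (`exists_vanishing`); one that vanishes on the `Y_x` and is closed on the `Y_q` is
constant on each `Y_q`, that is, a lift (`eq_lift`), and lifting commutes with `δ` (`δ_lift`). The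
preimage `g` is a global object, but it serves only to prove existence; the corrections themselves
are chosen from the local syndrome.

Two properties of the levels are used: `PathUnique`, which gives `δ δ = 0`, and `LinkConnected`,
which makes the wall of `Y_x` connected. Both are carried through the recursion by
`evenLevel_invariants`. -/

theorem mem_slab {m a b h : ℕ} :
    (a, b, h) ∈ slab m ↔ a ≤ 2 * m + 1 ∧ b ≤ 2 * m + 1 ∧ h ≤ 2 ∧ (h = 1 → a = 2 * m ∨ b = 2 * m) := by
  simp only [slab, Finset.mem_filter, Finset.mem_product, Finset.mem_range]
  omega

/-- `p'` arises from `p` by moving one even coordinate to an adjacent odd value. -/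
def Step (p p' : ℕ × ℕ × ℕ) : Prop :=
  (p.1 % 2 = 0 ∧ (p'.1 = p.1 + 1 ∨ p.1 = p'.1 + 1) ∧ p'.2.1 = p.2.1 ∧ p'.2.2 = p.2.2) ∨
  (p.2.1 % 2 = 0 ∧ (p'.2.1 = p.2.1 + 1 ∨ p.2.1 = p'.2.1 + 1) ∧ p'.1 = p.1 ∧ p'.2.2 = p.2.2) ∨
  (p.2.2 % 2 = 0 ∧ (p'.2.2 = p.2.2 + 1 ∨ p.2.2 = p'.2.2 + 1) ∧ p'.1 = p.1 ∧ p'.2.1 = p.2.1)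

theorem endpt_ext {i j : ℕ} (h₀ : endpt i 0 = endpt j 0) (h₁ : endpt i 1 = endpt j 1) : i = j := by
  unfold endpt at *; split_ifs at * <;> omega

theorem endpt_step (i : ℕ) :
    endpt i 0 % 2 = 0 ∧ (endpt i 1 = endpt i 0 + 1 ∨ endpt i 0 = endpt i 1 + 1) := by
  unfold endpt; split_ifs <;> omega

theorem endpt_min {a b : ℕ} (ha : a % 2 = 0) (hab : b = a + 1 ∨ a = b + 1) :
    endpt (min a b) 0 = a ∧ endpt (min a b) 1 = b := by
  unfold endpt
  rcases hab with rfl | rfl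
  · rw [min_eq_left (by omega)]; split_ifs <;> omega
  · rw [min_eq_right (by omega)]; split_ifs <;> omega

theorem squareCorner_step (m : ℕ) (S : SlabSquare m) :
    Step (squareCorner m S 0 0) (squareCorner m S 1 0) ∧
    Step (squareCorner m S 0 0) (squareCorner m S 0 1) ∧
    Step (squareCorner m S 1 0) (squareCorner m S 1 1) ∧
    Step (squareCorner m S 0 1) (squareCorner m S 1 1) := by
  rcases S with ⟨i, j, s⟩ | ⟨_ | _, i, s⟩
  · have := endpt_step i; have := endpt_step j
    simp only [squareCorner, Step, and_true, true_and]; omega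
  · have := endpt_step i; have := endpt_step s
    simp only [squareCorner, Step, and_true, true_and]; omega
  · have := endpt_step i; have := endpt_step s
    simp only [squareCorner, Step, and_true, true_and]; omega

/-- The two opposite corners give both end points of each varying interval, and the one coordinate
on which they agree tells a layer from either wall. -/
theorem squareCorner_ext {m : ℕ} {S S' : SlabSquare m}
    (h₀ : squareCorner m S 0 0 = squareCorner m S' 0 0)
    (h₁ : squareCorner m S 1 1 = squareCorner m S' 1 1) : S = S' := by
  rcases S with ⟨i, j, s⟩ | ⟨_ | _, i, s⟩ <;> rcases S' with ⟨i', j', s'⟩ | ⟨_ | _, i', s'⟩ <;>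
    simp only [squareCorner, Prod.mk.injEq] at h₀ h₁
  · have e₁ := endpt_ext h₀.1 h₁.1
    have e₂ := endpt_ext h₀.2.1 h₁.2.1
    have e₃ : (s : ℕ) = s' := by omega
    rw [Fin.ext e₁, Fin.ext e₂, Fin.ext e₃]
  · have := endpt_step i; omega
  · have := endpt_step j; omega
  · have := endpt_step i'; omega
  · have e₁ := endpt_ext h₀.2.1 h₁.2.1
    have e₂ := endpt_ext h₀.2.2 h₁.2.2
    rw [Fin.ext e₁, Fin.ext e₂]
  · have := endpt_step i; omega
  · have := endpt_step j'; omega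
  · have := endpt_step i; omega
  · have e₁ := endpt_ext h₀.1 h₁.1
    have e₂ := endpt_ext h₀.2.2 h₁.2.2
    rw [Fin.ext e₁, Fin.ext e₂]

/-- Two consecutive unit steps are two sides of a unit square. -/
theorem exists_square {m : ℕ} {p p' p'' : ℕ × ℕ × ℕ} (hp : p ∈ slab m) (hp'' : p'' ∈ slab m)
    (hd : p.1 % 2 + p.2.1 % 2 + p.2.2 % 2 = 0) (h : Step p p') (h' : Step p' p'') :
    ∃ S : SlabSquare m, squareCorner m S 0 0 = p ∧ squareCorner m S 1 1 = p'' ∧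
      (squareCorner m S 1 0 = p' ∨ squareCorner m S 0 1 = p') := by
  obtain ⟨a, b, c⟩ := p
  obtain ⟨a', b', c'⟩ := p'
  obtain ⟨a'', b'', c''⟩ := p''
  rw [mem_slab] at hp hp''
  simp only [Step] at h h' hd
  rcases h with ⟨e, hs, rfl, rfl⟩ | ⟨e, hs, rfl, rfl⟩ | ⟨e, hs, rfl, rfl⟩ <;>
    rcases h' with ⟨e', hs', rfl, rfl⟩ | ⟨e', hs', rfl, rfl⟩ | ⟨e', hs', rfl, rfl⟩
  · omega
  · obtain ⟨h₁, h₂⟩ := endpt_min e hs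
    obtain ⟨h₃, h₄⟩ := endpt_min e' hs'
    refine ⟨.inl (⟨min a a'', by omega⟩, ⟨min b' b'', by omega⟩, ⟨c'' / 2, by omega⟩), ?_⟩
    have : 2 * (c'' / 2) = c'' := by omega
    simp [squareCorner, *]
  · obtain ⟨h₁, h₂⟩ := endpt_min e hs
    obtain ⟨h₃, h₄⟩ := endpt_min e' hs'
    refine ⟨.inr (true, ⟨min a a'', by omega⟩, ⟨min c' c'', by omega⟩), ?_⟩
    have : b'' = 2 * m := by omega
    simp [squareCorner, *]
  · obtain ⟨h₁, h₂⟩ := endpt_min e hs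
    obtain ⟨h₃, h₄⟩ := endpt_min e' hs'
    refine ⟨.inl (⟨min a' a'', by omega⟩, ⟨min b b'', by omega⟩, ⟨c'' / 2, by omega⟩), ?_⟩
    have : 2 * (c'' / 2) = c'' := by omega
    simp [squareCorner, *]
  · omega
  · obtain ⟨h₁, h₂⟩ := endpt_min e hs
    obtain ⟨h₃, h₄⟩ := endpt_min e' hs'
    refine ⟨.inr (false, ⟨min b b'', by omega⟩, ⟨min c' c'', by omega⟩), ?_⟩
    have : a'' = 2 * m := by omega
    simp [squareCorner, *]
  · obtain ⟨h₁, h₂⟩ := endpt_min e hs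
    obtain ⟨h₃, h₄⟩ := endpt_min e' hs'
    refine ⟨.inr (true, ⟨min a' a'', by omega⟩, ⟨min c c'', by omega⟩), ?_⟩
    have : b'' = 2 * m := by omega
    simp [squareCorner, *]
  · obtain ⟨h₁, h₂⟩ := endpt_min e hs
    obtain ⟨h₃, h₄⟩ := endpt_min e' hs'
    refine ⟨.inr (false, ⟨min b' b'', by omega⟩, ⟨min c c'', by omega⟩), ?_⟩
    have : a'' = 2 * m := by omega
    simp [squareCorner, *]
  · omega

/-! ### Labels -/

variable {T : TannerComplex} {m : ℕ}

/-- An interior name remembers its copy and its coordinates, so it pins down the face. The vertex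
and edge names treated next leave several positions possible, in several copies. -/
theorem place_eq_onFace {f f' : T.F} {p : ℕ × ℕ × ℕ} {a b h : ℕ} :
    T.place m f p = .onFace f' a b h ↔
      f = f' ∧ p = (a, b, h) ∧ a ≠ 0 ∧ a ≠ 2 * m + 1 ∧ b ≠ 0 ∧ b ≠ 2 * m + 1 := by
  obtain ⟨a₁, b₁, h₁⟩ := p
  unfold place
  split_ifs <;> try simp only [Label.onFace.injEq, Prod.mk.injEq]
  all_goals grind

theorem place_eq_onVertex {f : T.F} {a b h : ℕ} {v : T.V} {k : ℕ} :
    T.place m f (a, b, h) = .onVertex v k ↔ h = k ∧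
      ((a = 0 ∧ b = 0 ∧ T.x f = v) ∨ (a = 0 ∧ b = 2 * m + 1 ∧ T.q₁ f = v) ∨
       (a = 2 * m + 1 ∧ b = 0 ∧ T.q₀ f = v) ∨ (a = 2 * m + 1 ∧ b = 2 * m + 1 ∧ T.z f = v)) := by
  unfold place
  split_ifs <;> try simp only [Label.onVertex.injEq]
  all_goals grind

theorem place_eq_onEdge {f : T.F} {a b h : ℕ} {u w : T.V} {k l : ℕ} :
    T.place m f (a, b, h) = .onEdge u w k l ↔ h = l ∧ k ≠ 0 ∧ k ≠ 2 * m + 1 ∧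
      ((a = 0 ∧ b = k ∧ T.x f = u ∧ T.q₁ f = w) ∨ (a = 2 * m + 1 ∧ b = k ∧ T.q₀ f = u ∧ T.z f = w) ∨
       (a = k ∧ b = 0 ∧ T.x f = u ∧ T.q₀ f = w) ∨
       (a = k ∧ b = 2 * m + 1 ∧ T.q₁ f = u ∧ T.z f = w)) := by
  unfold place
  split_ifs <;> try simp only [Label.onEdge.injEq]
  all_goals grind

/-! ### Adjacency in the glued complex -/

theorem Adj.deg_eq {S : TannerComplex} {u w : S.V} (h : S.Adj u w) : S.deg w = S.deg u + 1 := by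
  obtain ⟨f, h | h | h | h⟩ := h <;> rw [h.1, h.2] <;>
    simp [S.deg_x, S.deg_q₀, S.deg_q₁, S.deg_z]

/-- Adjacency is defined through squares; this replaces it by coordinates. The content is that no
unit step of the slab is isolated: each is a side of some unit square. -/
theorem adj_iff {u w : (RX m T).V} : (RX m T).Adj u w ↔ ∃ f p p', p ∈ slab m ∧ p' ∈ slab m ∧
    u.1 = T.place m f p ∧ w.1 = T.place m f p' ∧ Step p p' := by
  constructor
  · rintro ⟨⟨f, S⟩, h⟩
    obtain ⟨h₁, h₂, h₃, h₄⟩ := squareCorner_step m S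
    have hm := squareCorner_mem m S
    obtain ⟨rfl, rfl⟩ | ⟨rfl, rfl⟩ | ⟨rfl, rfl⟩ | ⟨rfl, rfl⟩ := h
    exacts [⟨f, _, _, hm _ _, hm _ _, rfl, rfl, h₁⟩, ⟨f, _, _, hm _ _, hm _ _, rfl, rfl, h₂⟩,
      ⟨f, _, _, hm _ _, hm _ _, rfl, rfl, h₃⟩, ⟨f, _, _, hm _ _, hm _ _, rfl, rfl, h₄⟩]
  · rintro ⟨f, p, p', hp, hp', hu, hw, h⟩
    -- Prolong the step to a path from an X-check through a qubit to a Z-check, forwards or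
    -- backwards according to where it starts; such a path spans a square.
    have key : (∃ p₁, p₁ ∈ slab m ∧ p.1 % 2 + p.2.1 % 2 + p.2.2 % 2 = 0 ∧ Step p' p₁) ∨
        (∃ p₀, p₀ ∈ slab m ∧ p₀.1 % 2 + p₀.2.1 % 2 + p₀.2.2 % 2 = 0 ∧ Step p₀ p) := by
      obtain ⟨a, b, c⟩ := p
      obtain ⟨a', b', c'⟩ := p'
      rw [mem_slab] at hp hp'
      simp only [Step] at h ⊢
      by_cases hd : a % 2 + b % 2 + c % 2 = 0
      · left
        rcases h with h | h | h
        · exact ⟨(a', b + 1, c'), by rw [mem_slab]; omega, by omega, by simp only [and_true]; omega⟩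
        · exact ⟨(a + 1, b', c'), by rw [mem_slab]; omega, by omega, by simp only [and_true]; omega⟩
        · by_cases ha : a = 2 * m
          · exact ⟨(a, b + 1, c'), by rw [mem_slab]; omega, by omega, by simp only [and_true]; omega⟩
          · exact ⟨(a + 1, b, c'), by rw [mem_slab]; omega, by omega, by simp only [and_true]; omega⟩
      · right
        by_cases ha : a % 2 = 1
        · exact ⟨(a - 1, b, c), by rw [mem_slab]; omega, by simp only; omega, by simp only [and_true]; omega⟩
        by_cases hb : b % 2 = 1
        · exact ⟨(a, b - 1, c), by rw [mem_slab]; omega, by simp only; omega, by simp only [and_true]; omega⟩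
        · exact ⟨(a, b, 0), by rw [mem_slab]; omega, by simp only; omega, by simp only [and_true, true_and]; omega⟩
    obtain ⟨p₁, hp₁, hd, h₁⟩ | ⟨p₀, hp₀, hd, h₀⟩ := key
    · obtain ⟨S, e₀, e₁, e | e⟩ := exists_square hp hp₁ hd h h₁
      · exact ⟨(f, S), .inl ⟨Subtype.ext (by rw [hu, ← e₀]; rfl), Subtype.ext (by rw [hw, ← e]; rfl)⟩⟩
      · exact ⟨(f, S), .inr <| .inl
          ⟨Subtype.ext (by rw [hu, ← e₀]; rfl), Subtype.ext (by rw [hw, ← e]; rfl)⟩⟩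
    · obtain ⟨S, e₀, e₁, e | e⟩ := exists_square hp₀ hp' hd h₀ h
      · exact ⟨(f, S), .inr <| .inr <| .inl
          ⟨Subtype.ext (by rw [hu, ← e]; rfl), Subtype.ext (by rw [hw, ← e₁]; rfl)⟩⟩
      · exact ⟨(f, S), .inr <| .inr <| .inr
          ⟨Subtype.ext (by rw [hu, ← e]; rfl), Subtype.ext (by rw [hw, ← e₁]; rfl)⟩⟩

variable {T : TannerComplex} {m : ℕ}

/-! ### Paths and links -/

/-- Every directed path from an `X`-check through a qubit to a `Z`-check lies on exactly one face. -/
def PathUnique (T : TannerComplex) : Prop :=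
  ∀ (q : T.V) (f₁ f₂ : T.F), (T.q₀ f₁ = q ∨ T.q₁ f₁ = q) → (T.q₀ f₂ = q ∨ T.q₁ f₂ = q) →
    ∃! f, T.x f = T.x f₁ ∧ T.z f = T.z f₂ ∧ (T.q₀ f = q ∨ T.q₁ f = q)

/-- The links of the `X`-checks are connected. -/
def LinkConnected (T : TannerComplex) : Prop :=
  ∀ (χ : T.V → ZMod 2) (u : T.V), (∀ g, T.x g = u → χ (T.q₀ g) = χ (T.q₁ g)) →
    ∀ g g', T.x g = u → T.x g' = u → χ (T.q₀ g) = χ (T.q₀ g')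

theorem PathUnique.dual (h : T.PathUnique) : T.dual.PathUnique := by
  intro q f₁ f₂ h₁ h₂
  obtain ⟨f, hf, hu⟩ := h q f₂ f₁ h₂ h₁
  exact ⟨f, ⟨hf.2.1, hf.1, hf.2.2⟩, fun g hg => hu g ⟨hg.2.1, hg.1, hg.2.2⟩⟩

theorem adj_x_q {u w : T.V} (hw : T.deg w = 1) (h : T.Adj u w) :
    ∃ f, T.x f = u ∧ (T.q₀ f = w ∨ T.q₁ f = w) := by
  obtain ⟨f, ⟨rfl, rfl⟩ | ⟨rfl, rfl⟩ | ⟨rfl, rfl⟩ | ⟨rfl, rfl⟩⟩ := h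
  · exact ⟨f, rfl, .inl rfl⟩
  · exact ⟨f, rfl, .inr rfl⟩
  all_goals simp [T.deg_z] at hw

theorem adj_q_z {u w : T.V} (hu : T.deg u = 1) (h : T.Adj u w) :
    ∃ f, T.z f = w ∧ (T.q₀ f = u ∨ T.q₁ f = u) := by
  obtain ⟨f, ⟨rfl, rfl⟩ | ⟨rfl, rfl⟩ | ⟨rfl, rfl⟩ | ⟨rfl, rfl⟩⟩ := h
  iterate 2 simp [T.deg_x] at hu
  · exact ⟨f, rfl, .inl rfl⟩
  · exact ⟨f, rfl, .inr rfl⟩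

theorem PathUnique.exists_face (h : T.PathUnique) {u w v : T.V} (hw : T.deg w = 1)
    (h₁ : T.Adj u w) (h₂ : T.Adj w v) :
    ∃! f, T.x f = u ∧ T.z f = v ∧ (T.q₀ f = w ∨ T.q₁ f = w) := by
  obtain ⟨f₁, rfl, hf₁⟩ := adj_x_q hw h₁
  obtain ⟨f₂, rfl, hf₂⟩ := adj_q_z hw h₂
  exact h w f₁ f₂ hf₁ hf₂

theorem PathUnique.of_adj (h : ∀ u w v, T.deg w = 1 → T.Adj u w → T.Adj w v →
    ∃! f, T.x f = u ∧ T.z f = v ∧ (T.q₀ f = w ∨ T.q₁ f = w)) : T.PathUnique := by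
  intro q f₁ f₂ h₁ h₂
  refine h _ q _ ?_ ?_ ?_
  · rcases h₁ with rfl | rfl
    exacts [T.deg_q₀ _, T.deg_q₁ _]
  · rcases h₁ with rfl | rfl
    exacts [⟨f₁, .inl ⟨rfl, rfl⟩⟩, ⟨f₁, .inr <| .inl ⟨rfl, rfl⟩⟩]
  · rcases h₂ with rfl | rfl
    exacts [⟨f₂, .inr <| .inr <| .inl ⟨rfl, rfl⟩⟩, ⟨f₂, .inr <| .inr <| .inr ⟨rfl, rfl⟩⟩]

/-! ### Names of the vertices over an edge -/

/-- The vertex of the glued complex over the edge `u → w`, at distance `k` from the end `u`. -/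
def edgePt (u w : T.V) (k h : ℕ) : T.Label := if k = 0 then .onVertex u h else .onEdge u w k h

theorem place_x_q₀ (f : T.F) {k : ℕ} (h : ℕ) (hk : k ≤ 2 * m) :
    T.place m f (k, 0, h) = edgePt (T.x f) (T.q₀ f) k h := by
  have : k ≠ 2 * m + 1 := by omega
  by_cases k0 : k = 0 <;> simp [place, edgePt, *]

theorem place_x_q₁ (f : T.F) {k : ℕ} (h : ℕ) (hk : k ≤ 2 * m) :
    T.place m f (0, k, h) = edgePt (T.x f) (T.q₁ f) k h := by
  have : k ≠ 2 * m + 1 := by omega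
  by_cases k0 : k = 0 <;> simp [place, edgePt, *]

theorem place_q₀_z (f : T.F) {k : ℕ} (h : ℕ) (hk : k ≤ 2 * m) :
    T.place m f (2 * m + 1, k, h) = edgePt (T.q₀ f) (T.z f) k h := by
  have : k ≠ 2 * m + 1 := by omega
  by_cases k0 : k = 0 <;> simp [place, edgePt, *]

theorem place_q₁_z (f : T.F) {k : ℕ} (h : ℕ) (hk : k ≤ 2 * m) :
    T.place m f (k, 2 * m + 1, h) = edgePt (T.q₁ f) (T.z f) k h := by
  have : k ≠ 2 * m + 1 := by omega
  by_cases k0 : k = 0 <;> simp [place, edgePt, *]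

theorem place_z (f : T.F) (h : ℕ) :
    T.place m f (2 * m + 1, 2 * m + 1, h) = .onVertex (T.z f) h := by
  simp [place]

theorem place_onFace (f : T.F) {a b : ℕ} (h : ℕ) (ha : a ≠ 0) (hb : b ≠ 0) (ha' : a ≠ 2 * m + 1)
    (hb' : b ≠ 2 * m + 1) : T.place m f (a, b, h) = .onFace f a b h := by
  simp [place, *]

/-- The predecessors of a vertex lying over an edge from an `X`-check are visible in every copy
that contains it. -/
theorem place_step_down {f f' : T.F} {p p' q' : ℕ × ℕ × ℕ} (he : T.place m f p' = T.place m f' q')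
    (ha : p'.1 ≤ 2 * m) (hb : p'.2.1 ≤ 2 * m) (hp : p ∈ slab m) (hs : Step p p') :
    ∃ q ∈ slab m, T.place m f' q = T.place m f p ∧ Step q q' := by
  obtain ⟨a, b, h⟩ := p
  obtain ⟨a', b', h'⟩ := p'
  obtain ⟨a'', b'', h''⟩ := q'
  have d₁ := T.deg_x f
  have d₂ := T.deg_x f'
  have d₃ := T.deg_q₀ f'
  have d₄ := T.deg_q₁ f'
  have d₅ := T.deg_z f'
  have d₆ := T.deg_q₀ f
  have d₇ := T.deg_q₁ f
  rw [mem_slab] at hp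
  simp only [Step] at hs ha hb
  by_cases hint : a' ≠ 0 ∧ b' ≠ 0
  · rw [place_onFace f h' hint.1 hint.2 (by omega) (by omega), eq_comm, place_eq_onFace] at he
    obtain ⟨rfl, he, -⟩ := he
    simp only [Prod.mk.injEq] at he
    obtain ⟨rfl, rfl, rfl⟩ := he
    exact ⟨(a, b, h), by rwa [mem_slab], rfl, hs⟩
  have : ∃ k k' : ℕ, k' ≤ 2 * m ∧ (k' = 0 → k = 0) ∧ k ≤ 2 * m ∧ ∃ q, ((a' = 0 ∧ a = 0 ∧ b' = k' ∧ b = k ∧ T.q₁ f = q) ∨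
      (b' = 0 ∧ b = 0 ∧ a' = k' ∧ a = k ∧ T.q₀ f = q)) ∧ T.place m f (a, b, h) = edgePt (T.x f) q k h ∧
      T.place m f (a', b', h') = edgePt (T.x f) q k' h' := by
    by_cases h0 : a' = 0
    · obtain rfl : a = 0 := by omega
      subst h0
      exact ⟨b, b', hb, by omega, by omega, _, .inl ⟨rfl, rfl, rfl, rfl, rfl⟩,
        place_x_q₁ f h (by omega), place_x_q₁ f h' (by omega)⟩
    · obtain rfl : b' = 0 := by omega
      obtain rfl : b = 0 := by omega
      exact ⟨a, a', ha, by omega, by omega, _, .inr ⟨rfl, rfl, rfl, rfl, rfl⟩,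
        place_x_q₀ f h (by omega), place_x_q₀ f h' (by omega)⟩
  obtain ⟨k, k', hk', hkk, hk, q, hq, e, e'⟩ := this
  rw [e', eq_comm] at he
  have key : (a'' = 0 ∧ b'' = k' ∧ h'' = h' ∧ edgePt (T.x f) q k h = edgePt (T.x f') (T.q₁ f') k h) ∨
      (b'' = 0 ∧ a'' = k' ∧ h'' = h' ∧ edgePt (T.x f) q k h = edgePt (T.x f') (T.q₀ f') k h) := by
    unfold edgePt at he ⊢
    split_ifs at he with hk0
    · rw [place_eq_onVertex] at he
      rw [if_pos (hkk hk0), if_pos (hkk hk0), if_pos (hkk hk0)]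
      grind
    · rw [place_eq_onEdge] at he
      grind
  rw [e]
  rcases key with ⟨rfl, rfl, rfl, e₁⟩ | ⟨rfl, rfl, rfl, e₁⟩
  · exact ⟨(0, k, h), by rw [mem_slab]; omega, by rw [e₁, place_x_q₁ f' h hk],
      by simp only [Step, true_and]; omega⟩
  · exact ⟨(k, 0, h), by rw [mem_slab]; omega, by rw [e₁, place_x_q₀ f' h hk],
      by simp only [Step, and_true, true_and]; omega⟩

/-- The successors of a vertex lying over the interior of an edge to a `Z`-check are visible in
every copy that contains it. -/
theorem place_step_up {f f' : T.F} {p p' q : ℕ × ℕ × ℕ} (he : T.place m f p = T.place m f' q)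
    (hc : p.1 = 2 * m + 1 ∧ p.2.1 ≠ 0 ∨ p.2.1 = 2 * m + 1 ∧ p.1 ≠ 0)
    (hp : p ∈ slab m) (hp' : p' ∈ slab m) (hs : Step p p') :
    ∃ q' ∈ slab m, T.place m f' q' = T.place m f p' ∧ Step q q' := by
  obtain ⟨a, b, h⟩ := p
  obtain ⟨a', b', h'⟩ := p'
  obtain ⟨a'', b'', h''⟩ := q
  have d₁ := T.deg_x f
  have d₂ := T.deg_x f'
  have d₃ := T.deg_q₀ f'
  have d₄ := T.deg_q₁ f'
  have d₅ := T.deg_z f'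
  have d₆ := T.deg_q₀ f
  have d₇ := T.deg_q₁ f
  have d₈ := T.deg_z f
  rw [mem_slab] at hp hp'
  simp only [Step] at hs hc
  have aux : ∀ (g : T.F) (k : ℕ), T.place m g (2 * m + 1, k, h') =
      (if k = 2 * m + 1 then .onVertex (T.z g) h' else edgePt (T.q₀ g) (T.z g) k h') ∧
      T.place m g (k, 2 * m + 1, h') =
      (if k = 2 * m + 1 then .onVertex (T.z g) h' else edgePt (T.q₁ g) (T.z g) k h') := by
    intro g k
    unfold place edgePt
    split_ifs <;> simp_all
  by_cases hz : a = 2 * m + 1 ∧ b = 2 * m + 1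
  · obtain ⟨rfl, rfl⟩ := hz
    rw [place_z, eq_comm, place_eq_onVertex] at he
    exact ⟨(a', b', h'), by rwa [mem_slab], by
      obtain ⟨rfl, rfl⟩ : a' = 2 * m + 1 ∧ b' = 2 * m + 1 := by omega
      grind [place_z], by simp only [Step]; grind⟩
  rcases hc with ⟨rfl, h0⟩ | ⟨rfl, h0⟩
  · obtain rfl : a' = 2 * m + 1 := by omega
    rw [place_q₀_z f h (by omega), edgePt, if_neg h0, eq_comm, place_eq_onEdge] at he
    obtain ⟨rfl, -, -, he⟩ := he
    rw [(aux f b').1]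
    obtain ⟨rfl, rfl, e₁, e₂⟩ | ⟨rfl, rfl, e₁, e₂⟩ | ⟨rfl, rfl, e₁, e₂⟩ | ⟨rfl, rfl, e₁, e₂⟩ := he
    · grind
    · exact ⟨(2 * m + 1, b', h'), by rw [mem_slab]; omega, by rw [(aux f' b').1, e₁, e₂],
        by simp only [Step, true_and]; omega⟩
    · grind
    · exact ⟨(b', 2 * m + 1, h'), by rw [mem_slab]; omega, by rw [(aux f' b').2, e₁, e₂],
        by simp only [Step, true_and, and_true]; omega⟩
  · obtain rfl : b' = 2 * m + 1 := by omega
    rw [place_q₁_z f h (by omega), edgePt, if_neg h0, eq_comm, place_eq_onEdge] at he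
    obtain ⟨rfl, -, -, he⟩ := he
    rw [(aux f a').2]
    obtain ⟨rfl, rfl, e₁, e₂⟩ | ⟨rfl, rfl, e₁, e₂⟩ | ⟨rfl, rfl, e₁, e₂⟩ | ⟨rfl, rfl, e₁, e₂⟩ := he
    · grind
    · exact ⟨(2 * m + 1, a', h'), by rw [mem_slab]; omega, by rw [(aux f' a').1, e₁, e₂],
        by simp only [Step, true_and]; omega⟩
    · grind
    · exact ⟨(a', 2 * m + 1, h'), by rw [mem_slab]; omega, by rw [(aux f' a').2, e₁, e₂],
        by simp only [Step, true_and, and_true]; omega⟩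

/-! ### The invariants pass to the glued complex -/

/-- The first alternative determines the copy. The only paths avoiding the interior of the face turn
the corner at `q₀` or at `q₁`, and for those the uniqueness of the face has to come from `T`. -/
theorem path_cases (hm : 1 ≤ m) {p p' p'' : ℕ × ℕ × ℕ} (hp : p ∈ slab m)
    (hp'' : p'' ∈ slab m) (hd : p.1 % 2 + p.2.1 % 2 + p.2.2 % 2 = 0) (h : Step p p')
    (h' : Step p' p'') :
    (∃ q ∈ [p, p', p''], q.1 ≠ 0 ∧ q.1 ≠ 2 * m + 1 ∧ q.2.1 ≠ 0 ∧ q.2.1 ≠ 2 * m + 1) ∨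
      (∃ l, (p = (2 * m, 0, l) ∧ p' = (2 * m + 1, 0, l) ∧ p'' = (2 * m + 1, 1, l)) ∨
        p = (0, 2 * m, l) ∧ p' = (0, 2 * m + 1, l) ∧ p'' = (1, 2 * m + 1, l)) := by
  obtain ⟨a, b, c⟩ := p
  obtain ⟨a', b', c'⟩ := p'
  obtain ⟨a'', b'', c''⟩ := p''
  rw [mem_slab] at hp hp''
  simp only [List.mem_cons, List.not_mem_nil, or_false, exists_eq_or_imp, exists_eq_left]
  by_cases n₁ : a ≠ 0 ∧ a ≠ 2 * m + 1 ∧ b ≠ 0 ∧ b ≠ 2 * m + 1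
  · exact .inl (.inl n₁)
  by_cases n₂ : a' ≠ 0 ∧ a' ≠ 2 * m + 1 ∧ b' ≠ 0 ∧ b' ≠ 2 * m + 1
  · exact .inl (.inr (.inl n₂))
  by_cases n₃ : a'' ≠ 0 ∧ a'' ≠ 2 * m + 1 ∧ b'' ≠ 0 ∧ b'' ≠ 2 * m + 1
  · exact .inl (.inr (.inr n₃))
  refine .inr ⟨c, ?_⟩
  replace n₁ : a = 0 ∨ b = 0 := by simp only at hd; clear * - hd n₁; omega
  simp only [Prod.mk.injEq]
  simp only at hd
  have hd' : a % 2 = 0 ∧ b % 2 = 0 ∧ c % 2 = 0 := by clear * - hd; omega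
  clear hd
  have hp₂ : c'' = 1 → a'' = 2 * m ∨ b'' = 2 * m := hp''.2.2.2
  have hp₃ : a'' ≤ 2 * m + 1 ∧ b'' ≤ 2 * m + 1 := ⟨hp''.1, hp''.2.1⟩
  have hp₄ : c'' ≤ 2 := hp''.2.2.1
  have hp₁ : a ≤ 2 * m + 1 ∧ b ≤ 2 * m + 1 := ⟨hp.1, hp.2.1⟩
  clear hp hp''
  rcases h with ⟨-, hs, rfl, rfl⟩ | ⟨-, hs, rfl, rfl⟩ | ⟨-, hs, rfl, rfl⟩ <;>
    rcases h' with ⟨e', hs', rfl, rfl⟩ | ⟨e', hs', rfl, rfl⟩ | ⟨e', hs', rfl, rfl⟩ <;>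
    dsimp only at * <;> rcases n₁ with rfl | rfl
  · exfalso; clear n₂ n₃; omega
  · exfalso; clear n₂ n₃; omega
  · exfalso; omega
  · obtain rfl : b'' = 1 := by omega
    obtain rfl : a'' = 2 * m + 1 := by omega
    obtain rfl : a = 2 * m := by omega
    simp
  · exfalso; omega
  · exfalso; omega
  · obtain rfl : a'' = 1 := by omega
    obtain rfl : b'' = 2 * m + 1 := by omega
    obtain rfl : b = 2 * m := by omega
    simp
  · exfalso; omega
  · exfalso; clear n₂ n₃; omega
  · exfalso; clear n₂ n₃; omega
  · exfalso; omega
  · exfalso; omega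
  · exfalso; omega
  · exfalso; omega
  · exfalso; omega
  · exfalso; omega
  · exfalso; clear n₂ n₃; omega
  · exfalso; clear n₂ n₃; omega

theorem place_path_cases (hm : 1 ≤ m) (f : T.F) {p p' p'' : ℕ × ℕ × ℕ} (hp : p ∈ slab m)
    (hp'' : p'' ∈ slab m) (hd : p.1 % 2 + p.2.1 % 2 + p.2.2 % 2 = 0) (h : Step p p')
    (h' : Step p' p'') :
    (∃ q ∈ [p, p', p''], T.place m f q = .onFace f q.1 q.2.1 q.2.2) ∨
    (∃ q l, T.place m f p = .onEdge (T.x f) q (2 * m) l ∧ T.place m f p' = .onVertex q l ∧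
      T.place m f p'' = .onEdge q (T.z f) 1 l) := by
  obtain ⟨q, hq, h₁, h₂, h₃, h₄⟩ | ⟨l, ⟨rfl, rfl, rfl⟩ | ⟨rfl, rfl, rfl⟩⟩ :=
    path_cases hm hp hp'' hd h h'
  · exact .inl ⟨q, hq, place_onFace f _ h₁ h₃ h₂ h₄⟩
  · refine .inr ⟨T.q₀ f, l, ?_⟩
    rw [place_x_q₀ f l (by omega), place_q₀_z f l (by omega)]
    simp [place, edgePt, show m ≠ 0 by omega]
  · refine .inr ⟨T.q₁ f, l, ?_⟩
    rw [place_x_q₁ f l (by omega), place_q₁_z f l (by omega)]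
    simp [place, edgePt, show m ≠ 0 by omega]

/-- Isolates the case covered neither by `place_step_down` nor by `place_step_up`: the qubit lies
exactly over a qubit of `T`. -/
theorem qubit_over_vertex {f f' : T.F} {p q : ℕ × ℕ × ℕ} (he : T.place m f p = T.place m f' q)
    (hp : p ∈ slab m) (hd : p.1 % 2 + p.2.1 % 2 + p.2.2 % 2 = 1)
    (hx : ¬(p.1 ≤ 2 * m ∧ p.2.1 ≤ 2 * m))
    (hc : ¬(q.1 = 2 * m + 1 ∧ q.2.1 ≠ 0 ∨ q.2.1 = 2 * m + 1 ∧ q.1 ≠ 0)) :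
    p.1 = 2 * m + 1 ∧ p.2.1 = 0 ∨ p.2.1 = 2 * m + 1 ∧ p.1 = 0 := by
  obtain ⟨a, b, c⟩ := p
  obtain ⟨a', b', c'⟩ := q
  rw [mem_slab] at hp
  simp only at hx hc hd ⊢
  have d₁ := T.deg_x f'
  by_contra hcon
  have hv : ∃ q z k, T.deg q = 1 ∧ k ≠ 0 ∧ k ≤ 2 * m ∧ T.place m f (a, b, c) = .onEdge q z k c := by
    by_cases ha : a = 2 * m + 1
    · refine ⟨T.q₀ f, T.z f, b, T.deg_q₀ f, by omega, by omega, ?_⟩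
      simp [place, ha, show b ≠ 0 by omega, show b ≠ 2 * m + 1 by omega]
    · refine ⟨T.q₁ f, T.z f, a, T.deg_q₁ f, by omega, by omega, ?_⟩
      simp [place, show b = 2 * m + 1 by omega, show a ≠ 0 by omega, show a ≠ 2 * m + 1 by omega]
  obtain ⟨q, z, k, hq, hk, hk', hv⟩ := hv
  rw [hv, eq_comm, place_eq_onEdge] at he
  clear hcon hx hp hd hv
  grind

/-- The two edges may be given in different copies. Either the first can be moved into the copy of
the second, or conversely, or the middle qubit lies over a qubit `q` of `T`. In the last case the
path follows an edge `x → q` and then an edge `q → z`, and the existence half of `PathUnique`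
supplies a face containing both. -/
theorem exists_common_copy (hm : 1 ≤ m) (hT : T.PathUnique) {u w v : (RX m T).V}
    (hw : (RX m T).deg w = 1) (h₁ : (RX m T).Adj u w) (h₂ : (RX m T).Adj w v) :
    ∃ f p p' p'', p ∈ slab m ∧ p'' ∈ slab m ∧ u.1 = T.place m f p ∧ w.1 = T.place m f p' ∧
      v.1 = T.place m f p'' ∧ Step p p' ∧ Step p' p'' := by
  obtain ⟨f₁, p, p', hp, hp', e₁, e₂, hs⟩ := adj_iff.mp h₁
  obtain ⟨f₂, q', q'', hq', hq'', e₃, e₄, hs'⟩ := adj_iff.mp h₂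
  have hd : p'.1 % 2 + p'.2.1 % 2 + p'.2.2 % 2 = 1 := by
    rw [← labelDeg_place T m f₁, ← e₂]; exact hw
  have he : T.place m f₁ p' = T.place m f₂ q' := e₂.symm.trans e₃
  by_cases hx : p'.1 ≤ 2 * m ∧ p'.2.1 ≤ 2 * m
  · obtain ⟨q, hq, e, hs''⟩ := place_step_down he hx.1 hx.2 hp hs
    exact ⟨f₂, q, q', q'', hq, hq'', e₁.trans e.symm, e₃, e₄, hs'', hs'⟩
  by_cases hc : q'.1 = 2 * m + 1 ∧ q'.2.1 ≠ 0 ∨ q'.2.1 = 2 * m + 1 ∧ q'.1 ≠ 0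
  · obtain ⟨p'', hp'', e, hs''⟩ := place_step_up he.symm hc hq' hq'' hs'
    exact ⟨f₁, p, p', p'', hp, hp'', e₁, e₂, e₄.trans e.symm, hs, hs''⟩
  have hb := qubit_over_vertex he hp' hd hx hc
  obtain ⟨a, b, c⟩ := p
  obtain ⟨a', b', c'⟩ := p'
  obtain ⟨a₂', b₂', c₂'⟩ := q'
  obtain ⟨a₂, b₂, c₂⟩ := q''
  rw [mem_slab] at hp hp' hq' hq''
  simp only [Step] at hs hs' hx hc hd hb
  -- Over a qubit of `T` each neighbour has a single possible position in its copy: the last vertex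
  -- before `q` on `x → q`, and the first one after `q` on `q → z`.
  have hu : c % 2 = 0 ∧ c' ≤ 2 ∧ c' ≠ 1 ∧ (a' = 2 * m + 1 → a = 2 * m ∧ b = b' ∧ c = c') ∧
      (b' = 2 * m + 1 → b = 2 * m ∧ a = a' ∧ c = c') := by
    clear * - hs hb hp hp' hd
    omega
  have hv : (b₂' = 2 * m + 1 → a₂' = 0 → a₂ = 1 ∧ b₂ = 2 * m + 1 ∧ c₂ = c₂') ∧
      (a₂' = 2 * m + 1 → b₂' = 0 → a₂ = 2 * m + 1 ∧ b₂ = 1 ∧ c₂ = c₂') := by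
    clear * - hs' hq' hq'' hm
    omega
  clear hs hs' hq' hq'' hx hc hp hd hp'
  have d₁ := T.deg_x f₂
  have d₃ := T.deg_q₀ f₁
  have d₄ := T.deg_q₁ f₁
  have hq : ∃ q, w.1 = .onVertex q c' ∧ u.1 = .onEdge (T.x f₁) q (2 * m) c' ∧
      (T.q₀ f₁ = q ∨ T.q₁ f₁ = q) := by
    rcases hb with ⟨rfl, rfl⟩ | ⟨rfl, rfl⟩
    · obtain ⟨rfl, rfl, rfl⟩ := hu.2.2.2.1 rfl
      refine ⟨T.q₀ f₁, ?_, ?_, .inl rfl⟩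
      · rw [e₂]; simp [place]
      · rw [e₁]; simp [place, show m ≠ 0 by omega]
    · obtain ⟨rfl, rfl, rfl⟩ := hu.2.2.2.2 rfl
      refine ⟨T.q₁ f₁, ?_, ?_, .inr rfl⟩
      · rw [e₂]; simp [place]
      · rw [e₁]; simp [place, show m ≠ 0 by omega]
  obtain ⟨q, hqw, hqu, hqf⟩ := hq
  have hz : v.1 = .onEdge q (T.z f₂) 1 c' ∧ (T.q₀ f₂ = q ∨ T.q₁ f₂ = q) := by
    have hdq : T.deg q = 1 := by rcases hqf with h | h <;> rw [← h] <;> assumption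
    have d₅ := T.deg_z f₂
    rw [hqw, eq_comm, place_eq_onVertex] at e₃
    obtain ⟨rfl, h | h | h | h⟩ := e₃
    · grind
    · obtain ⟨rfl, rfl, rfl⟩ := h
      obtain ⟨rfl, rfl, rfl⟩ := hv.1 rfl rfl
      exact ⟨by rw [e₄]; simp [place, show m ≠ 0 by omega], .inr rfl⟩
    · obtain ⟨rfl, rfl, rfl⟩ := h
      obtain ⟨rfl, rfl, rfl⟩ := hv.2 rfl rfl
      exact ⟨by rw [e₄]; simp [place, show m ≠ 0 by omega], .inl rfl⟩
    · grind
  obtain ⟨f, ⟨hf₁, hf₂, hf₃⟩, -⟩ := hT q f₁ f₂ hqf hz.2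
  rw [hqu, hqw, hz.1, ← hf₁, ← hf₂]
  have hc' : c' % 2 = 0 ∧ c' ≤ 2 := by omega
  rcases hf₃ with rfl | rfl
  · refine ⟨f, (2 * m, 0, c'), (2 * m + 1, 0, c'), (2 * m + 1, 1, c'), ?_, ?_, ?_, ?_, ?_, ?_, ?_⟩
    · rw [mem_slab]; omega
    · rw [mem_slab]; omega
    · simp [place, show m ≠ 0 by omega]
    · simp [place]
    · simp [place, show m ≠ 0 by omega]
    · simp [Step]
    · simp [Step]
  · refine ⟨f, (0, 2 * m, c'), (0, 2 * m + 1, c'), (1, 2 * m + 1, c'), ?_, ?_, ?_, ?_, ?_, ?_, ?_⟩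
    · rw [mem_slab]; omega
    · rw [mem_slab]; omega
    · simp [place, show m ≠ 0 by omega]
    · simp [place]
    · simp [place, show m ≠ 0 by omega]
    · simp [Step]
    · simp [Step]

/-- Within one copy a path spans exactly one square, so only the copy is in question: it exists by
`exists_common_copy`, and it is unique because the path meets the interior of the face or projects
to a path of `T`. -/
theorem PathUnique.RX (hm : 1 ≤ m) (hT : T.PathUnique) : (RX m T).PathUnique := by
  refine PathUnique.of_adj fun u w v hw h₁ h₂ => ?_
  have hdu : (TannerComplex.RX m T).deg u = 0 := by have := h₁.deg_eq; omega
  have hdu' : T.labelDeg u.1 = 0 := hdu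
  obtain ⟨f, p, p', p'', hp, hp'', rfl', hw', hv', hs, hs'⟩ := exists_common_copy hm hT hw h₁ h₂
  have hd : p.1 % 2 + p.2.1 % 2 + p.2.2 % 2 = 0 := by
    rw [← labelDeg_place T m f, ← rfl']; exact hdu
  obtain ⟨S, hS₀, hS₁, hS⟩ := exists_square hp hp'' hd hs hs'
  refine ⟨(f, S), ⟨Subtype.ext ?_, Subtype.ext ?_, ?_⟩, ?_⟩
  · rw [rfl', ← hS₀]; rfl
  · rw [hv', ← hS₁]; rfl
  · rcases hS with rfl | rfl
    · exact .inl (Subtype.ext (by rw [hw']; rfl))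
    · exact .inr (Subtype.ext (by rw [hw']; rfl))
  · rintro ⟨g, S'⟩ ⟨hu, hv, hw₂⟩
    have hu' : T.place m g (squareCorner m S' 0 0) = u.1 := congrArg Subtype.val hu
    have hv₂ : T.place m g (squareCorner m S' 1 1) = v.1 := congrArg Subtype.val hv
    have hw₃ : ∃ r, T.place m g r = w.1 := by
      rcases hw₂ with h | h <;> exact ⟨_, congrArg Subtype.val h⟩
    obtain ⟨r, hr⟩ := hw₃
    have hgf : g = f := by
      obtain ⟨q, hq, e⟩ | ⟨q, l, e₁, e₂, e₃⟩ := place_path_cases hm f hp hp'' hd hs hs'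
      · have : ∃ r, T.place m g r = T.place m f q := by
          simp only [List.mem_cons, List.not_mem_nil, or_false] at hq
          rcases hq with rfl | rfl | rfl
          exacts [⟨_, hu'.trans rfl'⟩, ⟨_, hr.trans hw'⟩, ⟨_, hv₂.trans hv'⟩]
        obtain ⟨r, hr⟩ := this
        rw [e, place_eq_onFace] at hr
        exact hr.1
      · rw [rfl', e₁] at hu'
        rw [hv', e₃] at hv₂
        rw [hw', e₂] at hr
        have d₁ := T.deg_x g
        have d₂ := T.deg_z g
        have d₃ := T.deg_q₀ g
        have d₄ := T.deg_q₁ g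
        have d₅ := T.deg_x f
        have hq : T.deg q = 1 := by
          have := (congrArg T.labelDeg hw').symm.trans hw
          have hl := labelDeg_place T m f p
          rw [e₁] at hl
          rw [e₂] at this
          simp only [labelDeg] at this hl
          omega
        have hgx : T.x g = T.x f := by
          rw [place_eq_onEdge] at hu'
          grind
        have hgz : T.z g = T.z f := by
          rw [place_eq_onEdge] at hv₂
          grind
        have hgq : T.q₀ g = q ∨ T.q₁ g = q := by
          rw [place_eq_onVertex] at hr
          grind
        have hfq : T.q₀ f = q ∨ T.q₁ f = q := by
          rw [place_eq_onVertex] at e₂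
          have := T.deg_z f
          grind
        exact (hT q f f hfq hfq).unique ⟨hgx, hgz, hgq⟩ ⟨rfl, rfl, hfq⟩
    subst hgf
    have e₀ := T.place_injective m g (hu'.trans rfl')
    have e₁ := T.place_injective m g (hv₂.trans hv')
    rw [squareCorner_ext (hS₀.trans e₀.symm) (hS₁.trans e₁.symm)]

theorem step_iff {a b h a' b' h' : ℕ} : Step (a, b, h) (a', b', h') ↔
    (a % 2 = 0 ∧ (a' = a + 1 ∨ a = a' + 1) ∧ b' = b ∧ h' = h) ∨
    (b % 2 = 0 ∧ (b' = b + 1 ∨ b = b' + 1) ∧ a' = a ∧ h' = h) ∨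
    (h % 2 = 0 ∧ (h' = h + 1 ∨ h = h' + 1) ∧ a' = a ∧ b' = b) := Iff.rfl

/-- A function on the vertices of the glued complex, as a function of their names. -/
def labelFun (χ : (RX m T).V → ZMod 2) (L : T.Label) : ZMod 2 :=
  if h : ∃ f : T.F, ∃ p ∈ slab m, L = T.place m f p then χ ⟨L, h⟩ else 0

theorem labelFun_val (χ : (RX m T).V → ZMod 2) (w : (RX m T).V) : labelFun χ w.1 = χ w := by
  obtain ⟨L, hL⟩ := w
  exact dif_pos hL

theorem exists_face_of_square (f : T.F) {p p₁ p₂ p₃ : ℕ × ℕ × ℕ} (hp : p ∈ slab m)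
    (hp₃ : p₃ ∈ slab m) (hd : p.1 % 2 + p.2.1 % 2 + p.2.2 % 2 = 0) (h₁ : Step p p₁)
    (h₁' : Step p₁ p₃) (h₂ : Step p p₂) (h₂' : Step p₂ p₃) (hne : p₁ ≠ p₂) :
    ∃ g : (RX m T).F, ((RX m T).x g).1 = T.place m f p ∧ ((RX m T).z g).1 = T.place m f p₃ ∧
      (((RX m T).q₀ g).1 = T.place m f p₁ ∧ ((RX m T).q₁ g).1 = T.place m f p₂ ∨
        ((RX m T).q₀ g).1 = T.place m f p₂ ∧ ((RX m T).q₁ g).1 = T.place m f p₁) := by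
  obtain ⟨S, e, e₃, h⟩ := exists_square hp hp₃ hd h₁ h₁'
  obtain ⟨S', e', e₃', h'⟩ := exists_square hp hp₃ hd h₂ h₂'
  obtain rfl := squareCorner_ext (e.trans e'.symm) (e₃.trans e₃'.symm)
  refine ⟨(f, S), congrArg (T.place m f) e, congrArg (T.place m f) e₃, ?_⟩
  rcases h with h | h <;> rcases h' with h' | h'
  · exact absurd (h.symm.trans h') hne
  · exact .inl ⟨congrArg (T.place m f) h, congrArg (T.place m f) h'⟩
  · exact .inr ⟨congrArg (T.place m f) h', congrArg (T.place m f) h⟩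
  · exact absurd (h.symm.trans h') hne

/-- Every square at `u` equates the values of `χ` at its two qubits. If `u` is interior to a face,
these squares connect its neighbours directly; over an edge of `T`, all copies share the neighbour
one step towards `x`; over `x` itself, the link is that of `x` in `T`. -/
theorem LinkConnected.RX (hm : 1 ≤ m) (hT : T.LinkConnected) : (RX m T).LinkConnected := by
  intro χ u H
  have sq : ∀ (f : T.F) {p p₁ p₂ p₃ : ℕ × ℕ × ℕ}, T.place m f p = u.1 →
      p ∈ slab m ∧ p₃ ∈ slab m ∧ p.1 % 2 + p.2.1 % 2 + p.2.2 % 2 = 0 ∧ Step p p₁ ∧ Step p₁ p₃ ∧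
        Step p p₂ ∧ Step p₂ p₃ ∧ p₁ ≠ p₂ →
      labelFun χ (T.place m f p₁) = labelFun χ (T.place m f p₂) := by
    rintro f p p₁ p₂ p₃ hu ⟨hp, hp₃, hd, h₁, h₁', h₂, h₂', hne⟩
    obtain ⟨g, hx, -, h⟩ := exists_face_of_square f hp hp₃ hd h₁ h₁' h₂ h₂' hne
    have := H g (Subtype.ext (hx.trans hu))
    rw [← labelFun_val χ, ← labelFun_val χ] at this
    rcases h with h | h
    · rwa [h.1, h.2] at this
    · rw [h.1, h.2] at this
      exact this.symm
  suffices hs : ∀ (f₀ : T.F) (p₀ : ℕ × ℕ × ℕ), p₀ ∈ slab m → T.place m f₀ p₀ = u.1 →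
      p₀.1 % 2 + p₀.2.1 % 2 + p₀.2.2 % 2 = 0 → ∃ κ, ∀ f p p₁, p ∈ slab m → p₁ ∈ slab m →
        T.place m f p = u.1 → Step p p₁ → labelFun χ (T.place m f p₁) = κ by
    intro g g' hg hg'
    have hd : ∀ g : (TannerComplex.RX m T).F, (squareCorner m g.2 0 0).1 % 2 +
        (squareCorner m g.2 0 0).2.1 % 2 + (squareCorner m g.2 0 0).2.2 % 2 = 0 := by
      intro g
      rw [← labelDeg_place T m g.1]
      exact (TannerComplex.RX m T).deg_x g
    obtain ⟨κ, hκ⟩ := hs g.1 _ (squareCorner_mem m g.2 0 0) (congrArg Subtype.val hg) (hd g)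
    have key : ∀ g, (TannerComplex.RX m T).x g = u → χ ((TannerComplex.RX m T).q₀ g) = κ := by
      intro g hg
      rw [← labelFun_val χ]
      exact hκ g.1 _ _ (squareCorner_mem m g.2 0 0) (squareCorner_mem m g.2 1 0)
        (congrArg Subtype.val hg) (squareCorner_step m g.2).1
    rw [key g hg, key g' hg']
  rintro f₀ ⟨a, b, c⟩ hp₀ hu hd
  simp only at hd
  rw [mem_slab] at hp₀
  have hd' : a % 2 = 0 ∧ b % 2 = 0 ∧ c % 2 = 0 := by omega
  by_cases hint : a ≠ 0 ∧ b ≠ 0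
  · refine ⟨labelFun χ (T.place m f₀ (a - 1, b, c)), ?_⟩
    have s₁ := sq f₀ (p₁ := (a - 1, b, c)) (p₂ := (a, b + 1, c)) (p₃ := (a - 1, b + 1, c)) hu
      (by and_intros <;> first
        | (rw [mem_slab]; omega) | (rw [step_iff]; omega) | (simp <;> omega))
    have s₂ := sq f₀ (p₁ := (a + 1, b, c)) (p₂ := (a, b + 1, c)) (p₃ := (a + 1, b + 1, c)) hu
      (by and_intros <;> first
        | (rw [mem_slab]; omega) | (rw [step_iff]; omega) | (simp <;> omega))
    have s₃ := sq f₀ (p₁ := (a - 1, b, c)) (p₂ := (a, b - 1, c)) (p₃ := (a - 1, b - 1, c)) hu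
      (by and_intros <;> first
        | (rw [mem_slab]; omega) | (rw [step_iff]; omega) | (simp <;> omega))
    rintro f ⟨a', b', c'⟩ ⟨a₁, b₁, c₁⟩ - hp₁ hf hs
    rw [← hu, place_onFace f₀ c hint.1 hint.2 (by omega) (by omega), place_eq_onFace] at hf
    obtain ⟨rfl, hf, -⟩ := hf
    simp only [Prod.mk.injEq] at hf
    obtain ⟨rfl, rfl, rfl⟩ := hf
    rw [mem_slab] at hp₁
    simp only [Step] at hs
    rcases hs with ⟨-, hs, rfl, rfl⟩ | ⟨-, hs, rfl, rfl⟩ | ⟨-, hs, rfl, rfl⟩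
    · obtain rfl | rfl : a₁ = a' - 1 ∨ a₁ = a' + 1 := by omega
      · rfl
      · rw [s₁, s₂]
    · obtain rfl | rfl : b₁ = b' - 1 ∨ b₁ = b' + 1 := by omega
      · rw [s₃]
      · rw [s₁]
    · obtain rfl : c₁ = 1 := by omega
      -- The vertical neighbour is compared with a horizontal one inside whichever wall contains
      -- `u`.
      by_cases ha : a₁ = 2 * m
      · rw [s₁]
        exact sq f (p₁ := (a₁, b₁, 1)) (p₂ := (a₁, b₁ + 1, c')) (p₃ := (a₁, b₁ + 1, 1)) hu
          (by and_intros <;> first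
            | (rw [mem_slab]; omega) | (rw [step_iff]; omega) | (simp <;> omega))
      · exact sq f (p₁ := (a₁, b₁, 1)) (p₂ := (a₁ - 1, b₁, c')) (p₃ := (a₁ - 1, b₁, 1)) hu
          (by and_intros <;> first
            | (rw [mem_slab]; omega) | (rw [step_iff]; omega) | (simp <;> omega))
  have hedge : ∃ k ≤ 2 * m, k % 2 = 0 ∧ ∃ q, u.1 = edgePt (T.x f₀) q k c := by
    by_cases ha : a = 0
    · subst ha
      exact ⟨b, by omega, by omega, T.q₁ f₀, by rw [← hu, place_x_q₁ f₀ c (by omega)]⟩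
    · obtain rfl : b = 0 := by omega
      exact ⟨a, by omega, by omega, T.q₀ f₀, by rw [← hu, place_x_q₀ f₀ c (by omega)]⟩
  obtain ⟨k, hk, hk', q, huk⟩ := hedge
  have hc : c % 2 = 0 ∧ c ≤ 2 := by omega
  have d₁ := T.deg_x f₀
  clear hint hd' hd hp₀
  by_cases k0 : k = 0
  · subst k0
    rw [edgePt, if_pos rfl] at huk
    -- A neighbour `q` of `x` corresponds to the first qubit on the edge `x → q`; this transports
    -- `χ` to the link of `x` in `T`.
    let χ' : T.V → ZMod 2 := fun q => labelFun χ (edgePt (T.x f₀) q 1 c)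
    have h1 : 1 ≤ 2 * m := by omega
    have hq : ∀ g, T.x g = T.x f₀ → χ' (T.q₀ g) = χ' (T.q₁ g) := by
      intro g hg
      have := sq g (p := (0, 0, c)) (p₁ := (1, 0, c)) (p₂ := (0, 1, c)) (p₃ := (1, 1, c))
        (by rw [huk, ← hg]; simp [place])
        (by and_intros <;> first
          | (rw [mem_slab]; omega) | (rw [step_iff]; omega) | (simp <;> omega))
      rwa [place_x_q₀ g c h1, place_x_q₁ g c h1, hg] at this
    refine ⟨χ' (T.q₀ f₀), ?_⟩
    rintro f ⟨a', b', c'⟩ ⟨a₁, b₁, c₁⟩ - hp₁ hf hs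
    have d₂ := T.deg_q₀ f
    have d₃ := T.deg_q₁ f
    have d₄ := T.deg_z f
    obtain ⟨rfl, rfl, rfl, hx⟩ : c' = c ∧ a' = 0 ∧ b' = 0 ∧ T.x f = T.x f₀ := by
      rw [huk, place_eq_onVertex] at hf
      grind
    rw [mem_slab] at hp₁
    have e := hT χ' (T.x f₀) hq f f₀ hx rfl
    have e' := hq f hx
    simp only [Step] at hs
    obtain ⟨rfl, rfl, rfl⟩ | ⟨rfl, rfl, rfl⟩ :
      (a₁ = 1 ∧ b₁ = 0 ∧ c₁ = c') ∨ (a₁ = 0 ∧ b₁ = 1 ∧ c₁ = c') := by omega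
    · rw [place_x_q₀ f c₁ h1, hx]; exact e
    · rw [place_x_q₁ f c₁ h1, hx]; exact e'.symm.trans e
  · refine ⟨labelFun χ (edgePt (T.x f₀) q (k - 1) c), ?_⟩
    rintro f ⟨a', b', c'⟩ ⟨a₁, b₁, c₁⟩ - hp₁ hf hs
    have d₂ := T.deg_q₀ f
    have d₃ := T.deg_q₁ f
    have hf' := hf
    rw [huk, edgePt, if_neg k0, place_eq_onEdge] at hf
    obtain ⟨rfl, -, -, hf⟩ := hf
    rw [mem_slab] at hp₁
    obtain ⟨rfl, rfl, h₁, rfl⟩ | h | ⟨rfl, rfl, h₁, rfl⟩ | h := hf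
    · rw [← h₁, ← place_x_q₁ f c' (show b' - 1 ≤ 2 * m by omega)]
      have s₁ := sq f (p₁ := (0, b' - 1, c')) (p₂ := (1, b', c')) (p₃ := (1, b' - 1, c')) hf'
        (by and_intros <;> first
          | (rw [mem_slab]; omega) | (rw [step_iff]; omega) | (simp <;> omega))
      have s₂ := sq f (p₁ := (0, b' + 1, c')) (p₂ := (1, b', c')) (p₃ := (1, b' + 1, c')) hf'
        (by and_intros <;> first
          | (rw [mem_slab]; omega) | (rw [step_iff]; omega) | (simp <;> omega))
      simp only [Step] at hs
      rcases hs with ⟨-, hs, rfl, rfl⟩ | ⟨-, hs, rfl, rfl⟩ | ⟨-, hs, rfl, rfl⟩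
      · obtain rfl : a₁ = 1 := by omega
        exact s₁.symm
      · obtain rfl | rfl : b₁ = b' - 1 ∨ b₁ = b' + 1 := by omega
        · rfl
        · exact s₂.trans s₁.symm
      · obtain rfl : c₁ = 1 := by omega
        rw [s₁]
        exact sq f (p₁ := (0, b₁, 1)) (p₂ := (1, b₁, c')) (p₃ := (1, b₁, 1)) hf'
          (by and_intros <;> first
            | (rw [mem_slab]; omega) | (rw [step_iff]; omega) | (simp <;> omega))
    · grind
    · rw [← h₁, ← place_x_q₀ f c' (show a' - 1 ≤ 2 * m by omega)]
      have s₁ := sq f (p₁ := (a' - 1, 0, c')) (p₂ := (a', 1, c')) (p₃ := (a' - 1, 1, c')) hf'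
        (by and_intros <;> first
          | (rw [mem_slab]; omega) | (rw [step_iff]; omega) | (simp <;> omega))
      have s₂ := sq f (p₁ := (a' + 1, 0, c')) (p₂ := (a', 1, c')) (p₃ := (a' + 1, 1, c')) hf'
        (by and_intros <;> first
          | (rw [mem_slab]; omega) | (rw [step_iff]; omega) | (simp <;> omega))
      simp only [Step] at hs
      rcases hs with ⟨-, hs, rfl, rfl⟩ | ⟨-, hs, rfl, rfl⟩ | ⟨-, hs, rfl, rfl⟩
      · obtain rfl | rfl : a₁ = a' - 1 ∨ a₁ = a' + 1 := by omega
        · rfl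
        · exact s₂.trans s₁.symm
      · obtain rfl : b₁ = 1 := by omega
        exact s₁.symm
      · obtain rfl : c₁ = 1 := by omega
        rw [s₁]
        exact sq f (p₁ := (a₁, 0, 1)) (p₂ := (a₁, 1, c')) (p₃ := (a₁, 1, 1)) hf'
          (by and_intros <;> first
            | (rw [mem_slab]; omega) | (rw [step_iff]; omega) | (simp <;> omega))
    · have := T.deg_q₁ f
      grind

-- The links of the Z-checks, needed because `RZ` is `RX` between two dualisations. The cases mirror
-- those for X-checks: interior to a face; over an edge `q → z`, where a neighbour on that edge is
-- shared by all copies; over `z`, where the link is that of `z` in `T`.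
set_option maxHeartbeats 1000000 in
theorem LinkConnected.dual_RX (hm : 1 ≤ m) (hT : T.dual.LinkConnected) :
    (TannerComplex.RX m T).dual.LinkConnected := by
  intro χ v H
  change ∀ g, (TannerComplex.RX m T).z g = v → χ ((TannerComplex.RX m T).q₀ g) =
    χ ((TannerComplex.RX m T).q₁ g) at H
  change ∀ g g', (TannerComplex.RX m T).z g = v → (TannerComplex.RX m T).z g' = v →
    χ ((TannerComplex.RX m T).q₀ g) = χ ((TannerComplex.RX m T).q₀ g')
  have sq : ∀ (f : T.F) {p p₁ p₂ p₃ : ℕ × ℕ × ℕ}, T.place m f p₃ = v.1 →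
      p ∈ slab m ∧ p₃ ∈ slab m ∧ p.1 % 2 + p.2.1 % 2 + p.2.2 % 2 = 0 ∧ Step p p₁ ∧ Step p₁ p₃ ∧
        Step p p₂ ∧ Step p₂ p₃ ∧ p₁ ≠ p₂ →
      labelFun χ (T.place m f p₁) = labelFun χ (T.place m f p₂) := by
    rintro f p p₁ p₂ p₃ hv ⟨hp, hp₃, hd, h₁, h₁', h₂, h₂', hne⟩
    obtain ⟨g, -, hz, h⟩ := exists_face_of_square f hp hp₃ hd h₁ h₁' h₂ h₂' hne
    have := H g (Subtype.ext (hz.trans hv))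
    rw [← labelFun_val χ, ← labelFun_val χ] at this
    rcases h with h | h
    · rwa [h.1, h.2] at this
    · rw [h.1, h.2] at this
      exact this.symm
  suffices hs : ∀ (f₀ : T.F) (p₀ : ℕ × ℕ × ℕ), p₀ ∈ slab m → T.place m f₀ p₀ = v.1 →
      p₀.1 % 2 + p₀.2.1 % 2 + p₀.2.2 % 2 = 2 → ∃ κ, ∀ f p p₁, p ∈ slab m → p₁ ∈ slab m →
        T.place m f p = v.1 → Step p₁ p → labelFun χ (T.place m f p₁) = κ by
    intro g g' hg hg'
    have hd : ∀ g : (TannerComplex.RX m T).F, (squareCorner m g.2 1 1).1 % 2 +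
        (squareCorner m g.2 1 1).2.1 % 2 + (squareCorner m g.2 1 1).2.2 % 2 = 2 := by
      intro g
      rw [← labelDeg_place T m g.1]
      exact (TannerComplex.RX m T).deg_z g
    obtain ⟨κ, hκ⟩ := hs g.1 _ (squareCorner_mem m g.2 1 1) (congrArg Subtype.val hg) (hd g)
    have key : ∀ g, (TannerComplex.RX m T).z g = v → χ ((TannerComplex.RX m T).q₀ g) = κ := by
      intro g hg
      rw [← labelFun_val χ]
      exact hκ g.1 _ _ (squareCorner_mem m g.2 1 1) (squareCorner_mem m g.2 1 0)
        (congrArg Subtype.val hg) (squareCorner_step m g.2).2.2.1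
    rw [key g hg, key g' hg']
  rintro f₀ ⟨a, b, c⟩ hp₀ hv hd
  simp only at hd
  rw [mem_slab] at hp₀
  by_cases hint : a ≤ 2 * m ∧ b ≤ 2 * m
  · have hab : a ≠ 0 ∧ b ≠ 0 := by omega
    have huniq : ∀ f p, T.place m f p = v.1 → f = f₀ ∧ p = (a, b, c) := by
      intro f p hf
      rw [← hv, place_onFace f₀ c hab.1 hab.2 (by omega) (by omega), place_eq_onFace] at hf
      exact ⟨hf.1, hf.2.1⟩
    by_cases hc : c = 1
    · subst hc
      obtain ⟨rfl, hb⟩ | ⟨rfl, ha⟩ : (a = 2 * m ∧ b % 2 = 1) ∨ (b = 2 * m ∧ a % 2 = 1) := by omega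
      · have s₁ := sq f₀ (p := (2 * m, b - 1, 0)) (p₁ := (2 * m, b - 1, 1))
          (p₂ := (2 * m, b, 0)) (p₃ := (2 * m, b, 1)) hv
            (by and_intros <;> first
              | (rw [mem_slab]; omega) | (rw [step_iff]; omega) | (simp <;> omega))
        have s₂ := sq f₀ (p := (2 * m, b - 1, 2)) (p₁ := (2 * m, b - 1, 1))
            (p₂ := (2 * m, b, 2)) (p₃ := (2 * m, b, 1)) hv
            (by and_intros <;> first
              | (rw [mem_slab]; omega) | (rw [step_iff]; omega) | (simp <;> omega))
        have s₃ := sq f₀ (p := (2 * m, b + 1, 0)) (p₁ := (2 * m, b + 1, 1))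
            (p₂ := (2 * m, b, 0)) (p₃ := (2 * m, b, 1)) hv
            (by and_intros <;> first
              | (rw [mem_slab]; omega) | (rw [step_iff]; omega) | (simp <;> omega))
        refine ⟨labelFun χ (T.place m f₀ (2 * m, b - 1, 1)), ?_⟩
        rintro f p ⟨a₁, b₁, c₁⟩ - hp₁ hf hs
        obtain ⟨rfl, rfl⟩ := huniq f p hf
        rw [mem_slab] at hp₁
        rw [step_iff] at hs
        obtain ⟨rfl, rfl, rfl⟩ | ⟨rfl, rfl, rfl⟩ | ⟨rfl, rfl, rfl⟩ | ⟨rfl, rfl, rfl⟩ :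
          (a₁ = 2 * m ∧ b₁ = b - 1 ∧ c₁ = 1) ∨ (a₁ = 2 * m ∧ b₁ = b + 1 ∧ c₁ = 1) ∨
          (a₁ = 2 * m ∧ b₁ = b ∧ c₁ = 0) ∨ (a₁ = 2 * m ∧ b₁ = b ∧ c₁ = 2) := by omega
        · rfl
        · rw [s₁, s₃]
        · rw [s₁]
        · rw [s₂]
      · have s₁ := sq f₀ (p := (a - 1, 2 * m, 0)) (p₁ := (a - 1, 2 * m, 1))
          (p₂ := (a, 2 * m, 0)) (p₃ := (a, 2 * m, 1)) hv
            (by and_intros <;> first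
              | (rw [mem_slab]; omega) | (rw [step_iff]; omega) | (simp <;> omega))
        have s₂ := sq f₀ (p := (a - 1, 2 * m, 2)) (p₁ := (a - 1, 2 * m, 1))
            (p₂ := (a, 2 * m, 2)) (p₃ := (a, 2 * m, 1)) hv
            (by and_intros <;> first
              | (rw [mem_slab]; omega) | (rw [step_iff]; omega) | (simp <;> omega))
        have s₃ := sq f₀ (p := (a + 1, 2 * m, 0)) (p₁ := (a + 1, 2 * m, 1))
            (p₂ := (a, 2 * m, 0)) (p₃ := (a, 2 * m, 1)) hv
            (by and_intros <;> first
              | (rw [mem_slab]; omega) | (rw [step_iff]; omega) | (simp <;> omega))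
        refine ⟨labelFun χ (T.place m f₀ (a - 1, 2 * m, 1)), ?_⟩
        rintro f p ⟨a₁, b₁, c₁⟩ - hp₁ hf hs
        obtain ⟨rfl, rfl⟩ := huniq f p hf
        rw [mem_slab] at hp₁
        rw [step_iff] at hs
        obtain ⟨rfl, rfl, rfl⟩ | ⟨rfl, rfl, rfl⟩ | ⟨rfl, rfl, rfl⟩ | ⟨rfl, rfl, rfl⟩ :
          (a₁ = a - 1 ∧ b₁ = 2 * m ∧ c₁ = 1) ∨ (a₁ = a + 1 ∧ b₁ = 2 * m ∧ c₁ = 1) ∨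
          (a₁ = a ∧ b₁ = 2 * m ∧ c₁ = 0) ∨ (a₁ = a ∧ b₁ = 2 * m ∧ c₁ = 2) := by omega
        · rfl
        · rw [s₁, s₃]
        · rw [s₁]
        · rw [s₂]
    · have hpar : a % 2 = 1 ∧ b % 2 = 1 ∧ c % 2 = 0 := by omega
      have s₁ := sq f₀ (p := (a - 1, b + 1, c)) (p₁ := (a - 1, b, c)) (p₂ := (a, b + 1, c))
          (p₃ := (a, b, c)) hv
            (by and_intros <;> first
              | (rw [mem_slab]; omega) | (rw [step_iff]; omega) | (simp <;> omega))
      have s₂ := sq f₀ (p := (a + 1, b + 1, c)) (p₁ := (a + 1, b, c)) (p₂ := (a, b + 1, c))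
          (p₃ := (a, b, c)) hv
            (by and_intros <;> first
              | (rw [mem_slab]; omega) | (rw [step_iff]; omega) | (simp <;> omega))
      have s₃ := sq f₀ (p := (a - 1, b - 1, c)) (p₁ := (a - 1, b, c)) (p₂ := (a, b - 1, c))
          (p₃ := (a, b, c)) hv
            (by and_intros <;> first
              | (rw [mem_slab]; omega) | (rw [step_iff]; omega) | (simp <;> omega))
      refine ⟨labelFun χ (T.place m f₀ (a - 1, b, c)), ?_⟩
      rintro f p ⟨a₁, b₁, c₁⟩ - hp₁ hf hs
      obtain ⟨rfl, rfl⟩ := huniq f p hf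
      rw [step_iff] at hs
      obtain ⟨rfl, rfl, rfl⟩ | ⟨rfl, rfl, rfl⟩ | ⟨rfl, rfl, rfl⟩ | ⟨rfl, rfl, rfl⟩ :
        (a₁ = a - 1 ∧ b₁ = b ∧ c₁ = c) ∨ (a₁ = a + 1 ∧ b₁ = b ∧ c₁ = c) ∨
        (a₁ = a ∧ b₁ = b - 1 ∧ c₁ = c) ∨ (a₁ = a ∧ b₁ = b + 1 ∧ c₁ = c) := by omega
      · rfl
      · rw [s₁, s₂]
      · rw [s₃]
      · rw [s₁]
  by_cases hz : a = 2 * m + 1 ∧ b = 2 * m + 1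
  · obtain ⟨rfl, rfl⟩ := hz
    have hc : c % 2 = 0 ∧ c ≤ 2 := by omega
    rw [place_z] at hv
    -- Here `q` corresponds to the last qubit before `z` on the edge `q → z`.
    let χ' : T.V → ZMod 2 := fun q => labelFun χ (edgePt q (T.z f₀) (2 * m) c)
    have hq : ∀ g, T.z g = T.z f₀ → χ' (T.q₀ g) = χ' (T.q₁ g) := by
      intro g hg
      have := sq g (p := (2 * m, 2 * m, c)) (p₁ := (2 * m + 1, 2 * m, c))
          (p₂ := (2 * m, 2 * m + 1, c)) (p₃ := (2 * m + 1, 2 * m + 1, c)) (by rw [place_z, hg, hv])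
            (by and_intros <;> first
              | (rw [mem_slab]; omega) | (rw [step_iff]; omega) | (simp <;> omega))
      rwa [place_q₀_z g c le_rfl, place_q₁_z g c le_rfl, hg] at this
    refine ⟨χ' (T.q₀ f₀), ?_⟩
    rintro f ⟨a', b', c'⟩ ⟨a₁, b₁, c₁⟩ - hp₁ hf hs
    have d₀ := T.deg_x f
    have d₂ := T.deg_q₀ f
    have d₃ := T.deg_q₁ f
    have d₄ := T.deg_z f₀
    obtain ⟨rfl, rfl, rfl, hz⟩ : c' = c ∧ a' = 2 * m + 1 ∧ b' = 2 * m + 1 ∧ T.z f = T.z f₀ := by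
      rw [← hv, place_eq_onVertex] at hf
      grind
    rw [mem_slab] at hp₁
    have e := hT χ' (T.z f₀) hq f f₀ hz rfl
    have e' := hq f hz
    rw [step_iff] at hs
    obtain ⟨rfl, rfl, rfl⟩ | ⟨rfl, rfl, rfl⟩ : (a₁ = 2 * m + 1 ∧ b₁ = 2 * m ∧ c₁ = c') ∨
      (a₁ = 2 * m ∧ b₁ = 2 * m + 1 ∧ c₁ = c') := by omega
    · rw [place_q₀_z f c₁ le_rfl, hz]; exact e
    · rw [place_q₁_z f c₁ le_rfl, hz]; exact e'.symm.trans e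
  have hedge : ∃ k ≤ 2 * m, (c = 1 ∧ k = 2 * m ∨ c % 2 = 0 ∧ k % 2 = 1) ∧ ∃ q, T.deg q = 1 ∧
      v.1 = .onEdge q (T.z f₀) k c := by
    by_cases ha : a = 2 * m + 1
    · have := place_q₀_z f₀ c (show b ≤ 2 * m by omega)
      rw [edgePt, if_neg (by omega)] at this
      exact ⟨b, by omega, by omega, T.q₀ f₀, T.deg_q₀ f₀, by rw [← hv, ha, this]⟩
    · have := place_q₁_z f₀ c (show a ≤ 2 * m by omega)
      rw [edgePt, if_neg (by omega)] at this
      exact ⟨a, by omega, by omega, T.q₁ f₀, T.deg_q₁ f₀,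
        by rw [← hv, ← this, show b = 2 * m + 1 by omega]⟩
  obtain ⟨k, hk, hkc, q, hdq, hvk⟩ := hedge
  have hc : c ≤ 2 := by omega
  clear hint hz hd hp₀ hv
  have hcase : ∀ f p, T.place m f p = v.1 → (p = (2 * m + 1, k, c) ∧ ∀ k' h, k' ≤ 2 * m →
        T.place m f (2 * m + 1, k', h) = edgePt q (T.z f₀) k' h) ∨
      (p = (k, 2 * m + 1, c) ∧ ∀ k' h, k' ≤ 2 * m →
        T.place m f (k', 2 * m + 1, h) = edgePt q (T.z f₀) k' h) := by
    rintro f ⟨a', b', c'⟩ hf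
    have d₀ := T.deg_x f
    rw [hvk, place_eq_onEdge] at hf
    obtain ⟨rfl, -, -, h | h | h | h⟩ := hf
    · grind
    · obtain ⟨rfl, rfl, rfl, hz⟩ := h
      exact .inl ⟨rfl, fun k' h hk' => by rw [← hz]; exact place_q₀_z f h hk'⟩
    · grind
    · obtain ⟨rfl, rfl, rfl, hz⟩ := h
      exact .inr ⟨rfl, fun k' h hk' => by rw [← hz]; exact place_q₁_z f h hk'⟩
  rcases hkc with ⟨rfl, rfl⟩ | ⟨hc', hk'⟩
  · refine ⟨labelFun χ (edgePt q (T.z f₀) (2 * m) 0), ?_⟩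
    rintro f p ⟨a₁, b₁, c₁⟩ - hp₁ hf hs
    rw [mem_slab] at hp₁
    obtain ⟨rfl, he⟩ | ⟨rfl, he⟩ := hcase f p hf
    · rw [← he _ _ le_rfl]
      have s₁ := sq f (p := (2 * m, 2 * m, 0)) (p₁ := (2 * m + 1, 2 * m, 0))
          (p₂ := (2 * m, 2 * m, 1)) (p₃ := (2 * m + 1, 2 * m, 1)) hf
            (by and_intros <;> first
              | (rw [mem_slab]; omega) | (rw [step_iff]; omega) | (simp <;> omega))
      have s₂ := sq f (p := (2 * m, 2 * m, 2)) (p₁ := (2 * m + 1, 2 * m, 2))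
          (p₂ := (2 * m, 2 * m, 1)) (p₃ := (2 * m + 1, 2 * m, 1)) hf
            (by and_intros <;> first
              | (rw [mem_slab]; omega) | (rw [step_iff]; omega) | (simp <;> omega))
      rw [step_iff] at hs
      obtain ⟨rfl, rfl, rfl⟩ | ⟨rfl, rfl, rfl⟩ | ⟨rfl, rfl, rfl⟩ :
        (a₁ = 2 * m + 1 ∧ b₁ = 2 * m ∧ c₁ = 0) ∨ (a₁ = 2 * m + 1 ∧ b₁ = 2 * m ∧ c₁ = 2) ∨
        (a₁ = 2 * m ∧ b₁ = 2 * m ∧ c₁ = 1) := by omega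
      · rfl
      · rw [s₁, s₂]
      · rw [s₁]
    · rw [← he _ _ le_rfl]
      have s₁ := sq f (p := (2 * m, 2 * m, 0)) (p₁ := (2 * m, 2 * m + 1, 0))
          (p₂ := (2 * m, 2 * m, 1)) (p₃ := (2 * m, 2 * m + 1, 1)) hf
            (by and_intros <;> first
              | (rw [mem_slab]; omega) | (rw [step_iff]; omega) | (simp <;> omega))
      have s₂ := sq f (p := (2 * m, 2 * m, 2)) (p₁ := (2 * m, 2 * m + 1, 2))
          (p₂ := (2 * m, 2 * m, 1)) (p₃ := (2 * m, 2 * m + 1, 1)) hf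
            (by and_intros <;> first
              | (rw [mem_slab]; omega) | (rw [step_iff]; omega) | (simp <;> omega))
      rw [step_iff] at hs
      obtain ⟨rfl, rfl, rfl⟩ | ⟨rfl, rfl, rfl⟩ | ⟨rfl, rfl, rfl⟩ :
        (a₁ = 2 * m ∧ b₁ = 2 * m + 1 ∧ c₁ = 0) ∨ (a₁ = 2 * m ∧ b₁ = 2 * m + 1 ∧ c₁ = 2) ∨
        (a₁ = 2 * m ∧ b₁ = 2 * m ∧ c₁ = 1) := by omega
      · rfl
      · rw [s₁, s₂]
      · rw [s₁]
  · refine ⟨labelFun χ (edgePt q (T.z f₀) (k - 1) c), ?_⟩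
    rintro f p ⟨a₁, b₁, c₁⟩ - hp₁ hf hs
    rw [mem_slab] at hp₁
    obtain ⟨rfl, he⟩ | ⟨rfl, he⟩ := hcase f p hf
    · rw [← he _ _ (by omega)]
      have s₁ := sq f (p := (2 * m, k - 1, c)) (p₁ := (2 * m + 1, k - 1, c))
          (p₂ := (2 * m, k, c)) (p₃ := (2 * m + 1, k, c)) hf
            (by and_intros <;> first
              | (rw [mem_slab]; omega) | (rw [step_iff]; omega) | (simp <;> omega))
      have s₂ := sq f (p := (2 * m, k + 1, c)) (p₁ := (2 * m + 1, k + 1, c))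
          (p₂ := (2 * m, k, c)) (p₃ := (2 * m + 1, k, c)) hf
            (by and_intros <;> first
              | (rw [mem_slab]; omega) | (rw [step_iff]; omega) | (simp <;> omega))
      rw [step_iff] at hs
      obtain ⟨rfl, rfl, rfl⟩ | ⟨rfl, rfl, rfl⟩ | ⟨rfl, rfl, rfl⟩ :
        (a₁ = 2 * m + 1 ∧ b₁ = k - 1 ∧ c₁ = c) ∨ (a₁ = 2 * m + 1 ∧ b₁ = k + 1 ∧ c₁ = c) ∨
        (a₁ = 2 * m ∧ b₁ = k ∧ c₁ = c) := by omega
      · rfl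
      · rw [s₁, s₂]
      · rw [s₁]
    · rw [← he _ _ (by omega)]
      have s₁ := sq f (p := (k - 1, 2 * m, c)) (p₁ := (k - 1, 2 * m + 1, c))
          (p₂ := (k, 2 * m, c)) (p₃ := (k, 2 * m + 1, c)) hf
            (by and_intros <;> first
              | (rw [mem_slab]; omega) | (rw [step_iff]; omega) | (simp <;> omega))
      have s₂ := sq f (p := (k + 1, 2 * m, c)) (p₁ := (k + 1, 2 * m + 1, c))
          (p₂ := (k, 2 * m, c)) (p₃ := (k, 2 * m + 1, c)) hf
            (by and_intros <;> first
              | (rw [mem_slab]; omega) | (rw [step_iff]; omega) | (simp <;> omega))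
      rw [step_iff] at hs
      obtain ⟨rfl, rfl, rfl⟩ | ⟨rfl, rfl, rfl⟩ | ⟨rfl, rfl, rfl⟩ :
        (a₁ = k - 1 ∧ b₁ = 2 * m + 1 ∧ c₁ = c) ∨ (a₁ = k + 1 ∧ b₁ = 2 * m + 1 ∧ c₁ = c) ∨
        (a₁ = k ∧ b₁ = 2 * m ∧ c₁ = c) := by omega
      · rfl
      · rw [s₁, s₂]
      · rw [s₁]

/-! ### The invariants at the even levels -/

theorem surfaceCode_pathUnique : surfaceCode.PathUnique := by
  rintro q ⟨x₁, z₁⟩ ⟨x₂, z₂⟩ h₁ h₂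
  refine ⟨((x₁, z₂) : Bool × Bool), ⟨rfl, rfl, ?_⟩, ?_⟩
  · rcases h₁ with h₁ | h₁
    · rcases h₂ with h₂ | h₂
      · have h := h₁.trans h₂.symm
        cases x₁ <;> cases z₁ <;> cases x₂ <;> cases z₂ <;>
          first | exact .inl h₁ | simp [surfaceCode] at h
      · exact .inr h₂
    · exact .inr h₁
  · rintro ⟨x, z⟩ ⟨hx, hz, -⟩
    cases x₁ <;> cases z₂ <;> cases x <;> cases z <;>
      first | rfl | (simp [surfaceCode] at hx; done) | simp [surfaceCode] at hz

theorem surfaceCode_linkConnected : surfaceCode.LinkConnected := by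
  intro χ u H
  have key : ∀ g g' : Bool × Bool, surfaceCode.x g = surfaceCode.x g' →
      surfaceCode.q₁ g = surfaceCode.q₁ g' := fun _ _ _ => rfl
  intro g g' hg hg'
  rw [H g hg, H g' hg', key g g' (hg.trans hg'.symm)]

/-- `PathUnique` is self-dual, so it passes through `RZ` as well. Only the links of X-checks are
tracked: after dualising they are links of Z-checks, which `LinkConnected.dual_RX` handles. -/
theorem evenLevel_invariants (hm : 1 ≤ m) (k : ℕ) :
    (evenLevel m k).PathUnique ∧ (evenLevel m k).LinkConnected := by
  induction k with
  | zero => exact ⟨surfaceCode_pathUnique, surfaceCode_linkConnected⟩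
  | succ k ih =>
    have h₁ := ih.1.RX hm
    have h₂ := ih.2.RX hm
    exact ⟨(h₁.dual.RX hm).dual, LinkConnected.dual_RX (T := (RX m (evenLevel m k)).dual) hm h₂⟩

/-! ### Cochains -/

/-- The paths from `v` to `w` correspond to pairs of a face with corners `v`, `w` and one of its two
qubits, so their number is even. -/
theorem PathUnique.δ_δ (hT : T.PathUnique) (c : T.C 0) : T.δ 1 (T.δ 0 c) = 0 := by
  have hc : ∀ (v : T.VDeg 0) (w : T.VDeg 2),
      ∑ u : T.VDeg 1, (if T.Adj v.1 u.1 ∧ T.Adj u.1 w.1 then (1 : ZMod 2) else 0) = 0 := by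
    intro v w
    have : Fintype T.F := Fintype.ofFinite _
    have h₁ : ∀ u : T.VDeg 1, (if T.Adj v.1 u.1 ∧ T.Adj u.1 w.1 then (1 : ZMod 2) else 0) =
        ∑ f : T.F, if T.x f = v.1 ∧ T.z f = w.1 then
          (if (⟨T.q₀ f, T.deg_q₀ f⟩ : T.VDeg 1) = u then 1 else 0) +
          (if (⟨T.q₁ f, T.deg_q₁ f⟩ : T.VDeg 1) = u then 1 else 0) else 0 := by
      intro u
      split_ifs with h
      · obtain ⟨f, ⟨hx, hz, hq⟩, hu⟩ := hT.exists_face u.2 h.1 h.2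
        rw [Finset.sum_eq_single f]
        · rw [if_pos ⟨hx, hz⟩]
          have := T.q_ne f
          simp only [Subtype.ext_iff]
          rcases hq with hq | hq
          · rw [if_pos hq, if_neg (fun h => this (hq.trans h.symm)), add_zero]
          · rw [if_pos hq, if_neg (fun h => this (h.trans hq.symm)), zero_add]
        · intro g _ hg
          split_ifs with h₁ h₂ h₃ h₃
          · exact absurd (hu g ⟨h₁.1, h₁.2, .inl (congrArg Subtype.val h₂)⟩) hg
          · exact absurd (hu g ⟨h₁.1, h₁.2, .inl (congrArg Subtype.val h₂)⟩) hg
          · exact absurd (hu g ⟨h₁.1, h₁.2, .inr (congrArg Subtype.val h₃)⟩) hg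
          · rw [add_zero]
          · rfl
        · simp
      · refine (Finset.sum_eq_zero fun f _ => ?_).symm
        split_ifs with h₁ h₂ h₃ h₃
        · exact absurd ⟨⟨f, .inl ⟨h₁.1.symm, congrArg Subtype.val h₂.symm⟩⟩,
            ⟨f, .inr (.inr (.inl ⟨congrArg Subtype.val h₂.symm, h₁.2.symm⟩))⟩⟩ h
        · exact absurd ⟨⟨f, .inl ⟨h₁.1.symm, congrArg Subtype.val h₂.symm⟩⟩,
            ⟨f, .inr (.inr (.inl ⟨congrArg Subtype.val h₂.symm, h₁.2.symm⟩))⟩⟩ h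
        · exact absurd ⟨⟨f, .inr (.inl ⟨h₁.1.symm, congrArg Subtype.val h₃.symm⟩)⟩,
            ⟨f, .inr (.inr (.inr ⟨congrArg Subtype.val h₃.symm, h₁.2.symm⟩))⟩⟩ h
        · rw [add_zero]
        · rfl
    simp_rw [h₁]
    rw [Finset.sum_comm]
    refine Finset.sum_eq_zero fun f _ => ?_
    split_ifs
    · rw [Finset.sum_add_distrib, Finset.sum_ite_eq, Finset.sum_ite_eq]
      simp only [Finset.mem_univ, if_true]
      decide
    · simp
  ext w
  change ∑ u : T.VDeg 1, (if T.Adj u.1 w.1 then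
    ∑ v : T.VDeg 0, (if T.Adj v.1 u.1 then c v else 0) else 0) = 0
  calc _ = ∑ u : T.VDeg 1, ∑ v : T.VDeg 0,
        c v * (if T.Adj v.1 u.1 ∧ T.Adj u.1 w.1 then (1 : ZMod 2) else 0) := by
        refine Finset.sum_congr rfl fun u _ => ?_
        split_ifs with h
        · refine Finset.sum_congr rfl fun v _ => ?_
          simp [h]
        · simp [h]
    _ = 0 := by
        rw [Finset.sum_comm]
        refine Finset.sum_eq_zero fun v _ => ?_
        rw [← Finset.mul_sum, hc v w, mul_zero]

/-- The value of a cochain of the glued complex at the vertex of a given name, and `0` if there is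
no vertex of the right degree with that name. -/
def ev {i : ℕ} (c : (RX m T).C i) (L : T.Label) : ZMod 2 :=
  ∑ u : (RX m T).VDeg i, if u.1.1 = L then c u else 0

theorem ev_val {i : ℕ} (c : (RX m T).C i) (u : (RX m T).VDeg i) : ev c u.1.1 = c u := by
  unfold ev
  rw [Finset.sum_eq_single u]
  · rw [if_pos rfl]
  · intro v _ hv
    rw [if_neg fun h => hv (Subtype.ext (Subtype.ext h))]
  · simp

theorem ev_add {i : ℕ} (c d : (RX m T).C i) (L : T.Label) : ev (c + d) L = ev c L + ev d L := by
  unfold ev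
  rw [← Finset.sum_add_distrib]
  exact Finset.sum_congr rfl fun u _ => by split_ifs <;> simp

/-- The vertex of the glued complex at a point of a copy of the slab. -/
def vert (f : T.F) {p : ℕ × ℕ × ℕ} (hp : p ∈ slab m) {i : ℕ}
    (hd : p.1 % 2 + p.2.1 % 2 + p.2.2 % 2 = i) : (RX m T).VDeg i :=
  ⟨⟨T.place m f p, f, p, hp, rfl⟩, by rw [← hd]; exact labelDeg_place T m f p⟩

theorem exists_vert {i : ℕ} (u : (RX m T).VDeg i) :
    ∃ (f : T.F) (p : ℕ × ℕ × ℕ) (hp : p ∈ slab m) (hd : p.1 % 2 + p.2.1 % 2 + p.2.2 % 2 = i),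
      u = vert f hp hd := by
  obtain ⟨⟨_, f, p, hp, rfl⟩, hd⟩ := u
  have : T.labelDeg (T.place m f p) = i := hd
  exact ⟨f, p, hp, by rw [← this, labelDeg_place], rfl⟩

/-- The list `e` need only be correct on the support of `c`; this allows neighbours where `c`
vanishes to be ignored. -/
theorem δ_apply_eq_sum {i : ℕ} {ι : Type*} (c : (RX m T).C i) (w : (RX m T).VDeg (i + 1))
    (s : Finset ι) (e : ι → T.Label) (he : Set.InjOn e s)
    (hs : ∀ u : (RX m T).VDeg i, c u ≠ 0 → ((RX m T).Adj u.1 w.1 ↔ ∃ j ∈ s, u.1.1 = e j)) :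
    (RX m T).δ i c w = ∑ j ∈ s, ev c (e j) := by
  unfold ev
  rw [Finset.sum_comm]
  refine Finset.sum_congr rfl fun u _ => ?_
  by_cases hc : c u = 0
  · simp [hc]
  split_ifs with h
  · obtain ⟨j, hj, h'⟩ := (hs u hc).mp h
    rw [Finset.sum_eq_single_of_mem j hj, if_pos h']
    intro k hk hkj
    rw [if_neg fun h'' => hkj (he hk hj (h''.symm.trans h'))]
  · refine (Finset.sum_eq_zero fun j hj => ?_).symm
    rw [if_neg fun h' => h ((hs u hc).mpr ⟨j, hj, h'⟩)]

/-- Over the star of an X-check, every predecessor is visible in every copy containing the vertex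
(`place_step_down`), so the coboundary is computed in a single copy. -/
theorem ev_δ_place {i : ℕ} (c : (RX m T).C i) (f : T.F) {p' : ℕ × ℕ × ℕ} (hp' : p' ∈ slab m)
    (ha : p'.1 ≤ 2 * m) (hb : p'.2.1 ≤ 2 * m) (hd : p'.1 % 2 + p'.2.1 % 2 + p'.2.2 % 2 = i + 1)
    (s : Finset (ℕ × ℕ × ℕ)) (hs : ∀ p, p ∈ s ↔ p ∈ slab m ∧ Step p p') :
    ev ((RX m T).δ i c) (T.place m f p') = ∑ p ∈ s, ev c (T.place m f p) := by
  have := ev_val ((RX m T).δ i c) (vert f hp' hd)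
  refine this.trans (δ_apply_eq_sum c _ s _ (T.place_injective m f).injOn fun u _ => ?_)
  rw [adj_iff]
  constructor
  · rintro ⟨f₁, p, p₁, hp, hp₁, hu, hw, hstep⟩
    have hw' : T.place m f p' = T.place m f₁ p₁ := hw
    have hpl : p₁.1 ≤ 2 * m ∧ p₁.2.1 ≤ 2 * m := by
      obtain ⟨a, b, h⟩ := p'
      obtain ⟨a₁, b₁, h₁⟩ := p₁
      by_cases hint : a ≠ 0 ∧ b ≠ 0
      · simp only at ha hb
        rw [place_onFace f h hint.1 hint.2 (by omega) (by omega), eq_comm, place_eq_onFace] at hw'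
        obtain ⟨-, hw', -⟩ := hw'
        simp only [Prod.mk.injEq] at hw'
        obtain ⟨rfl, rfl, rfl⟩ := hw'
        exact ⟨ha, hb⟩
      · have d₁ := T.deg_x f
        have d₂ := T.deg_x f₁
        have d₃ := T.deg_q₀ f₁
        have d₄ := T.deg_q₁ f₁
        have d₅ := T.deg_z f₁
        simp only at ha hb ⊢
        have : ∃ q k, k ≤ 2 * m ∧ T.place m f (a, b, h) = edgePt (T.x f) q k h := by
          by_cases a0 : a = 0
          · rw [a0]; exact ⟨_, b, hb, place_x_q₁ f h hb⟩
          · rw [show b = 0 by omega]; exact ⟨_, a, ha, place_x_q₀ f h ha⟩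
        obtain ⟨q, k, hk, e⟩ := this
        rw [e, eq_comm] at hw'
        unfold edgePt at hw'
        split_ifs at hw'
        · rw [place_eq_onVertex] at hw'
          grind
        · rw [place_eq_onEdge] at hw'
          grind
    obtain ⟨q, hq, hqe, hqs⟩ := place_step_down hw'.symm hpl.1 hpl.2 hp hstep
    exact ⟨q, (hs q).mpr ⟨hq, hqs⟩, hu.trans hqe.symm⟩
  · rintro ⟨p, hp, hu⟩
    obtain ⟨hp, hstep⟩ := (hs p).mp hp
    exact ⟨f, p, p', hp, hp', hu, rfl, hstep⟩

/-! ### Explicit coboundaries inside `Y_x` -/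

section formulas
variable (f : T.F) {i j h : ℕ}

theorem ev_δ_cell (g : (RX m T).C 1) (hi : i < m) (hj : j < m) (hh : h = 0 ∨ h = 2) :
    ev ((RX m T).δ 1 g) (T.place m f (2 * i + 1, 2 * j + 1, h)) =
      ev g (T.place m f (2 * i, 2 * j + 1, h)) + ev g (T.place m f (2 * i + 2, 2 * j + 1, h)) +
      ev g (T.place m f (2 * i + 1, 2 * j, h)) + ev g (T.place m f (2 * i + 1, 2 * j + 2, h)) := by
  rw [ev_δ_place g f (by rw [mem_slab]; omega) (by simp only; omega) (by simp only; omega)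
    (by simp only; omega) {(2 * i, 2 * j + 1, h), (2 * i + 2, 2 * j + 1, h), (2 * i + 1, 2 * j, h),
      (2 * i + 1, 2 * j + 2, h)}]
  · rw [Finset.sum_insert (by simp), Finset.sum_insert (by simp), Finset.sum_pair (by simp)]
    ring
  · rintro ⟨a, b, k⟩
    rw [mem_slab, step_iff]
    simp only [Finset.mem_insert, Finset.mem_singleton, Prod.mk.injEq]
    omega

theorem ev_δ_wall_left (g : (RX m T).C 1) (hj : j < m) :
    ev ((RX m T).δ 1 g) (T.place m f (2 * m, 2 * j + 1, 1)) =
      ev g (T.place m f (2 * m, 2 * j + 1, 0)) + ev g (T.place m f (2 * m, 2 * j + 1, 2)) +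
      ev g (T.place m f (2 * m, 2 * j, 1)) + ev g (T.place m f (2 * m, 2 * j + 2, 1)) := by
  rw [ev_δ_place g f (by rw [mem_slab]; omega) (by simp only; omega) (by simp only; omega)
    (by simp only; omega) {(2 * m, 2 * j + 1, 0), (2 * m, 2 * j + 1, 2), (2 * m, 2 * j, 1),
      (2 * m, 2 * j + 2, 1)}]
  · rw [Finset.sum_insert (by simp), Finset.sum_insert (by simp), Finset.sum_pair (by simp)]
    ring
  · rintro ⟨a, b, k⟩
    rw [mem_slab, step_iff]
    simp only [Finset.mem_insert, Finset.mem_singleton, Prod.mk.injEq]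
    omega

theorem ev_δ_wall_right (g : (RX m T).C 1) (hi : i < m) :
    ev ((RX m T).δ 1 g) (T.place m f (2 * i + 1, 2 * m, 1)) =
      ev g (T.place m f (2 * i + 1, 2 * m, 0)) + ev g (T.place m f (2 * i + 1, 2 * m, 2)) +
      ev g (T.place m f (2 * i, 2 * m, 1)) + ev g (T.place m f (2 * i + 2, 2 * m, 1)) := by
  rw [ev_δ_place g f (by rw [mem_slab]; omega) (by simp only; omega) (by simp only; omega)
    (by simp only; omega) {(2 * i + 1, 2 * m, 0), (2 * i + 1, 2 * m, 2), (2 * i, 2 * m, 1),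
      (2 * i + 2, 2 * m, 1)}]
  · rw [Finset.sum_insert (by simp), Finset.sum_insert (by simp), Finset.sum_pair (by simp)]
    ring
  · rintro ⟨a, b, k⟩
    rw [mem_slab, step_iff]
    simp only [Finset.mem_insert, Finset.mem_singleton, Prod.mk.injEq]
    omega

theorem ev_δ_layer_fst (c : (RX m T).C 0) (hi : i < m) (hj : j ≤ m) (hh : h = 0 ∨ h = 2) :
    ev ((RX m T).δ 0 c) (T.place m f (2 * i + 1, 2 * j, h)) =
      ev c (T.place m f (2 * i, 2 * j, h)) + ev c (T.place m f (2 * i + 2, 2 * j, h)) := by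
  rw [ev_δ_place c f (by rw [mem_slab]; omega) (by simp only; omega) (by simp only; omega)
    (by simp only; omega) {(2 * i, 2 * j, h), (2 * i + 2, 2 * j, h)}]
  · rw [Finset.sum_pair (by simp)]
  · rintro ⟨a, b, k⟩
    rw [mem_slab, step_iff]
    simp only [Finset.mem_insert, Finset.mem_singleton, Prod.mk.injEq]
    omega

theorem ev_δ_layer_snd (c : (RX m T).C 0) (hi : i ≤ m) (hj : j < m) (hh : h = 0 ∨ h = 2) :
    ev ((RX m T).δ 0 c) (T.place m f (2 * i, 2 * j + 1, h)) =
      ev c (T.place m f (2 * i, 2 * j, h)) + ev c (T.place m f (2 * i, 2 * j + 2, h)) := by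
  rw [ev_δ_place c f (by rw [mem_slab]; omega) (by simp only; omega) (by simp only; omega)
    (by simp only; omega) {(2 * i, 2 * j, h), (2 * i, 2 * j + 2, h)}]
  · rw [Finset.sum_pair (by simp)]
  · rintro ⟨a, b, k⟩
    rw [mem_slab, step_iff]
    simp only [Finset.mem_insert, Finset.mem_singleton, Prod.mk.injEq]
    omega

theorem ev_δ_vertical (c : (RX m T).C 0) (hi : i ≤ m) (hj : j ≤ m) (hij : i = m ∨ j = m) :
    ev ((RX m T).δ 0 c) (T.place m f (2 * i, 2 * j, 1)) =
      ev c (T.place m f (2 * i, 2 * j, 0)) + ev c (T.place m f (2 * i, 2 * j, 2)) := by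
  rw [ev_δ_place c f (by rw [mem_slab]; omega) (by simp only; omega) (by simp only; omega)
    (by simp only; omega) {(2 * i, 2 * j, 0), (2 * i, 2 * j, 2)}]
  · rw [Finset.sum_pair (by simp)]
  · rintro ⟨a, b, k⟩
    rw [mem_slab, step_iff]
    simp only [Finset.mem_insert, Finset.mem_singleton, Prod.mk.injEq]
    omega

end formulas

/-! ### Owners -/

theorem labelOwner_place (f : T.F) {p : ℕ × ℕ × ℕ} (hp : p ∈ slab m) :
    T.labelOwner (T.place m f p) = if p.1 ≤ 2 * m then (if p.2.1 ≤ 2 * m then T.x f else T.q₁ f)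
      else (if p.2.1 ≤ 2 * m then T.q₀ f else T.z f) := by
  obtain ⟨a, b, h⟩ := p
  rw [mem_slab] at hp
  simp only [place]
  split_ifs <;> first | rfl | omega

theorem deg_labelOwner_place (f : T.F) {p : ℕ × ℕ × ℕ} (hp : p ∈ slab m) :
    T.deg (T.labelOwner (T.place m f p)) =
      (if p.1 ≤ 2 * m then 0 else 1) + (if p.2.1 ≤ 2 * m then 0 else 1) := by
  rw [labelOwner_place f hp]
  split_ifs <;> simp [T.deg_x, T.deg_q₀, T.deg_q₁, T.deg_z]

/-- The filtration behind the whole argument: an edge stays in its local complex or follows a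
directed edge of `T`. It orders the rounds of correction and also bounds how far information
travels. -/
theorem owner_of_adj {u w : (RX m T).V} (h : (RX m T).Adj u w) :
    T.owner m u = T.owner m w ∨ T.Adj (T.owner m u) (T.owner m w) := by
  obtain ⟨f, p, p', hp, hp', hu, hw, hs⟩ := adj_iff.mp h
  rw [owner, owner, hu, hw, labelOwner_place f hp, labelOwner_place f hp']
  obtain ⟨a, b, c⟩ := p
  obtain ⟨a', b', c'⟩ := p'
  rw [mem_slab] at hp hp'
  rw [step_iff] at hs
  dsimp only
  have h₁ : T.Adj (T.x f) (T.q₀ f) := ⟨f, .inl ⟨rfl, rfl⟩⟩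
  have h₂ : T.Adj (T.x f) (T.q₁ f) := ⟨f, .inr <| .inl ⟨rfl, rfl⟩⟩
  have h₃ : T.Adj (T.q₀ f) (T.z f) := ⟨f, .inr <| .inr <| .inl ⟨rfl, rfl⟩⟩
  have h₄ : T.Adj (T.q₁ f) (T.z f) := ⟨f, .inr <| .inr <| .inr ⟨rfl, rfl⟩⟩
  split_ifs <;> first | exact .inl rfl | exact .inr (by assumption) | (exfalso; omega)

theorem deg_owner_of_adj {u w : (RX m T).V} (h : (RX m T).Adj u w) (hne : T.owner m u ≠ T.owner m w) :
    T.deg (T.owner m w) = T.deg (T.owner m u) + 1 :=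
  ((owner_of_adj h).resolve_left hne).deg_eq

theorem ev_ofLabel {i : ℕ} (F : T.Label → ZMod 2) (f : T.F) {p : ℕ × ℕ × ℕ} (hp : p ∈ slab m)
    (hd : p.1 % 2 + p.2.1 % 2 + p.2.2 % 2 = i) :
    ev (fun u : (RX m T).VDeg i => F u.1.1) (T.place m f p) = F (T.place m f p) :=
  ev_val _ (vert f hp hd)

/-- The qubits of the local complexes `Y_x`. -/
theorem qubit_cases (u : (RX m T).VDeg 1) (hu : T.deg (T.owner m u.1) = 0) :
    ∃ f, T.x f = T.owner m u.1 ∧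
      ((∃ i j h, i < m ∧ j ≤ m ∧ (h = 0 ∨ h = 2) ∧ u.1.1 = T.place m f (2 * i + 1, 2 * j, h)) ∨
       (∃ i j h, i ≤ m ∧ j < m ∧ (h = 0 ∨ h = 2) ∧ u.1.1 = T.place m f (2 * i, 2 * j + 1, h)) ∨
       (∃ i j, i ≤ m ∧ j ≤ m ∧ (i = m ∨ j = m) ∧ u.1.1 = T.place m f (2 * i, 2 * j, 1))) := by
  obtain ⟨f, p, hp, hd, rfl⟩ := exists_vert u
  have ho : T.owner m (vert f hp hd).1 = T.labelOwner (T.place m f p) := rfl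
  rw [ho, deg_labelOwner_place f hp] at hu
  rw [ho, labelOwner_place f hp]
  obtain ⟨a, b, h⟩ := p
  rw [mem_slab] at hp
  dsimp only at hu hd ⊢
  have ha : a ≤ 2 * m := by by_contra ha; simp [ha] at hu
  have hb : b ≤ 2 * m := by by_contra hb; simp [hb] at hu
  refine ⟨f, by simp [ha, hb], ?_⟩
  by_cases h1 : h = 1
  · subst h1
    refine .inr (.inr ⟨a / 2, b / 2, by omega, by omega, by omega, ?_⟩)
    rw [show 2 * (a / 2) = a by omega, show 2 * (b / 2) = b by omega]
    rfl
  by_cases ha2 : a % 2 = 1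
  · refine .inl ⟨a / 2, b / 2, h, by omega, by omega, by omega, ?_⟩
    rw [show 2 * (a / 2) + 1 = a by omega, show 2 * (b / 2) = b by omega]
    rfl
  · refine .inr (.inl ⟨a / 2, b / 2, h, by omega, by omega, by omega, ?_⟩)
    rw [show 2 * (a / 2) = a by omega, show 2 * (b / 2) + 1 = b by omega]
    rfl

/-! ### Gauge fixing on a layer -/

/-- The potential of a cochain on a layer, integrated from the centre: first along the side `a = 0`
and then in the direction of `a`. -/
def potential (m : ℕ) (g : (RX m T).C 1) : T.Label → ZMod 2
  | .onVertex _ _ => 0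
  | .onEdge u w k h => ∑ i ∈ Finset.range (k / 2), ev g (.onEdge u w (2 * i + 1) h)
  | .onFace f a b h => ∑ j ∈ Finset.range (b / 2), ev g (T.place m f (0, 2 * j + 1, h)) +
      ∑ i ∈ Finset.range (a / 2), ev g (T.place m f (2 * i + 1, b, h))

theorem potential_place (g : (RX m T).C 1) (f : T.F) {i j : ℕ} (h : ℕ) (hi : i ≤ m) (hj : j ≤ m) :
    potential m g (T.place m f (2 * i, 2 * j, h)) =
      ∑ j' ∈ Finset.range j, ev g (T.place m f (0, 2 * j' + 1, h)) +
      ∑ i' ∈ Finset.range i, ev g (T.place m f (2 * i' + 1, 2 * j, h)) := by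
  rcases Nat.eq_zero_or_pos i with rfl | hi'
  · rw [mul_zero, place_x_q₁ f h (by omega), Finset.range_zero, Finset.sum_empty, add_zero]
    rcases Nat.eq_zero_or_pos j with rfl | hj'
    · simp [edgePt, potential]
    · rw [edgePt, if_neg (by omega), potential, Nat.mul_div_cancel_left _ (by norm_num)]
      refine Finset.sum_congr rfl fun j' hj' => ?_
      rw [Finset.mem_range] at hj'
      rw [place_x_q₁ f h (by omega), edgePt, if_neg (by omega)]
  · rcases Nat.eq_zero_or_pos j with rfl | hj'
    · rw [mul_zero, place_x_q₀ f h (by omega), Finset.range_zero, Finset.sum_empty, zero_add,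
        edgePt, if_neg (by omega), potential, Nat.mul_div_cancel_left _ (by norm_num)]
      refine Finset.sum_congr rfl fun i' hi' => ?_
      rw [Finset.mem_range] at hi'
      rw [place_x_q₀ f h (by omega), edgePt, if_neg (by omega)]
    · rw [place_onFace f h (by omega) (by omega) (by omega) (by omega), potential,
        Nat.mul_div_cancel_left _ (by norm_num), Nat.mul_div_cancel_left _ (by norm_num)]

section gauge
variable {g G : (RX m T).C 1} {c : (RX m T).C 0} {t : ℕ}

/-- Along the direction of `a` the potential is the integral of `g`, so its coboundary cancels `g`
there in characteristic two. -/
theorem gauge_fst (ht : t = 0 ∨ t = 2) (hG : G = g + (RX m T).δ 0 c)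
    (hc : ∀ f i j, i ≤ m → j ≤ m → ev c (T.place m f (2 * i, 2 * j, t)) =
      potential m g (T.place m f (2 * i, 2 * j, t))) (f : T.F) {i j : ℕ} (hi : i < m) (hj : j ≤ m) :
    ev G (T.place m f (2 * i + 1, 2 * j, t)) = 0 := by
  rw [hG, ev_add, ev_δ_layer_fst f c hi hj ht, hc f i j hi.le hj,
    show 2 * i + 2 = 2 * (i + 1) by ring, hc f (i + 1) j hi hj, potential_place g f t hi.le hj,
    potential_place g f t hi hj, Finset.sum_range_succ (n := i)]
  grind

theorem gauge_snd_zero (ht : t = 0 ∨ t = 2) (hG : G = g + (RX m T).δ 0 c)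
    (hc : ∀ f i j, i ≤ m → j ≤ m → ev c (T.place m f (2 * i, 2 * j, t)) =
      potential m g (T.place m f (2 * i, 2 * j, t))) (f : T.F) {j : ℕ} (hj : j < m) :
    ev G (T.place m f (0, 2 * j + 1, t)) = 0 := by
  have h₁ := ev_δ_layer_snd f c (Nat.zero_le m) hj ht
  rw [show 2 * j + 2 = 2 * (j + 1) by ring, hc f 0 j (Nat.zero_le m) hj.le,
    hc f 0 (j + 1) (Nat.zero_le m) hj, potential_place g f t (Nat.zero_le m) hj.le,
    potential_place g f t (Nat.zero_le m) hj, Finset.sum_range_succ (n := j)] at h₁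
  simp only [mul_zero, Finset.range_zero, Finset.sum_empty] at h₁
  rw [hG, ev_add, h₁]
  grind

/-- With the other direction gone, each cell check is the sum of just two opposite sides; the row
telescopes from the side `a = 0`, where `G` vanishes. -/
theorem gauge_snd (ht : t = 0 ∨ t = 2) (hG : G = g + (RX m T).δ 0 c)
    (hc : ∀ f i j, i ≤ m → j ≤ m → ev c (T.place m f (2 * i, 2 * j, t)) =
      potential m g (T.place m f (2 * i, 2 * j, t))) (f : T.F) {i j : ℕ} (hi : i ≤ m) (hj : j < m) :
    ev G (T.place m f (2 * i, 2 * j + 1, t)) = ∑ i' ∈ Finset.range i,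
      ev ((RX m T).δ 1 G) (T.place m f (2 * i' + 1, 2 * j + 1, t)) := by
  induction i with
  | zero => exact gauge_snd_zero ht hG hc f hj
  | succ i ih =>
    have h₁ := gauge_fst ht hG hc f hi hj.le
    have h₂ := gauge_fst ht hG hc f hi (j := j + 1) hj
    rw [Finset.sum_range_succ, ← ih (by omega), ev_δ_cell f G hi hj ht, h₁,
      show 2 * j + 2 = 2 * (j + 1) by ring, h₂, show 2 * (i + 1) = 2 * i + 2 by ring]
    grind

end gauge

/-! ### Filling a syndrome inside `Y_x` -/

/-- The height of a vertex of the glued complex. -/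
def labelHeight (T : TannerComplex) : T.Label → ℕ
  | .onVertex _ h => h
  | .onEdge _ _ _ h => h
  | .onFace _ _ _ h => h

/-- The vertical translate of a vertex to height `h`. -/
def setHeight (T : TannerComplex) (h : ℕ) : T.Label → T.Label
  | .onVertex v _ => .onVertex v h
  | .onEdge u w k _ => .onEdge u w k h
  | .onFace f a b _ => .onFace f a b h

/-- The vertex lies over the boundary of the star of an `X`-check. -/
def OnWall (T : TannerComplex) (m : ℕ) : T.Label → Prop
  | .onVertex _ _ => False
  | .onEdge _ _ k _ => k = 2 * m
  | .onFace _ a b _ => a = 2 * m ∨ b = 2 * m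

theorem labelHeight_place (f : T.F) (p : ℕ × ℕ × ℕ) :
    T.labelHeight (T.place m f p) = p.2.2 := by
  unfold place
  split_ifs <;> rfl

theorem setHeight_place (f : T.F) (a b h h' : ℕ) :
    T.setHeight h' (T.place m f (a, b, h)) = T.place m f (a, b, h') := by
  simp only [place]
  split_ifs <;> rfl

theorem onWall_place (hm : 1 ≤ m) (f : T.F) {a b : ℕ} (h : ℕ) (ha : a ≤ 2 * m) (hb : b ≤ 2 * m) :
    T.OnWall m (T.place m f (a, b, h)) ↔ a = 2 * m ∨ b = 2 * m := by
  simp only [place]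
  split_ifs <;> simp only [OnWall, false_iff] <;> omega

/-- Every cochain is cohomologous to one that vanishes on the vertical edges and on the edges of
one layer in one of its two directions. -/
theorem exists_gauge (hm : 1 ≤ m) (hT : (RX m T).PathUnique) (g : (RX m T).C 1) {t s : ℕ}
    (hts : t = 0 ∧ s = 2 ∨ t = 2 ∧ s = 0) :
    ∃ G : (RX m T).C 1, (RX m T).δ 1 G = (RX m T).δ 1 g ∧
      (∀ f i j, i < m → j ≤ m → ev G (T.place m f (2 * i + 1, 2 * j, t)) = 0) ∧
      (∀ f i j, i ≤ m → j < m → ev G (T.place m f (2 * i, 2 * j + 1, t)) =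
        ∑ i' ∈ Finset.range i, ev ((RX m T).δ 1 G) (T.place m f (2 * i' + 1, 2 * j + 1, t))) ∧
      (∀ f i j, i ≤ m → j ≤ m → (i = m ∨ j = m) → ev G (T.place m f (2 * i, 2 * j, 1)) = 0) := by
  -- On the rim of layer `s` the value is forced by the requirement that the vertical edge to layer
  -- `t` be cancelled; inside that layer it is arbitrary, taken to be `0`.
  let Φ : T.Label → ZMod 2 := fun L => if T.labelHeight L = t then potential m g L else
    if T.OnWall m L then potential m g (T.setHeight t L) + ev g (T.setHeight 1 L) else 0
  let c : (RX m T).C 0 := fun u => Φ u.1.1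
  have ht : t = 0 ∨ t = 2 := by omega
  have hc : ∀ f i j, i ≤ m → j ≤ m → ev c (T.place m f (2 * i, 2 * j, t)) =
      potential m g (T.place m f (2 * i, 2 * j, t)) := by
    intro f i j hi hj
    refine (ev_ofLabel Φ f (by rw [mem_slab]; omega) (by simp only; omega)).trans ?_
    simp only [Φ, labelHeight_place, if_true]
  have hc' : ∀ f i j, i ≤ m → j ≤ m → (i = m ∨ j = m) → ev c (T.place m f (2 * i, 2 * j, s)) =
      potential m g (T.place m f (2 * i, 2 * j, t)) + ev g (T.place m f (2 * i, 2 * j, 1)) := by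
    intro f i j hi hj hij
    refine (ev_ofLabel Φ f (by rw [mem_slab]; omega) (by simp only; omega)).trans ?_
    simp only [Φ, labelHeight_place, setHeight_place]
    rw [if_neg (by omega), if_pos ((onWall_place hm f s (by omega) (by omega)).mpr (by omega))]
  refine ⟨g + (RX m T).δ 0 c, ?_, ?_, ?_, ?_⟩
  · rw [map_add, hT.δ_δ, add_zero]
  · exact fun f i j hi hj => gauge_fst ht rfl hc f hi hj
  · exact fun f i j hi hj => gauge_snd ht rfl hc f hi hj
  · intro f i j hi hj hij
    have h₁ := hc f i j hi hj
    have h₂ := hc' f i j hi hj hij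
    rw [ev_add, ev_δ_vertical f c hi hj hij]
    rcases hts with ⟨rfl, rfl⟩ | ⟨rfl, rfl⟩
    · rw [h₁, h₂]; grind
    · rw [h₁, h₂]; grind

/-- A cochain that is closed on all `Y_x` is cohomologous to one that vanishes on all `Y_x`. -/
theorem exists_vanishing (hP : (RX m T).PathUnique) (hL : T.LinkConnected)
    (g : (RX m T).C 1)
    (hg : ∀ w : (RX m T).VDeg 2, T.deg (T.owner m w.1) = 0 → (RX m T).δ 1 g w = 0) :
    ∃ G : (RX m T).C 1, (RX m T).δ 1 G = (RX m T).δ 1 g ∧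
      ∀ u : (RX m T).VDeg 1, T.deg (T.owner m u.1) = 0 → G u = 0 := by
  have hev : ∀ G : (RX m T).C 1, (RX m T).δ 1 G = (RX m T).δ 1 g → ∀ f p, p ∈ slab m →
      p.1 ≤ 2 * m → p.2.1 ≤ 2 * m → p.1 % 2 + p.2.1 % 2 + p.2.2 % 2 = 2 →
      ev ((RX m T).δ 1 G) (T.place m f p) = 0 := by
    intro G hG f p hp ha hb hd
    rw [hG]
    have := ev_val ((RX m T).δ 1 g) (vert f hp hd)
    refine this.trans (hg _ ?_)
    change T.deg (T.labelOwner (T.place m f p)) = 0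
    rw [deg_labelOwner_place f hp, if_pos ha, if_pos hb]
  let c₁ : (RX m T).C 0 := fun u => potential m g u.1.1
  let G₁ := g + (RX m T).δ 0 c₁
  have hG₁ : (RX m T).δ 1 G₁ = (RX m T).δ 1 g := by rw [map_add, hP.δ_δ, add_zero]
  have hc₁ : ∀ t, (t = 0 ∨ t = 2) → ∀ f i j, i ≤ m → j ≤ m →
      ev c₁ (T.place m f (2 * i, 2 * j, t)) = potential m g (T.place m f (2 * i, 2 * j, t)) := by
    intro t ht f i j hi hj
    exact ev_ofLabel _ f (by rw [mem_slab]; omega) (by simp only; omega)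
  have v₁ : ∀ t, (t = 0 ∨ t = 2) → ∀ f i j, i < m → j ≤ m →
      ev G₁ (T.place m f (2 * i + 1, 2 * j, t)) = 0 :=
    fun t ht f i j hi hj => gauge_fst ht rfl (hc₁ t ht) f hi hj
  have v₂ : ∀ t, (t = 0 ∨ t = 2) → ∀ f i j, i ≤ m → j < m →
      ev G₁ (T.place m f (2 * i, 2 * j + 1, t)) = 0 := by
    intro t ht f i j hi hj
    rw [gauge_snd ht rfl (hc₁ t ht) f hi hj]
    refine Finset.sum_eq_zero fun i' hi' => ?_
    rw [Finset.mem_range] at hi'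
    exact hev G₁ hG₁ f _ (by rw [mem_slab]; omega) (by simp only; omega) (by simp only; omega)
      (by simp only; omega)
  -- Both layers are now clear, so a wall check sees only its two vertical qubits, and its silence
  -- makes them equal.
  have left : ∀ f j, j ≤ m →
      ev G₁ (T.place m f (2 * m, 2 * j, 1)) = ev G₁ (T.place m f (2 * m, 0, 1)) := by
    intro f j hj
    induction j with
    | zero => rfl
    | succ j ih =>
      have h₁ := ev_δ_wall_left f G₁ (j := j) hj
      rw [hev G₁ hG₁ f _ (by rw [mem_slab]; omega) (by simp only; omega) (by simp only; omega)
        (by simp only; omega), v₂ 0 (.inl rfl) f m j le_rfl hj, v₂ 2 (.inr rfl) f m j le_rfl hj,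
        ih (by omega)] at h₁
      rw [show 2 * (j + 1) = 2 * j + 2 by ring]
      grind
  have right : ∀ f i, i ≤ m →
      ev G₁ (T.place m f (2 * i, 2 * m, 1)) = ev G₁ (T.place m f (0, 2 * m, 1)) := by
    intro f i hi
    induction i with
    | zero => rfl
    | succ i ih =>
      have h₁ := ev_δ_wall_right f G₁ (i := i) hi
      rw [hev G₁ hG₁ f _ (by rw [mem_slab]; omega) (by simp only; omega) (by simp only; omega)
        (by simp only; omega), v₁ 0 (.inl rfl) f i m hi le_rfl, v₁ 2 (.inr rfl) f i m hi le_rfl,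
        ih (by omega)] at h₁
      rw [show 2 * (i + 1) = 2 * i + 2 by ring]
      grind
  let χ : T.V → T.V → ZMod 2 := fun x q => ev G₁ (edgePt x q (2 * m) 1)
  have hχ : ∀ f, χ (T.x f) (T.q₀ f) = χ (T.x f) (T.q₁ f) := by
    intro f
    have h₁ := left f m le_rfl
    have h₂ := right f m le_rfl
    rw [h₁, place_x_q₀ f 1 le_rfl, place_x_q₁ f 1 le_rfl] at h₂
    exact h₂
  -- The two walls of a face meet in the corner `(2m, 2m)`, and connectedness of the link of `x`
  -- then makes all vertical values of `Y_x` equal. This constant is removed by adding it throughout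
  -- the layer `h = 2`, which leaves both layers clear.
  let κ : T.V → ZMod 2 := fun x => if h : ∃ f, T.x f = x then χ x (T.q₀ h.choose) else 0
  have hκ : ∀ f, χ (T.x f) (T.q₀ f) = κ (T.x f) := by
    intro f
    have h : ∃ f', T.x f' = T.x f := ⟨f, rfl⟩
    simp only [κ]
    rw [dif_pos h]
    exact hL (χ (T.x f)) (T.x f) (fun g hg => by rw [← hg]; exact hχ g) f _ rfl h.choose_spec
  let Φ : T.Label → ZMod 2 := fun L => if T.labelHeight L = 2 then κ (T.labelOwner L) else 0
  let c₂ : (RX m T).C 0 := fun u => Φ u.1.1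
  have hc₂ : ∀ t, (t = 0 ∨ t = 2) → ∀ f i j, i ≤ m → j ≤ m →
      ev c₂ (T.place m f (2 * i, 2 * j, t)) = if t = 2 then κ (T.x f) else 0 := by
    intro t ht f i j hi hj
    have hp : (2 * i, 2 * j, t) ∈ slab m := by rw [mem_slab]; omega
    refine (ev_ofLabel Φ f hp (by simp only; omega)).trans ?_
    simp only [Φ, labelHeight_place]
    rw [labelOwner_place f hp]
    dsimp only
    rw [if_pos (show 2 * i ≤ 2 * m by omega), if_pos (show 2 * j ≤ 2 * m by omega)]
  refine ⟨G₁ + (RX m T).δ 0 c₂, by rw [map_add, hP.δ_δ, add_zero, hG₁], fun u hu => ?_⟩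
  rw [← ev_val (G₁ + _), ev_add]
  obtain ⟨f, -, ⟨i, j, h, hi, hj, hh, e⟩ | ⟨i, j, h, hi, hj, hh, e⟩ | ⟨i, j, hi, hj, hij, e⟩⟩ :=
    qubit_cases u hu
  · rw [e, v₁ h hh f i j hi hj, ev_δ_layer_fst f c₂ hi hj hh, hc₂ h hh f i j hi.le hj,
      show 2 * i + 2 = 2 * (i + 1) by ring, hc₂ h hh f (i + 1) j hi hj]
    grind
  · rw [e, v₂ h hh f i j hi hj, ev_δ_layer_snd f c₂ hi hj hh, hc₂ h hh f i j hi hj.le,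
      show 2 * j + 2 = 2 * (j + 1) by ring, hc₂ h hh f i (j + 1) hi hj]
    grind
  · have hval : ev G₁ (T.place m f (2 * i, 2 * j, 1)) = κ (T.x f) := by
      rw [← hκ f]
      rcases hij with rfl | rfl
      · rw [left f j hj, place_x_q₀ f 1 le_rfl]
      · rw [right f i hi, place_x_q₁ f 1 le_rfl, hχ f]
    rw [e, ev_δ_vertical f c₂ hi hj hij, hc₂ 0 (.inl rfl) f i j hi hj,
      hc₂ 2 (.inr rfl) f i j hi hj, hval]
    grind

/-! ### Fillings and the excitations they emit -/

theorem δ_congr {S : TannerComplex} {i : ℕ} {c d : S.C i} {w : S.VDeg (i + 1)}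
    (h : ∀ u : S.VDeg i, S.Adj u.1 w.1 → c u = d u) : S.δ i c w = S.δ i d w :=
  Finset.sum_congr rfl fun u _ => by
    by_cases hu : S.Adj u.1 w.1
    · rw [if_pos hu, if_pos hu, h u hu]
    · rw [if_neg hu, if_neg hu]

/-- The adjacent pairs through which the coboundary of `f` leaves the local complex `Y_v`. -/
def outPairs (T : TannerComplex) (m : ℕ) (v : T.V) (f : (RX m T).C 1) :
    Finset ((RX m T).VDeg 1 × (RX m T).VDeg 2) :=
  {p | T.owner m p.1.1 = v ∧ f p.1 ≠ 0 ∧ (RX m T).Adj p.1.1 p.2.1 ∧ T.owner m p.2.1 ≠ v}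

/-- The support of a syndrome in the local complex `Y_v`. -/
def localSupport (T : TannerComplex) (m : ℕ) (v : T.V) (s : (RX m T).C 2) :
    Finset ((RX m T).VDeg 2) :=
  {w | T.owner m w.1 = v ∧ s w ≠ 0}

/-- `f` is supported on `Y_v`, has the syndrome `s` there, and sends at most as many excitations to
other local complexes as it removes from `Y_v`. -/
structure Fills (T : TannerComplex) (m : ℕ) (v : T.V) (s : (RX m T).C 2) (f : (RX m T).C 1) :
    Prop where
  support : ∀ u, T.owner m u.1 ≠ v → f u = 0
  boundary : ∀ w, T.owner m w.1 = v → (RX m T).δ 1 f w = s w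
  weight : (T.outPairs m v f).card ≤ (T.localSupport m v s).card

theorem labelHeight_eq {f : T.F} {p : ℕ × ℕ × ℕ} {L : T.Label} (h : L = T.place m f p) :
    T.labelHeight L = p.2.2 := by rw [h, labelHeight_place]

/-- How the coboundary of a cochain without vertical part leaves `Y_x`. -/
theorem outPairs_cases {x : T.V} (hx : T.deg x = 0) {F G : (RX m T).C 1} (hF : ∀ u, F u ≠ 0 → G u ≠ 0)
    (hG : ∀ f i j, i ≤ m → j ≤ m → (i = m ∨ j = m) → ev G (T.place m f (2 * i, 2 * j, 1)) = 0)
    {p : (RX m T).VDeg 1 × (RX m T).VDeg 2} (hp : p ∈ T.outPairs m x F) :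
    ∃ f j h, T.x f = x ∧ j < m ∧ (h = 0 ∨ h = 2) ∧ ev G p.1.1.1 ≠ 0 ∧
      ((p.1.1.1 = T.place m f (2 * m, 2 * j + 1, h) ∧
        p.2.1.1 = T.place m f (2 * m + 1, 2 * j + 1, h)) ∨
       (p.1.1.1 = T.place m f (2 * j + 1, 2 * m, h) ∧
        p.2.1.1 = T.place m f (2 * j + 1, 2 * m + 1, h))) := by
  obtain ⟨u, w⟩ := p
  simp only [outPairs, Finset.mem_filter, Finset.mem_univ, true_and] at hp
  obtain ⟨hu, hFu, hadj, hw⟩ := hp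
  obtain ⟨f, ⟨a, b, h⟩, ⟨a', b', h'⟩, hp, hp', eu, ew, hs⟩ := adj_iff.mp hadj
  have hGu : ev G u.1.1 ≠ 0 := by rw [ev_val]; exact hF u hFu
  have hd : a % 2 + b % 2 + h % 2 = 1 := by
    have : T.labelDeg u.1.1 = 1 := u.2
    rw [eu, labelDeg_place] at this
    exact this
  have hu₀ : T.deg (T.labelOwner u.1.1) = 0 := by
    have : T.labelOwner u.1.1 = x := hu
    rw [this, hx]
  rw [eu, deg_labelOwner_place f hp] at hu₀
  dsimp only at hu₀
  have ha : a ≤ 2 * m := by by_contra ha; simp [ha] at hu₀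
  have hb : b ≤ 2 * m := by by_contra hb; simp [hb] at hu₀
  have hxf : T.x f = x := by
    rw [← hu, owner, eu, labelOwner_place f hp]
    simp [ha, hb]
  have hout : ¬(a' ≤ 2 * m ∧ b' ≤ 2 * m) := by
    rintro ⟨ha', hb'⟩
    apply hw
    rw [owner, ew, labelOwner_place f hp', ← hxf]
    simp [ha', hb']
  rw [mem_slab] at hp hp'
  rw [step_iff] at hs
  have hh : h ≠ 1 := by
    rintro rfl
    apply hGu
    rw [eu]
    have h1 := hG f (a / 2) (b / 2) (by omega) (by omega) (by omega)
    rwa [show 2 * (a / 2) = a by omega, show 2 * (b / 2) = b by omega] at h1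
  by_cases hA : a' = 2 * m + 1
  · obtain ⟨rfl, rfl, rfl, rfl⟩ : a = 2 * m ∧ a' = 2 * m + 1 ∧ b' = b ∧ h' = h := by omega
    refine ⟨f, b' / 2, h', hxf, by omega, by omega, hGu, .inl ?_⟩
    rw [show 2 * (b' / 2) + 1 = b' by omega]
    exact ⟨eu, ew⟩
  · obtain ⟨rfl, rfl, rfl, rfl⟩ : b = 2 * m ∧ b' = 2 * m + 1 ∧ a' = a ∧ h' = h := by omega
    refine ⟨f, a' / 2, h', hxf, by omega, by omega, hGu, .inr ?_⟩
    rw [show 2 * (a' / 2) + 1 = a' by omega]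
    exact ⟨eu, ew⟩

/-- A `Z`-check of `Y_x` to which an outgoing pair at height `h` can be charged. -/
def Charge (T : TannerComplex) (m t h : ℕ) (p : (RX m T).VDeg 1 × (RX m T).VDeg 2)
    (v : (RX m T).VDeg 2) : Prop :=
  (∃ f j, j < m ∧ p.1.1.1 = T.place m f (2 * m, 2 * j + 1, h) ∧
    p.2.1.1 = T.place m f (2 * m + 1, 2 * j + 1, h) ∧
    (v.1.1 = T.place m f (2 * m, 2 * j + 1, 1) ∨
      ∃ i < m, v.1.1 = T.place m f (2 * i + 1, 2 * j + 1, t))) ∨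
  (∃ f i, i < m ∧ p.1.1.1 = T.place m f (2 * i + 1, 2 * m, h) ∧
    p.2.1.1 = T.place m f (2 * i + 1, 2 * m + 1, h) ∧
    v.1.1 = T.place m f (2 * i + 1, 2 * m, 1))

/-- The charged check lies over the interior of a face, so its name reveals the face, the wall and
the row or column; the height `h` of the pair is fixed. Hence the charging is injective at each
height. -/
theorem Charge.eq (hm : 1 ≤ m) {t h : ℕ}
    {p q : (RX m T).VDeg 1 × (RX m T).VDeg 2} {v : (RX m T).VDeg 2}
    (hp : T.Charge m t h p v) (hq : T.Charge m t h q v) : p = q := by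
  have face : ∀ (f f' : T.F) (a b k a' b' k' : ℕ), a ≠ 0 → b ≠ 0 → a ≤ 2 * m → b ≤ 2 * m →
      T.place m f (a, b, k) = T.place m f' (a', b', k') → f = f' ∧ a = a' ∧ b = b' ∧ k = k' := by
    intro f f' a b k a' b' k' ha hb ha' hb' e
    rw [place_onFace f k ha hb (by omega) (by omega), eq_comm, place_eq_onFace] at e
    simp only [Prod.mk.injEq] at e
    exact ⟨e.1.symm, e.2.1.1.symm, e.2.1.2.1.symm, e.2.1.2.2.symm⟩
  have ext : ∀ L L', p.1.1.1 = L → q.1.1.1 = L → p.2.1.1 = L' → q.2.1.1 = L' → p = q :=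
    fun L L' h₁ h₂ h₃ h₄ => Prod.ext (Subtype.ext (Subtype.ext (h₁.trans h₂.symm)))
      (Subtype.ext (Subtype.ext (h₃.trans h₄.symm)))
  rcases hp with ⟨f, j, hj, e₁, e₂, e₃ | ⟨i, hi, e₃⟩⟩ | ⟨f, i, hi, e₁, e₂, e₃⟩ <;>
    rcases hq with ⟨f', j', hj', e₁', e₂', e₃' | ⟨i', hi', e₃'⟩⟩ | ⟨f', i', hi', e₁', e₂', e₃'⟩ <;>
    obtain ⟨rfl, h₁, h₂, h₃⟩ := face _ _ _ _ _ _ _ _ (by omega) (by omega) (by omega) (by omega)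
      (e₃.symm.trans e₃')
  · obtain rfl : j = j' := by omega
    exact ext _ _ e₁ e₁' e₂ e₂'
  · omega
  · omega
  · omega
  · obtain rfl : j = j' := by omega
    exact ext _ _ e₁ e₁' e₂ e₂'
  · omega
  · omega
  · omega
  · obtain rfl : i = i' := by omega
    exact ext _ _ e₁ e₁' e₂ e₂'

/-- The filling is the restriction to `Y_x` of a gauged preimage of the syndrome; the weight bound
comes from the charging scheme with the less excited layer as `t`. -/
theorem exists_fills_x (hm : 1 ≤ m) (hP : (RX m T).PathUnique) (g : (RX m T).C 1) {x : T.V}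
    (hx : T.deg x = 0) : ∃ f, T.Fills m x ((RX m T).δ 1 g) f := by
  let A : ℕ → Finset ((RX m T).VDeg 2) := fun t =>
    (T.localSupport m x ((RX m T).δ 1 g)).filter fun w => T.labelHeight w.1.1 = t
  have hA : (A 0).card + (A 1).card + (A 2).card ≤
      (T.localSupport m x ((RX m T).δ 1 g)).card := by
    have hd : ∀ i j, i ≠ j → Disjoint (A i) (A j) := by
      intro i j hij
      refine Finset.disjoint_filter.mpr fun w _ h₁ h₂ => hij (h₁.symm.trans h₂)
    rw [← Finset.card_union_of_disjoint (hd 0 1 (by norm_num)), ← Finset.card_union_of_disjoint]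
    · refine Finset.card_le_card (Finset.union_subset (Finset.union_subset ?_ ?_) ?_) <;>
        exact Finset.filter_subset _ _
    · exact Finset.disjoint_union_left.mpr ⟨hd 0 2 (by norm_num), hd 1 2 (by norm_num)⟩
  obtain ⟨t, s, hts, hcard⟩ : ∃ t s, (t = 0 ∧ s = 2 ∨ t = 2 ∧ s = 0) ∧
      (A t).card ≤ (A s).card := by
    rcases le_total (A 0).card (A 2).card with h | h
    exacts [⟨0, 2, .inl ⟨rfl, rfl⟩, h⟩, ⟨2, 0, .inr ⟨rfl, rfl⟩, h⟩]
  have ht : t = 0 ∨ t = 2 := by omega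
  obtain ⟨G, hG, g₁, g₂, g₃⟩ := exists_gauge hm hP g hts
  let F : (RX m T).C 1 := T.restr m x G
  have hF : ∀ u, F u ≠ 0 → G u ≠ 0 := by
    intro u hu
    simp only [F, restr] at hu
    split_ifs at hu
    · exact hu
    · exact absurd rfl hu
  refine ⟨F, fun u hu => if_neg hu, fun w hw => ?_, ?_⟩
  · rw [← hG]
    -- Nothing flows into `Y_x` from outside, so cutting `G` down to `Y_x` leaves its coboundary
    -- there unchanged.
    refine δ_congr fun u hu => if_pos ?_
    by_contra hne
    have := deg_owner_of_adj hu (by rwa [hw])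
    rw [hw, hx] at this
    omega
  have mem_A : ∀ (f : T.F) (q : ℕ × ℕ × ℕ) (hq : q ∈ slab m)
      (hd : q.1 % 2 + q.2.1 % 2 + q.2.2 % 2 = 2), T.x f = x → q.1 ≤ 2 * m → q.2.1 ≤ 2 * m →
      ev ((RX m T).δ 1 G) (T.place m f q) ≠ 0 → (vert f hq hd : (RX m T).VDeg 2) ∈ A q.2.2 := by
    intro f q hq hd hf ha hb he
    simp only [A, localSupport, Finset.mem_filter, Finset.mem_univ, true_and]
    refine ⟨⟨?_, ?_⟩, ?_⟩
    · change T.labelOwner (T.place m f q) = x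
      rw [labelOwner_place f hq, if_pos ha, if_pos hb, hf]
    · rw [← hG, ← ev_val ((RX m T).δ 1 G)]
      exact he
    · exact labelHeight_place f q
  have row : ∀ f j, T.x f = x → j < m → ev G (T.place m f (2 * m, 2 * j + 1, t)) ≠ 0 →
      ∃ v ∈ A t, ∃ i < m, v.1.1 = T.place m f (2 * i + 1, 2 * j + 1, t) := by
    intro f j hf hj hne
    rw [g₂ f m j le_rfl hj] at hne
    obtain ⟨i, hi, hne⟩ := Finset.exists_ne_zero_of_sum_ne_zero hne
    rw [Finset.mem_range] at hi
    exact ⟨_, mem_A f (2 * i + 1, 2 * j + 1, t) (by rw [mem_slab]; omega) (by simp only; omega) hf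
      (by simp only; omega) (by simp only; omega) hne, i, hi, rfl⟩
  let P : ℕ → Finset ((RX m T).VDeg 1 × (RX m T).VDeg 2) := fun h =>
    (T.outPairs m x F).filter fun p => T.labelHeight p.1.1.1 = h
  have hPt : (P t).card ≤ (A t).card := by
    refine Finset.card_le_card_of_forall_subsingleton (T.Charge m t t) ?_
      fun v _ p hp q hq => Charge.eq hm hp.2 hq.2
    intro p hp
    obtain ⟨hp, hpt⟩ := Finset.mem_filter.mp hp
    obtain ⟨f, j, h, hf, hj, hh, hne, ⟨e₁, e₂⟩ | ⟨e₁, e₂⟩⟩ := outPairs_cases hx hF g₃ hp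
    · obtain rfl : h = t := (labelHeight_eq e₁).symm.trans hpt
      rw [e₁] at hne
      obtain ⟨v, hv, i, hi, e⟩ := row f j hf hj hne
      exact ⟨v, hv, .inl ⟨f, j, hj, e₁, e₂, .inr ⟨i, hi, e⟩⟩⟩
    · obtain rfl : h = t := (labelHeight_eq e₁).symm.trans hpt
      rw [e₁, g₁ f j m hj le_rfl] at hne
      exact absurd rfl hne
  -- Vertical edges vanish, so a wall check is the sum of the values of `G` above and below it. If
  -- `G` is nonzero in layer `s`, either that check is excited or `G` is nonzero in layer `t` too,
  -- which points to an excitation of the row.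
  have hPs : (P s).card ≤ (A t).card + (A 1).card := by
    refine le_trans ?_ (Finset.card_union_le (A t) (A 1))
    refine Finset.card_le_card_of_forall_subsingleton (T.Charge m t s) ?_
      fun v _ p hp q hq => Charge.eq hm hp.2 hq.2
    intro p hp
    obtain ⟨hp, hps⟩ := Finset.mem_filter.mp hp
    obtain ⟨f, j, h, hf, hj, hh, hne, ⟨e₁, e₂⟩ | ⟨e₁, e₂⟩⟩ := outPairs_cases hx hF g₃ hp
    · obtain rfl : h = s := (labelHeight_eq e₁).symm.trans hps
      by_cases hw : ev ((RX m T).δ 1 G) (T.place m f (2 * m, 2 * j + 1, 1)) = 0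
      · have hw' := ev_δ_wall_left f G hj
        rw [hw, g₃ f m j le_rfl hj.le (.inl rfl), show 2 * j + 2 = 2 * (j + 1) by ring,
          g₃ f m (j + 1) le_rfl hj (.inl rfl)] at hw'
        have hne' : ev G (T.place m f (2 * m, 2 * j + 1, t)) ≠ 0 := by
          rw [e₁] at hne
          intro h0
          apply hne
          rcases hts with ⟨rfl, rfl⟩ | ⟨rfl, rfl⟩ <;> grind
        obtain ⟨v, hv, i, hi, e⟩ := row f j hf hj hne'
        exact ⟨v, Finset.mem_union_left _ hv, .inl ⟨f, j, hj, e₁, e₂, .inr ⟨i, hi, e⟩⟩⟩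
      · exact ⟨_, Finset.mem_union_right _ (mem_A f (2 * m, 2 * j + 1, 1) (by rw [mem_slab]; omega)
          (by simp only; omega) hf (by simp only; omega) (by simp only; omega) hw),
          .inl ⟨f, j, hj, e₁, e₂, .inl rfl⟩⟩
    · obtain rfl : h = s := (labelHeight_eq e₁).symm.trans hps
      have hw : ev ((RX m T).δ 1 G) (T.place m f (2 * j + 1, 2 * m, 1)) ≠ 0 := by
        rw [ev_δ_wall_right f G hj, g₃ f j m hj.le le_rfl (.inr rfl),
          show 2 * j + 2 = 2 * (j + 1) by ring, g₃ f (j + 1) m hj le_rfl (.inr rfl)]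
        have := g₁ f j m hj le_rfl
        rw [e₁] at hne
        rcases hts with ⟨rfl, rfl⟩ | ⟨rfl, rfl⟩ <;> grind
      exact ⟨_, Finset.mem_union_right _ (mem_A f (2 * j + 1, 2 * m, 1) (by rw [mem_slab]; omega)
          (by simp only; omega) hf (by simp only; omega) (by simp only; omega) hw),
          .inr ⟨f, j, hj, e₁, e₂, rfl⟩⟩
  have hcov : T.outPairs m x F ⊆ P t ∪ P s := by
    intro p hp
    obtain ⟨f, j, h, hf, hj, hh, hne, h₁⟩ := outPairs_cases hx hF g₃ hp
    have hht : T.labelHeight p.1.1.1 = h := by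
      rcases h₁ with h₁ | h₁ <;> exact labelHeight_eq h₁.1
    simp only [P, Finset.mem_union, Finset.mem_filter, hht]
    rcases show h = t ∨ h = s by omega with e | e
    exacts [.inl ⟨hp, e⟩, .inr ⟨hp, e⟩]
  -- The emissions number at most `2 |A t| + |A 1|`, and one of the two `|A t|` is bounded by `|A
  -- s|`.
  have h₁ := (Finset.card_le_card hcov).trans (Finset.card_union_le _ _)
  rcases hts with ⟨rfl, rfl⟩ | ⟨rfl, rfl⟩ <;> omega

/-! ### The local complexes `Y_q` -/

theorem edgePt_inj {q z z' : T.V} {k h k' h' : ℕ} (hk : k ≠ 0)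
    (e : edgePt q z k h = edgePt q z' k' h') : z = z' ∧ k = k' ∧ h = h' := by
  unfold edgePt at e
  rw [if_neg hk] at e
  split_ifs at e
  simp only [Label.onEdge.injEq, true_and] at e
  exact e

theorem edgePt_inj' {q z : T.V} {k h k' h' : ℕ}
    (e : edgePt q z k h = edgePt q z k' h') : k = k' ∧ h = h' := by
  by_cases hk : k = 0
  · by_cases hk' : k' = 0
    · subst hk hk'
      simp only [edgePt, if_true, Label.onVertex.injEq, true_and] at e
      exact ⟨rfl, e⟩
    · have := edgePt_inj hk' e.symm
      omega
  · exact (edgePt_inj hk e).2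

/-- The points over the edge `q → z`, in a copy of the slab that contains them. -/
theorem exists_copy_q_z (m : ℕ) {q z : T.V} (hq : T.deg q = 1) (hz : T.Adj q z) :
    ∃ f, T.z f = z ∧
      ((T.q₀ f = q ∧ ∀ k h, k ≤ 2 * m → T.place m f (2 * m + 1, k, h) = edgePt q z k h) ∨
      (T.q₁ f = q ∧ ∀ k h, k ≤ 2 * m → T.place m f (k, 2 * m + 1, h) = edgePt q z k h)) := by
  obtain ⟨f, rfl, rfl | rfl⟩ := adj_q_z hq hz
  · exact ⟨f, rfl, .inl ⟨rfl, fun k h hk => place_q₀_z f h hk⟩⟩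
  · exact ⟨f, rfl, .inr ⟨rfl, fun k h hk => place_q₁_z f h hk⟩⟩

theorem exists_edge_vert {q z : T.V} (hq : T.deg q = 1) (hz : T.Adj q z) {k h i : ℕ}
    (hk : k ≤ 2 * m) (hh : h ≤ 2) (h1 : h = 1 → k = 2 * m) (hi : 1 + k % 2 + h % 2 = i) :
    ∃ u : (RX m T).VDeg i, u.1.1 = edgePt q z k h := by
  obtain ⟨f, -, ⟨-, he⟩ | ⟨-, he⟩⟩ := exists_copy_q_z m hq hz
  · rw [← he k h hk]
    exact ⟨vert f (p := (2 * m + 1, k, h)) (by rw [mem_slab]; omega) (by simp only; omega), rfl⟩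
  · rw [← he k h hk]
    exact ⟨vert f (p := (k, 2 * m + 1, h)) (by rw [mem_slab]; omega) (by simp only; omega), rfl⟩

theorem adj_edgePt {q z : T.V} (hq : T.deg q = 1) (hz : T.Adj q z) {k h k' h' : ℕ}
    {u w : (RX m T).V} (hu : u.1 = edgePt q z k h) (hw : w.1 = edgePt q z k' h')
    (hk : k ≤ 2 * m) (hh : h ≤ 2)
    (hk' : k' ≤ 2 * m) (hh' : h' ≤ 2) (h1' : h' = 1 → k' = 2 * m)
    (hs : (k % 2 = 0 ∧ (k' = k + 1 ∨ k = k' + 1) ∧ h' = h) ∨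
      (h % 2 = 0 ∧ (h' = h + 1 ∨ h = h' + 1) ∧ k' = k)) : (RX m T).Adj u w := by
  rw [adj_iff]
  obtain ⟨f, -, ⟨-, he⟩ | ⟨-, he⟩⟩ := exists_copy_q_z m hq hz
  · exact ⟨f, (2 * m + 1, k, h), (2 * m + 1, k', h'), by rw [mem_slab]; omega,
      by rw [mem_slab]; omega, by rw [hu, he k h hk], by rw [hw, he k' h' hk'],
      by rw [step_iff]; omega⟩
  · exact ⟨f, (k, 2 * m + 1, h), (k', 2 * m + 1, h'), by rw [mem_slab]; omega,
      by rw [mem_slab]; omega, by rw [hu, he k h hk], by rw [hw, he k' h' hk'],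
      by rw [step_iff]; omega⟩

theorem exists_edgePt_of_adj {q z : T.V} (hq : T.deg q = 1) {k' h' : ℕ}
    {u w : (RX m T).V} (hw : w.1 = edgePt q z k' h') (hk' : k' ≠ 0)
    (hadj : (RX m T).Adj u w) (hu : T.deg (T.owner m u) ≠ 0) :
    ∃ k h, u.1 = edgePt q z k h ∧ h ≤ 2 ∧
      ((k % 2 = 0 ∧ (k' = k + 1 ∨ k = k' + 1) ∧ h' = h) ∨
        (h % 2 = 0 ∧ (h' = h + 1 ∨ h = h' + 1) ∧ k' = k)) ∧ k ≤ 2 * m + 1 ∧ k' ≤ 2 * m := by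
  obtain ⟨f, ⟨a, b, h⟩, ⟨a', b', h''⟩, hp, hp', eu, ew, hs⟩ := adj_iff.mp hadj
  rw [owner, eu, deg_labelOwner_place f hp] at hu
  rw [mem_slab] at hp hp'
  rw [step_iff] at hs
  dsimp only at hu
  have hab : ¬(a ≤ 2 * m ∧ b ≤ 2 * m) := fun h => hu (by simp [h])
  rw [hw, edgePt, if_neg hk', eq_comm, place_eq_onEdge] at ew
  have d₁ := T.deg_x f
  obtain ⟨rfl, -, hk'', hc⟩ := ew
  rcases hc with hc | ⟨rfl, rfl, rfl, rfl⟩ | hc | ⟨rfl, rfl, rfl, rfl⟩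
  · grind
  · obtain rfl : a = 2 * m + 1 := by omega
    exact ⟨b, h, by rw [eu, place_q₀_z f h (by omega)], by omega, by omega, by omega, by omega⟩
  · grind
  · obtain rfl : b = 2 * m + 1 := by omega
    exact ⟨a, h, by rw [eu, place_q₁_z f h (by omega)], by omega, by omega, by omega, by omega⟩

theorem qubit_cases_q {q : T.V} (hq : T.deg q = 1) (u : (RX m T).VDeg 1)
    (hu : T.owner m u.1 = q) : ∃ z k h, T.Adj q z ∧ k ≤ m ∧ (h = 0 ∨ h = 2) ∧
      u.1.1 = edgePt q z (2 * k) h := by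
  obtain ⟨f, ⟨a, b, h⟩, hp, hd, rfl⟩ := exists_vert u
  have ho : T.labelOwner (T.place m f (a, b, h)) = q := hu
  have hdo := deg_labelOwner_place f hp
  rw [ho, hq] at hdo
  rw [labelOwner_place f hp] at ho
  have hp' := mem_slab.mp hp
  have hd' : a % 2 + b % 2 + h % 2 = 1 := hd
  change ∃ z k h', T.Adj q z ∧ k ≤ m ∧ (h' = 0 ∨ h' = 2) ∧
    T.place m f (a, b, h) = edgePt q z (2 * k) h'
  clear hp hd hu
  dsimp only at ho hdo
  split_ifs at ho hdo with ha hb hb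
  · omega
  · refine ⟨T.z f, a / 2, h, ?_, by omega, by omega, ?_⟩
    · rw [← ho]; exact ⟨f, .inr <| .inr <| .inr ⟨rfl, rfl⟩⟩
    · rw [show 2 * (a / 2) = a by omega, ← ho, ← place_q₁_z f h ha]
      rw [show 2 * m + 1 = b by omega]
  · refine ⟨T.z f, b / 2, h, ?_, by omega, by omega, ?_⟩
    · rw [← ho]; exact ⟨f, .inr <| .inr <| .inl ⟨rfl, rfl⟩⟩
    · rw [show 2 * (b / 2) = b by omega, ← ho, ← place_q₀_z f h hb]
      rw [show 2 * m + 1 = a by omega]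
  · omega

theorem zCheck_cases_q {q : T.V} (hq : T.deg q = 1) (w : (RX m T).VDeg 2)
    (hw : T.owner m w.1 = q) : ∃ z, T.Adj q z ∧
      ((∃ k h, k < m ∧ (h = 0 ∨ h = 2) ∧ w.1.1 = edgePt q z (2 * k + 1) h) ∨
        w.1.1 = edgePt q z (2 * m) 1) := by
  obtain ⟨f, ⟨a, b, h⟩, hp, hd, rfl⟩ := exists_vert w
  have ho : T.labelOwner (T.place m f (a, b, h)) = q := hw
  have hdo := deg_labelOwner_place f hp
  rw [ho, hq] at hdo
  rw [labelOwner_place f hp] at ho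
  have hp' := mem_slab.mp hp
  have hd' : a % 2 + b % 2 + h % 2 = 2 := hd
  change ∃ z, T.Adj q z ∧ ((∃ k h', k < m ∧ (h' = 0 ∨ h' = 2) ∧
    T.place m f (a, b, h) = edgePt q z (2 * k + 1) h') ∨ T.place m f (a, b, h) = edgePt q z (2 * m) 1)
  clear hp hd hw
  dsimp only at ho hdo
  split_ifs at ho hdo with ha hb hb
  · omega
  · refine ⟨T.z f, ?_, ?_⟩
    · rw [← ho]; exact ⟨f, .inr <| .inr <| .inr ⟨rfl, rfl⟩⟩
    · have e : T.place m f (a, b, h) = edgePt q (T.z f) a h := by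
        rw [← ho, ← place_q₁_z f h ha, show 2 * m + 1 = b by omega]
      by_cases h1 : h = 1
      · subst h1
        obtain rfl : a = 2 * m := by omega
        exact .inr e
      · refine .inl ⟨a / 2, h, by omega, by omega, ?_⟩
        rw [show 2 * (a / 2) + 1 = a by omega]
        exact e
  · refine ⟨T.z f, ?_, ?_⟩
    · rw [← ho]; exact ⟨f, .inr <| .inr <| .inl ⟨rfl, rfl⟩⟩
    · have e : T.place m f (a, b, h) = edgePt q (T.z f) b h := by
        rw [← ho, ← place_q₀_z f h hb, show 2 * m + 1 = a by omega]
      by_cases h1 : h = 1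
      · subst h1
        obtain rfl : b = 2 * m := by omega
        exact .inr e
      · refine .inl ⟨b / 2, h, by omega, by omega, ?_⟩
        rw [show 2 * (b / 2) + 1 = b by omega]
        exact e
  · omega

theorem labelOwner_edgePt (q z : T.V) (k h : ℕ) : T.labelOwner (edgePt q z k h) = q := by
  unfold edgePt
  split_ifs <;> rfl

/-! ### Coboundaries along the arms of `Y_q` -/

section arms
variable {g : (RX m T).C 1} {q z : T.V}

/-- A check on an arm also sees a qubit of `Y_x` in each copy containing it; as `g` vanishes on
those, only its neighbours along the arm contribute. -/
theorem ev_δ_edgePt (hg : ∀ u : (RX m T).VDeg 1, T.deg (T.owner m u.1) = 0 → g u = 0)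
    (hq : T.deg q = 1) (hz : T.Adj q z) {k' h' : ℕ} (hk : k' ≠ 0) (hk' : k' ≤ 2 * m) (hh' : h' ≤ 2)
    (h1' : h' = 1 → k' = 2 * m) (hd : k' % 2 + h' % 2 = 1) (s : Finset (ℕ × ℕ))
    (hs : ∀ p : ℕ × ℕ, p ∈ s ↔ p.1 ≤ 2 * m ∧ p.2 ≤ 2 ∧ (p.2 = 1 → p.1 = 2 * m) ∧
      ((p.1 % 2 = 0 ∧ (k' = p.1 + 1 ∨ p.1 = k' + 1) ∧ h' = p.2) ∨
        (p.2 % 2 = 0 ∧ (h' = p.2 + 1 ∨ p.2 = h' + 1) ∧ k' = p.1))) :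
    ev ((RX m T).δ 1 g) (edgePt q z k' h') = ∑ p ∈ s, ev g (edgePt q z p.1 p.2) := by
  obtain ⟨w, hw⟩ := exists_edge_vert (i := 2) hq hz hk' hh' h1' (by omega)
  rw [← hw, ev_val]
  refine δ_apply_eq_sum g w s (fun p => edgePt q z p.1 p.2)
    (fun p _ p' _ e => Prod.ext (edgePt_inj' e).1 (edgePt_inj' e).2) fun u hu => ?_
  constructor
  · intro hadj
    obtain ⟨k, h, e, hh, hst, hk, -⟩ := exists_edgePt_of_adj hq hw hk hadj fun h0 => hu (hg u h0)
    have hu₁ : T.labelDeg u.1.1 = 1 := u.2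
    exact ⟨(k, h), (hs _).mpr (by simp only; omega), e⟩
  · rintro ⟨⟨k, h⟩, hp, e⟩
    rw [hs] at hp
    dsimp only at hp
    exact adj_edgePt hq hz e hw hp.1 hp.2.1 hk' hh' h1' hp.2.2.2

theorem ev_δ_arm (hg : ∀ u : (RX m T).VDeg 1, T.deg (T.owner m u.1) = 0 → g u = 0)
    (hq : T.deg q = 1) (hz : T.Adj q z) {k h : ℕ} (hk : k < m) (hh : h = 0 ∨ h = 2) :
    ev ((RX m T).δ 1 g) (edgePt q z (2 * k + 1) h) =
      ev g (edgePt q z (2 * k) h) + ev g (edgePt q z (2 * (k + 1)) h) := by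
  rw [ev_δ_edgePt hg hq hz (by omega) (by omega) (by omega) (by omega) (by omega)
    {(2 * k, h), (2 * (k + 1), h)}]
  · rw [Finset.sum_pair (by simp)]
  · rintro ⟨a, b⟩
    simp only [Finset.mem_insert, Finset.mem_singleton, Prod.mk.injEq]
    omega

theorem ev_δ_end (hm : 1 ≤ m) (hg : ∀ u : (RX m T).VDeg 1, T.deg (T.owner m u.1) = 0 → g u = 0)
    (hq : T.deg q = 1) (hz : T.Adj q z) :
    ev ((RX m T).δ 1 g) (edgePt q z (2 * m) 1) =
      ev g (edgePt q z (2 * m) 0) + ev g (edgePt q z (2 * m) 2) := by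
  rw [ev_δ_edgePt hg hq hz (by omega) (by omega) (by omega) (by omega) (by omega)
    {(2 * m, 0), (2 * m, 2)}]
  · rw [Finset.sum_pair (by simp)]
  · rintro ⟨a, b⟩
    simp only [Finset.mem_insert, Finset.mem_singleton, Prod.mk.injEq]
    omega

/-- The difference of the values at the two ends of a piece of an arm. -/
theorem sum_δ_arm (hg : ∀ u : (RX m T).VDeg 1, T.deg (T.owner m u.1) = 0 → g u = 0)
    (hq : T.deg q = 1) (hz : T.Adj q z) {k h : ℕ} (hk : k ≤ m) (hh : h = 0 ∨ h = 2) :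
    ev g (edgePt q z (2 * k) h) = ev g (.onVertex q h) +
      ∑ k' ∈ Finset.range k, ev ((RX m T).δ 1 g) (edgePt q z (2 * k' + 1) h) := by
  induction k with
  | zero => simp [edgePt]
  | succ k ih =>
    rw [Finset.sum_range_succ, ev_δ_arm hg hq hz hk hh, ih (by omega)]
    grind

end arms

theorem adj_onVertex {q z : T.V} (hq : T.deg q = 1) (hz : T.Adj q z) {h : ℕ} {u w : (RX m T).V}
    (hu : u.1 = edgePt q z (2 * m) h) (hw : w.1 = .onVertex z h) (hh : h = 0 ∨ h = 2) :
    (RX m T).Adj u w := by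
  rw [adj_iff]
  obtain ⟨f, rfl, ⟨-, he⟩ | ⟨-, he⟩⟩ := exists_copy_q_z m hq hz
  · exact ⟨f, (2 * m + 1, 2 * m, h), (2 * m + 1, 2 * m + 1, h), by rw [mem_slab]; omega,
      by rw [mem_slab]; omega, by rw [hu, he _ h le_rfl], by rw [hw, place_z],
      by rw [step_iff]; omega⟩
  · exact ⟨f, (2 * m, 2 * m + 1, h), (2 * m + 1, 2 * m + 1, h), by rw [mem_slab]; omega,
      by rw [mem_slab]; omega, by rw [hu, he _ h le_rfl], by rw [hw, place_z],
      by rw [step_iff]; omega⟩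

/-- How the coboundary of a cochain on `Y_q` leaves `Y_q`. -/
theorem exists_of_adj_out {q : T.V} (hq : T.deg q = 1) {u : (RX m T).VDeg 1} {w : (RX m T).VDeg 2}
    (hu : T.owner m u.1 = q) (hadj : (RX m T).Adj u.1 w.1) (hw : T.owner m w.1 ≠ q) :
    ∃ z h, T.Adj q z ∧ (h = 0 ∨ h = 2) ∧ u.1.1 = edgePt q z (2 * m) h ∧
      w.1.1 = .onVertex z h := by
  have hd := deg_owner_of_adj hadj (by rw [hu]; exact hw.symm)
  obtain ⟨f, ⟨a, b, h⟩, ⟨a', b', h'⟩, hp, hp', eu, ew, hs⟩ := adj_iff.mp hadj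
  have hd' : a % 2 + b % 2 + h % 2 = 1 := by
    have := u.2
    rwa [show (RX m T).deg u.1 = T.labelDeg u.1.1 from rfl, eu, labelDeg_place] at this
  rw [hu, hq, owner, ew, deg_labelOwner_place f hp'] at hd
  have hu' := deg_labelOwner_place f hp
  rw [← eu, show T.labelOwner u.1.1 = q from hu, hq] at hu'
  have ho := labelOwner_place f hp
  rw [← eu, show T.labelOwner u.1.1 = q from hu] at ho
  rw [mem_slab] at hp hp'
  rw [step_iff] at hs
  dsimp only at hd hu' ho
  split_ifs at hd hu' ho with h₁ h₂ h₃ h₄ <;> try omega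
  · obtain ⟨rfl, rfl, rfl, rfl, rfl⟩ :
        b' = 2 * m + 1 ∧ a' = 2 * m + 1 ∧ h' = h ∧ b = 2 * m + 1 ∧ a = 2 * m := by omega
    subst ho
    exact ⟨T.z f, h', ⟨f, .inr <| .inr <| .inr ⟨rfl, rfl⟩⟩, by omega,
      by rw [eu, place_q₁_z f h' le_rfl], by rw [ew, place_z]⟩
  · obtain ⟨rfl, rfl, rfl, rfl, rfl⟩ :
        b' = 2 * m + 1 ∧ a' = 2 * m + 1 ∧ h' = h ∧ a = 2 * m + 1 ∧ b = 2 * m := by omega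
    subst ho
    exact ⟨T.z f, h', ⟨f, .inr <| .inr <| .inl ⟨rfl, rfl⟩⟩, by omega,
      by rw [eu, place_q₀_z f h' le_rfl], by rw [ew, place_z]⟩

/-- Each check of `Y_q` sees exactly two qubits of `Y_q`, so `g` may be shifted there by a constant
`κ`; the weight bound is a matter of choosing `κ`. -/
theorem exists_fills_q (hm : 1 ≤ m) {g : (RX m T).C 1}
    (hg : ∀ u : (RX m T).VDeg 1, T.deg (T.owner m u.1) = 0 → g u = 0) {q : T.V}
    (hq : T.deg q = 1) : ∃ f, T.Fills m q ((RX m T).δ 1 g) f := by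
  let F : ZMod 2 → (RX m T).C 1 := fun κ u => if T.owner m u.1 = q then g u + κ else 0
  have hF₀ : ∀ κ (u : (RX m T).VDeg 1), T.deg (T.owner m u.1) = 0 → F κ u = 0 := by
    intro κ u hu
    refine if_neg ?_
    rintro rfl
    omega
  have hFe : ∀ κ z k h, T.Adj q z → k ≤ m → (h = 0 ∨ h = 2) →
      ev (F κ) (edgePt q z (2 * k) h) = ev g (edgePt q z (2 * k) h) + κ := by
    intro κ z k h hz hk hh
    obtain ⟨u, hu⟩ := exists_edge_vert (m := m) (i := 1) hq hz (k := 2 * k) (h := h) (by omega)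
      (by omega) (by omega) (by omega)
    rw [← hu, ev_val, ev_val]
    exact if_pos (by rw [owner, hu, labelOwner_edgePt])
  have support : ∀ κ u, T.owner m u.1 ≠ q → F κ u = 0 := fun κ u hu => if_neg hu
  have boundary : ∀ κ w, T.owner m w.1 = q → (RX m T).δ 1 (F κ) w = (RX m T).δ 1 g w := by
    intro κ w hw
    rw [← ev_val ((RX m T).δ 1 (F κ)), ← ev_val ((RX m T).δ 1 g)]
    obtain ⟨z, hz, ⟨k, h, hk, hh, e⟩ | e⟩ := zCheck_cases_q hq w hw
    · rw [e, ev_δ_arm (hF₀ κ) hq hz hk hh, ev_δ_arm hg hq hz hk hh, hFe κ z k h hz hk.le hh,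
        hFe κ z (k + 1) h hz hk hh]
      grind
    · rw [e, ev_δ_end hm (hF₀ κ) hq hz, ev_δ_end hm hg hq hz, hFe κ z m 0 hz le_rfl (.inl rfl),
        hFe κ z m 2 hz le_rfl (.inr rfl)]
      grind
  have out : ∀ κ, ∀ p ∈ T.outPairs m q (F κ), ∃ z h, T.Adj q z ∧ (h = 0 ∨ h = 2) ∧
      p.1.1.1 = edgePt q z (2 * m) h ∧ p.2.1.1 = .onVertex z h ∧ g p.1 + κ ≠ 0 := by
    rintro κ ⟨u, w⟩ hp
    simp only [outPairs, Finset.mem_filter, Finset.mem_univ, true_and] at hp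
    obtain ⟨hu, hFu, hadj, hw⟩ := hp
    obtain ⟨z, h, hz, hh, e, e'⟩ := exists_of_adj_out hq hu hadj hw
    simp only [F, if_pos hu] at hFu
    exact ⟨z, h, hz, hh, e, e', hFu⟩
  have supp : ∀ z k h, T.Adj q z → k ≤ 2 * m → h ≤ 2 → (h = 1 → k = 2 * m) → k % 2 + h % 2 = 1 →
      ev ((RX m T).δ 1 g) (edgePt q z k h) ≠ 0 →
      ∃ v ∈ T.localSupport m q ((RX m T).δ 1 g), v.1.1 = edgePt q z k h := by
    intro z k h hz hk hh h1 hd hne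
    obtain ⟨v, hv⟩ := exists_edge_vert (m := m) (i := 2) hq hz hk hh h1 (by omega)
    rw [← hv, ev_val] at hne
    refine ⟨v, ?_, hv⟩
    simp only [localSupport, Finset.mem_filter, Finset.mem_univ, true_and]
    exact ⟨by rw [owner, hv, labelOwner_edgePt], hne⟩
  -- If the centres agree, take `κ` to cancel their common value: a nonzero tip then forces an
  -- excitation on its own arm and layer.
  by_cases hc : ev g (.onVertex q 0) = ev g (.onVertex q 2)
  · refine ⟨F (ev g (.onVertex q 0)), support _, boundary _, ?_⟩
    refine Finset.card_le_card_of_forall_subsingleton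
      (fun p v => ∃ z k h, p.1.1.1 = edgePt q z (2 * m) h ∧ p.2.1.1 = .onVertex z h ∧
        v.1.1 = edgePt q z (2 * k + 1) h) ?_ ?_
    · intro p hp
      obtain ⟨z, h, hz, hh, e, e', hne⟩ := out _ p hp
      have hce : ev g (.onVertex q h) = ev g (.onVertex q 0) := by
        rcases hh with rfl | rfl
        exacts [rfl, hc.symm]
      rw [← ev_val g, e, sum_δ_arm hg hq hz le_rfl hh, hce] at hne
      obtain ⟨k, hk, hne'⟩ := Finset.exists_ne_zero_of_sum_ne_zero
        (f := fun k' => ev ((RX m T).δ 1 g) (edgePt q z (2 * k' + 1) h))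
        (s := Finset.range m) (by grind)
      rw [Finset.mem_range] at hk
      obtain ⟨v, hv, ev⟩ := supp z (2 * k + 1) h hz (by omega) (by omega) (by omega) (by omega) hne'
      exact ⟨v, hv, z, k, h, e, e', ev⟩
    · rintro v - ⟨u, w⟩ ⟨-, z, k, h, e₁, e₂, e₃⟩ ⟨u', w'⟩ ⟨-, z', k', h', e₁', e₂', e₃'⟩
      obtain ⟨rfl, -, rfl⟩ := edgePt_inj (by omega) (e₃.symm.trans e₃')
      exact Prod.ext (Subtype.ext (Subtype.ext (e₁.trans e₁'.symm)))
        (Subtype.ext (Subtype.ext (e₂.trans e₂'.symm)))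
  -- If the centres differ, the path from one centre to the other through the tips over `z` must
  -- meet an excited check, so there are at least as many excitations as arms.
  · have hN : (Finset.univ.filter fun z => T.Adj q z).card ≤
        (T.localSupport m q ((RX m T).δ 1 g)).card := by
      refine Finset.card_le_card_of_forall_subsingleton
        (fun z v => ∃ k h, k ≠ 0 ∧ v.1.1 = edgePt q z k h) ?_ ?_
      · intro z hz
        replace hz := (Finset.mem_filter.mp hz).2
        by_contra hno
        push Not at hno
        have h₀ : ∀ k h, k ≠ 0 → k ≤ 2 * m → h ≤ 2 → (h = 1 → k = 2 * m) → k % 2 + h % 2 = 1 →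
            ev ((RX m T).δ 1 g) (edgePt q z k h) = 0 := by
          intro k h hk hk' hh h1 hd
          by_contra hne
          obtain ⟨v, hv, e⟩ := supp z k h hz hk' hh h1 hd hne
          exact hno v hv k h hk e
        have h₁ : ∀ h, (h = 0 ∨ h = 2) → ev g (edgePt q z (2 * m) h) = ev g (.onVertex q h) := by
          intro h hh
          rw [sum_δ_arm hg hq hz le_rfl hh, Finset.sum_eq_zero, add_zero]
          intro k hk
          rw [Finset.mem_range] at hk
          exact h₀ _ _ (by omega) (by omega) (by omega) (by omega) (by omega)
        have h₂ := h₀ (2 * m) 1 (by omega) (by omega) (by omega) (by omega) (by omega)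
        rw [ev_δ_end hm hg hq hz, h₁ 0 (.inl rfl), h₁ 2 (.inr rfl)] at h₂
        exact hc (by grind)
      · rintro v - z ⟨-, k, h, hk, e⟩ z' ⟨-, k', h', -, e'⟩
        exact (edgePt_inj hk (e.symm.trans e')).1
    -- Each of the two tips per arm is nonzero for exactly one `κ`, so both candidates together emit
    -- at most twice per arm.
    have hdis : Disjoint (T.outPairs m q (F 0)) (T.outPairs m q (F 1)) := by
      rw [Finset.disjoint_left]
      intro p hp hp'
      obtain ⟨-, -, -, -, -, -, h₁⟩ := out _ p hp
      obtain ⟨-, -, -, -, -, -, h₂⟩ := out _ p hp'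
      generalize g p.1 = a at h₁ h₂
      revert a
      decide
    have hcard : (T.outPairs m q (F 0)).card + (T.outPairs m q (F 1)).card ≤
        2 * (Finset.univ.filter fun z => T.Adj q z).card := by
      rw [← Finset.card_union_of_disjoint hdis]
      have : ((Finset.univ.filter fun z => T.Adj q z) ×ˢ ({0, 2} : Finset ℕ)).card =
          2 * (Finset.univ.filter fun z => T.Adj q z).card := by
        rw [Finset.card_product, mul_comm]; rfl
      rw [← this]
      refine Finset.card_le_card_of_forall_subsingleton
        (fun p zh => p.1.1.1 = edgePt q zh.1 (2 * m) zh.2 ∧ p.2.1.1 = .onVertex zh.1 zh.2) ?_ ?_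
      · intro p hp
        have : ∃ κ, p ∈ T.outPairs m q (F κ) := by
          rcases Finset.mem_union.mp hp with hp | hp
          exacts [⟨_, hp⟩, ⟨_, hp⟩]
        obtain ⟨κ, hp⟩ := this
        obtain ⟨z, h, hz, hh, e, e', -⟩ := out κ p hp
        exact ⟨(z, h), by simp [hz, hh], e, e'⟩
      · rintro zh - ⟨u, w⟩ ⟨-, e₁, e₂⟩ ⟨u', w'⟩ ⟨-, e₁', e₂'⟩
        exact Prod.ext (Subtype.ext (Subtype.ext (e₁.trans e₁'.symm)))
          (Subtype.ext (Subtype.ext (e₂.trans e₂'.symm)))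
    rcases le_total (T.outPairs m q (F 0)).card (T.outPairs m q (F 1)).card with h | h
    · exact ⟨F 0, support _, boundary _, by omega⟩
    · exact ⟨F 1, support _, boundary _, by omega⟩

/-! ### The cochain map `𝓕` -/

theorem deg_owner_le_one (u : (RX m T).VDeg 1) : T.deg (T.owner m u.1) ≤ 1 := by
  obtain ⟨f, ⟨a, b, h⟩, hp, hd, rfl⟩ := exists_vert u
  change T.deg (T.labelOwner (T.place m f (a, b, h))) ≤ 1
  have hd' : a % 2 + b % 2 + h % 2 = 1 := hd
  rw [deg_labelOwner_place f hp]
  have := mem_slab.mp hp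
  dsimp only
  split_ifs <;> omega

theorem zCheck_cases_z (w : (RX m T).VDeg 2) (hw : T.deg (T.owner m w.1) = 2) :
    ∃ f h, (h = 0 ∨ h = 2) ∧ w.1.1 = .onVertex (T.z f) h ∧ T.owner m w.1 = T.z f := by
  obtain ⟨f, ⟨a, b, h⟩, hp, hd, rfl⟩ := exists_vert w
  have hd' : a % 2 + b % 2 + h % 2 = 2 := hd
  have hdo : T.deg (T.labelOwner (T.place m f (a, b, h))) = 2 := hw
  rw [deg_labelOwner_place f hp] at hdo
  have hp' := mem_slab.mp hp
  dsimp only at hdo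
  have ⟨ha, hb⟩ : a = 2 * m + 1 ∧ b = 2 * m + 1 := by
    split_ifs at hdo <;> omega
  have e : T.place m f (a, b, h) = .onVertex (T.z f) h := by rw [ha, hb, place_z]
  exact ⟨f, h, by omega, e, congrArg T.labelOwner e⟩

theorem lift_apply_of_deg {i : ℕ} (c : T.C i) (u : (RX m T).VDeg i)
    (h : T.deg (T.owner m u.1) = i) : T.lift m i c u = c ⟨T.owner m u.1, h⟩ := dif_pos h

theorem lift_apply_of_deg_ne {i : ℕ} (c : T.C i) (u : (RX m T).VDeg i)
    (h : T.deg (T.owner m u.1) ≠ i) : T.lift m i c u = 0 := dif_neg h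

/-- Silent checks make `g` constant along each arm and equal at its two tips, hence constant on
`Y_q`; its value can be read off at the centre of height `0`. -/
theorem eq_lift (hm : 1 ≤ m) {g : (RX m T).C 1}
    (hg : ∀ u : (RX m T).VDeg 1, T.deg (T.owner m u.1) = 0 → g u = 0)
    (hδ : ∀ w : (RX m T).VDeg 2, T.deg (T.owner m w.1) = 1 → (RX m T).δ 1 g w = 0) :
    g = T.lift m 1 fun q => ev g (.onVertex q.1 0) := by
  funext u
  by_cases h : T.deg (T.owner m u.1) = 1
  · rw [lift_apply_of_deg _ _ h]
    obtain ⟨z, k, h', hz, hk, hh, e⟩ := qubit_cases_q h u rfl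
    generalize T.owner m u.1 = q at *
    have h₀ : ∀ k h', k ≠ 0 → k ≤ 2 * m → h' ≤ 2 → (h' = 1 → k = 2 * m) → k % 2 + h' % 2 = 1 →
        ev ((RX m T).δ 1 g) (edgePt q z k h') = 0 := by
      intro k h' hk hk' hh h1 hd
      obtain ⟨w, hw⟩ := exists_edge_vert (m := m) (i := 2) h hz hk' hh h1 (by omega)
      rw [← hw, ev_val]
      exact hδ w (by rw [owner, hw, labelOwner_edgePt, h])
    have h₁ : ∀ k h, k ≤ m → (h = 0 ∨ h = 2) →
        ev g (edgePt q z (2 * k) h) = ev g (.onVertex q h) := by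
      intro k h' hk hh
      rw [sum_δ_arm hg h hz hk hh, Finset.sum_eq_zero, add_zero]
      intro k hk
      rw [Finset.mem_range] at hk
      exact h₀ _ _ (by omega) (by omega) (by omega) (by omega) (by omega)
    have h₂ := h₀ (2 * m) 1 (by omega) (by omega) (by omega) (by omega) (by omega)
    rw [ev_δ_end hm hg h hz, h₁ m 0 le_rfl (.inl rfl), h₁ m 2 le_rfl (.inr rfl)] at h₂
    rw [← ev_val g, e, h₁ k h' hk hh]
    rcases hh with rfl | rfl <;> grind
  · rw [lift_apply_of_deg_ne _ _ h]
    exact hg u (by have := deg_owner_le_one u; omega)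

/-- A check of `Y_q` sees the same value twice; a point over `z` sees one arm tip for each qubit
adjacent to `z`, which reproduces `δ ε`. -/
theorem δ_lift (hm : 1 ≤ m) (ε : T.C 1) :
    (RX m T).δ 1 (T.lift m 1 ε) = T.lift m 2 (T.δ 1 ε) := by
  have hg : ∀ u : (RX m T).VDeg 1, T.deg (T.owner m u.1) = 0 → T.lift m 1 ε u = 0 :=
    fun u hu => lift_apply_of_deg_ne _ _ (by omega)
  have hev : ∀ (q : T.VDeg 1) z k h, T.Adj q z → k ≤ m → (h = 0 ∨ h = 2) →
      ev (T.lift m 1 ε) (edgePt q.1 z (2 * k) h) = ε q := by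
    rintro ⟨q, hq⟩ z k h hz hk hh
    obtain ⟨u, hu⟩ := exists_edge_vert (m := m) (i := 1) hq hz (k := 2 * k) (h := h) (by omega)
      (by omega) (by omega) (by omega)
    have ho : T.owner m u.1 = q := by rw [owner, hu, labelOwner_edgePt]
    subst ho
    rw [← hu, ev_val, lift_apply_of_deg _ _ hq]
  funext w
  by_cases h₂ : T.deg (T.owner m w.1) = 2
  · rw [lift_apply_of_deg _ _ h₂]
    obtain ⟨f, h, hh, e, ho⟩ := zCheck_cases_z w h₂
    rw [δ_apply_eq_sum (T.lift m 1 ε) w (Finset.univ.filter fun q : T.VDeg 1 => T.Adj q.1 (T.z f))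
      (fun q => edgePt q.1 (T.z f) (2 * m) h)]
    · simp only [ho]
      rw [Finset.sum_congr rfl fun q hq => hev q _ m h (Finset.mem_filter.mp hq).2 le_rfl hh,
        Finset.sum_filter]
      rfl
    · rintro q - q' - e
      have := congrArg T.labelOwner e
      simp only [labelOwner_edgePt] at this
      exact Subtype.ext this
    · intro u hu
      constructor
      · intro hadj
        have hq : T.deg (T.owner m u.1) = 1 := by
          by_contra h1
          exact hu (lift_apply_of_deg_ne _ _ h1)
        obtain ⟨z, h', hz, -, e₁, e₂⟩ := exists_of_adj_out hq rfl hadj fun h => by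
          rw [h] at h₂; omega
        rw [e] at e₂
        simp only [Label.onVertex.injEq] at e₂
        obtain ⟨rfl, rfl⟩ := e₂
        exact ⟨⟨_, hq⟩, by simpa using hz, e₁⟩
      · rintro ⟨q, hq, e'⟩
        exact adj_onVertex q.2 (Finset.mem_filter.mp hq).2 e' e hh
  · rw [lift_apply_of_deg_ne _ _ h₂]
    by_cases h₁ : T.deg (T.owner m w.1) = 1
    · rw [← ev_val ((RX m T).δ 1 (T.lift m 1 ε))]
      obtain ⟨z, hz, ⟨k, h, hk, hh, e⟩ | e⟩ := zCheck_cases_q h₁ w rfl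
      · rw [e, ev_δ_arm hg h₁ hz hk hh, hev ⟨_, h₁⟩ z k h hz hk.le hh,
          hev ⟨_, h₁⟩ z (k + 1) h hz hk hh]
        grind
      · rw [e, ev_δ_end hm hg h₁ hz, hev ⟨_, h₁⟩ z m 0 hz le_rfl (.inl rfl),
          hev ⟨_, h₁⟩ z m 2 hz le_rfl (.inr rfl)]
        grind
    · refine Finset.sum_eq_zero fun u _ => ?_
      split_ifs with hadj
      · refine hg u ?_
        have := deg_owner_le_one u
        by_cases hne : T.owner m u.1 = T.owner m w.1
        · rw [← hne] at h₁; omega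
        · have := deg_owner_of_adj hadj hne
          omega
      · rfl

/-! ### One round of local corrections -/

/-- The excitations sent out of the local complexes are at most as many as the ones removed. -/
theorem hammingNorm_add_δ_le {d : ℕ} {s : (RX m T).C 2} {c : (RX m T).C 1}
    (hc : ∀ u : (RX m T).VDeg 1, T.deg (T.owner m u.1) ≠ d → c u = 0)
    (hs : ∀ w : (RX m T).VDeg 2, T.deg (T.owner m w.1) = d → (s + (RX m T).δ 1 c) w = 0)
    (hw : ∀ v, T.deg v = d → (T.outPairs m v c).card ≤ (T.localSupport m v s).card) :
    hammingNorm (s + (RX m T).δ 1 c) ≤ hammingNorm s := by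
  let D : Finset T.V := {v | T.deg v = d}
  -- `A` holds the old excitations left untouched, `B` the targets of emissions, `L` the removed
  -- excitations. The new support lies in `A ∪ B`, while `A` and `L` are disjoint inside the old
  -- one.
  let A : Finset ((RX m T).VDeg 2) := {w | T.deg (T.owner m w.1) ≠ d ∧ s w ≠ 0}
  let B := (D.biUnion fun v => T.outPairs m v c).image Prod.snd
  let L := D.biUnion fun v => T.localSupport m v s
  have hBL : B.card ≤ L.card := by
    refine Finset.card_image_le.trans (Finset.card_biUnion_le.trans ?_)
    rw [Finset.card_biUnion]
    · exact Finset.sum_le_sum fun v hv => hw v (Finset.mem_filter.mp hv).2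
    · intro v _ v' _ hne
      refine Finset.disjoint_left.mpr ?_
      intro w h h'
      simp only [localSupport, Finset.mem_filter, Finset.mem_univ, true_and] at h h'
      exact hne (h.1.symm.trans h'.1)
  have hAL : Disjoint A L := by
    rw [Finset.disjoint_left]
    intro w h h'
    simp only [A, L, D, localSupport, Finset.mem_filter, Finset.mem_univ, true_and,
      Finset.mem_biUnion] at h h'
    obtain ⟨v, hv, rfl, -⟩ := h'
    exact h.1 hv
  calc hammingNorm (s + (RX m T).δ 1 c) ≤ (A ∪ B).card := by
        refine Finset.card_le_card fun w hw' => ?_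
        replace hw' := (Finset.mem_filter.mp hw').2
        have hd : T.deg (T.owner m w.1) ≠ d := fun h => hw' (hs w h)
        by_cases hsw : s w = 0
        · rw [Pi.add_apply, hsw, zero_add] at hw'
          obtain ⟨u, -, hu⟩ := Finset.exists_ne_zero_of_sum_ne_zero hw'
          have ⟨hadj, hcu⟩ : (RX m T).Adj u.1 w.1 ∧ c u ≠ 0 := by
            split_ifs at hu with h
            exacts [⟨h, hu⟩, absurd rfl hu]
          have hdu : T.deg (T.owner m u.1) = d := by
            by_contra h
            exact hcu (hc u h)
          refine Finset.mem_union_right _ (Finset.mem_image.mpr ⟨(u, w), ?_, rfl⟩)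
          simp only [D, outPairs, Finset.mem_biUnion, Finset.mem_filter, Finset.mem_univ, true_and]
          exact ⟨_, hdu, rfl, hcu, hadj, fun h => hd (by rw [h, hdu])⟩
        · refine Finset.mem_union_left _ ?_
          simp only [A, Finset.mem_filter, Finset.mem_univ, true_and]
          exact ⟨hd, hsw⟩
    _ ≤ A.card + B.card := Finset.card_union_le _ _
    _ ≤ A.card + L.card := Nat.add_le_add_left hBL _
    _ = (A ∪ L).card := (Finset.card_union_of_disjoint hAL).symm
    _ ≤ hammingNorm s := by
        refine Finset.card_le_card fun w hw' => Finset.mem_filter.mpr ⟨Finset.mem_univ _, ?_⟩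
        simp only [A, L, localSupport, Finset.mem_filter, Finset.mem_univ, true_and,
          Finset.mem_union, Finset.mem_biUnion] at hw'
        rcases hw' with h | ⟨_, _, h⟩ <;> exact h.2

/-- A local correction in `Y_v` of the syndrome `s`. -/
def localCorrection (T : TannerComplex) (m : ℕ) (v : T.V) (s : (RX m T).C 2) : (RX m T).C 1 :=
  Classical.epsilon (T.Fills m v s)

/-- The local corrections in all the local complexes `Y_v` with `v` of degree `d`. -/
def round (T : TannerComplex) (m d : ℕ) (s : (RX m T).C 2) : (RX m T).C 1 := fun u =>
  if T.deg (T.owner m u.1) = d then T.localCorrection m (T.owner m u.1) s u else 0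

theorem round_apply_of_ne {d : ℕ} (s : (RX m T).C 2) {u : (RX m T).VDeg 1}
    (h : T.deg (T.owner m u.1) ≠ d) : T.round m d s u = 0 := if_neg h

/-- Source of locality: `Fills` sees the syndrome only on `Y_v`, and the choice operator returns the
same cochain for equal predicates. -/
theorem localCorrection_congr {v : T.V} {s t : (RX m T).C 2}
    (h : ∀ w : (RX m T).VDeg 2, T.owner m w.1 = v → s w = t w) :
    T.localCorrection m v s = T.localCorrection m v t := by
  have hl : T.localSupport m v s = T.localSupport m v t := by
    ext w
    simp only [localSupport, Finset.mem_filter, Finset.mem_univ, true_and]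
    exact and_congr_right fun hw => by rw [h w hw]
  have : T.Fills m v s = T.Fills m v t := by
    funext f
    refine propext ⟨fun hf => ⟨hf.1, fun w hw => (hf.2 w hw).trans (h w hw), hl ▸ hf.3⟩,
      fun hf => ⟨hf.1, fun w hw => (hf.2 w hw).trans (h w hw).symm, hl ▸ hf.3⟩⟩
  rw [localCorrection, localCorrection, this]

theorem round_congr {d : ℕ} {s t : (RX m T).C 2} {u : (RX m T).VDeg 1}
    (h : ∀ w : (RX m T).VDeg 2, T.owner m w.1 = T.owner m u.1 → s w = t w) :
    T.round m d s u = T.round m d t u := by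
  rw [round, round, localCorrection_congr h]

/-- Local corrections of equal degree do not interfere: what enters a local complex from outside
comes from one of degree one lower, where the round vanishes. -/
theorem add_δ_round {d : ℕ} {s : (RX m T).C 2} (hs : ∀ v, T.deg v = d → ∃ f, T.Fills m v s f)
    {w : (RX m T).VDeg 2} (hw : T.deg (T.owner m w.1) = d) :
    (s + (RX m T).δ 1 (T.round m d s)) w = 0 := by
  have hf := Classical.epsilon_spec (hs _ hw)
  have : (RX m T).δ 1 (T.round m d s) w = s w := by
    rw [← hf.2 w rfl]
    refine δ_congr fun u hu => ?_
    by_cases ho : T.owner m u.1 = T.owner m w.1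
    · rw [round, if_pos (by rw [ho, hw]), ho, localCorrection]
    · rw [hf.1 u ho]
      have := deg_owner_of_adj hu ho
      exact round_apply_of_ne s (by omega)
  rw [Pi.add_apply, this]
  grind

theorem hammingNorm_add_δ_round_le {d : ℕ} {s : (RX m T).C 2}
    (hs : ∀ v, T.deg v = d → ∃ f, T.Fills m v s f) :
    hammingNorm (s + (RX m T).δ 1 (T.round m d s)) ≤ hammingNorm s := by
  refine hammingNorm_add_δ_le (fun u => round_apply_of_ne s) (fun w => add_δ_round hs)
    fun v hv => ?_
  have hf := Classical.epsilon_spec (hs v hv)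
  refine le_trans (Finset.card_le_card fun p hp => ?_) hf.3
  simp only [outPairs, Finset.mem_filter, Finset.mem_univ, true_and] at hp ⊢
  obtain ⟨rfl, h, h'⟩ := hp
  rw [round, if_pos hv] at h
  exact ⟨rfl, h, h'⟩

theorem exists_vertex_over (m : ℕ) {ε : T.C 1} {z : T.VDeg 2} (hz : T.δ 1 ε z ≠ 0) {h : ℕ}
    (hh : h = 0 ∨ h = 2) : ∃ w : (RX m T).VDeg 2, w.1.1 = .onVertex z.1 h := by
  obtain ⟨q, -, hq⟩ := Finset.exists_ne_zero_of_sum_ne_zero hz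
  have hadj : T.Adj q.1 z.1 := by
    by_contra h
    exact hq (if_neg h)
  obtain ⟨f, hf, -⟩ := adj_q_z q.2 hadj
  rw [← hf, ← place_z (m := m)]
  exact ⟨vert f (p := (2 * m + 1, 2 * m + 1, h)) (by rw [mem_slab]; omega) (by simp only; omega),
    rfl⟩

/-- Each excited `z` has two excited points over it, at heights `0` and `2`. The syndrome must be a
coboundary: a Z-check lying on no face has no points over it. -/
theorem two_mul_hammingNorm_le (ε : T.C 1) :
    2 * hammingNorm (T.δ 1 ε) ≤ hammingNorm (T.lift m 2 (T.δ 1 ε)) := by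
  have : ((Finset.univ.filter fun z => T.δ 1 ε z ≠ 0) ×ˢ ({0, 2} : Finset ℕ)).card =
      2 * hammingNorm (T.δ 1 ε) := by
    rw [Finset.card_product, mul_comm]
    congr
  rw [← this]
  refine Finset.card_le_card_of_forall_subsingleton (fun zh w => w.1.1 = .onVertex zh.1.1 zh.2) ?_ ?_
  · rintro ⟨z, h⟩ hz
    simp only [Finset.mem_product, Finset.mem_filter, Finset.mem_univ, true_and,
      Finset.mem_insert, Finset.mem_singleton] at hz
    obtain ⟨w, hw⟩ := exists_vertex_over m hz.1 hz.2
    have ho : T.owner m w.1 = z.1 := congrArg T.labelOwner hw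
    refine ⟨w, Finset.mem_filter.mpr ⟨Finset.mem_univ _, ?_⟩, hw⟩
    rw [lift_apply_of_deg _ _ (by rw [ho, z.2])]
    simp only [ho]
    exact hz.1
  · rintro w - ⟨z, h⟩ ⟨-, e⟩ ⟨z', h'⟩ ⟨-, e'⟩
    have := e.symm.trans e'
    simp only [Label.onVertex.injEq] at this
    exact Prod.ext (Subtype.ext this.1) this.2

/-! ### Locality -/

theorem dirDist_le_of_dirPath {u v : T.V} {n r : ℕ} (h : T.DirPath n u v) (hn : n ≤ r) :
    T.dirDist u v ≤ r := iInf₂_le_of_le n h (by exact_mod_cast hn)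

theorem nearby_apply {v : T.V} {r : ℕ} (σ : (RX m T).C 2) {w : (RX m T).VDeg 2}
    (h : T.dirDist (T.owner m w.1) v ≤ r) : T.nearby m v r σ w = σ w := by
  simp only [nearby, Finset.sum_apply, restr]
  rw [Finset.sum_eq_single (T.owner m w.1)]
  · rw [if_pos rfl]
  · intro v' _ hv'
    rw [if_neg hv'.symm]
  · intro h'
    rw [Finset.mem_filter] at h'
    exact absurd ⟨Finset.mem_univ _, h⟩ h'

theorem eq_of_nearby_eq {v : T.V} {n r : ℕ} {σ τ : (RX m T).C 2}
    (h : T.nearby m v r σ = T.nearby m v r τ) {w : (RX m T).VDeg 2}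
    (hw : T.DirPath n (T.owner m w.1) v) (hn : n ≤ r) : σ w = τ w := by
  have hd := dirDist_le_of_dirPath hw hn
  rw [← nearby_apply σ hd, h, nearby_apply τ hd]

/-- A map constant on the fibres of `nearby` factors through it; `Function.extend` gives the factor,
with default `0` off the image. -/
theorem correctionLocal_of {f : (RX m T).B2 → (RX m T).C 1}
    (h : ∀ v (σ τ : (RX m T).B2), T.nearby m v 1 σ = T.nearby m v 1 τ →
      T.restr m v (f σ) = T.restr m v (f τ)) : T.CorrectionLocal m f := by
  let φ : T.V → (RX m T).C 2 → (RX m T).C 1 := fun v =>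
    Function.extend (fun σ : (RX m T).B2 => T.nearby m v 1 σ) (fun σ => T.restr m v (f σ)) 0
  have hφ : ∀ v (σ : (RX m T).B2), φ v (T.nearby m v 1 σ) = T.restr m v (f σ) := fun v σ =>
    Function.FactorsThrough.extend_apply (fun σ τ => h v σ τ) 0 σ
  refine ⟨φ, fun σ => ⟨?_, fun v => (hφ v σ).symm⟩⟩
  simp only [hφ]
  funext u
  simp [Finset.sum_apply, restr]

theorem syndromeLocal_of {s : (RX m T).B2 → T.B2}
    (h : ∀ (z : T.VDeg 2) (σ τ : (RX m T).B2), T.nearby m z.1 2 σ = T.nearby m z.1 2 τ →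
      (s σ).1 z = (s τ).1 z) : T.SyndromeLocal m s :=
  ⟨fun z => Function.extend (fun σ : (RX m T).B2 => T.nearby m z.1 2 σ) (fun σ => (s σ).1 z) 0,
    fun σ z => (Function.FactorsThrough.extend_apply (fun σ τ => h z σ τ) 0 σ).symm⟩

/-- The correction: local corrections in the `Y_x`, then in the `Y_q`. -/
def correction (T : TannerComplex) (m : ℕ) (s : (RX m T).C 2) : (RX m T).C 1 :=
  T.round m 0 s + T.round m 1 (s + (RX m T).δ 1 (T.round m 0 s))

/-- The second round reads the syndrome left by the first. Each round acts within one local complex,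
so only the coboundary in between costs a step in distance. -/
theorem correction_congr {s t : (RX m T).C 2} {u : (RX m T).VDeg 1}
    (h : ∀ w : (RX m T).VDeg 2, T.owner m w.1 = T.owner m u.1 ∨
      T.Adj (T.owner m w.1) (T.owner m u.1) → s w = t w) :
    T.correction m s u = T.correction m t u := by
  rw [correction, correction, Pi.add_apply, Pi.add_apply, round_congr fun w hw => h w (.inl hw),
    round_congr (d := 1) fun w hw => ?_]
  rw [Pi.add_apply, Pi.add_apply, h w (.inl hw), δ_congr fun u' hu' => ?_]
  refine round_congr fun w' hw' => h w' ?_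
  rw [hw', ← hw]
  exact owner_of_adj hu'

theorem add_δ_correction_congr {s t : (RX m T).C 2} {z : T.V} {w : (RX m T).VDeg 2}
    (hw : T.owner m w.1 = z)
    (h : ∀ w' : (RX m T).VDeg 2, (∃ n ≤ 2, T.DirPath n (T.owner m w'.1) z) → s w' = t w') :
    (s + (RX m T).δ 1 (T.correction m s)) w = (t + (RX m T).δ 1 (T.correction m t)) w := by
  rw [Pi.add_apply, Pi.add_apply, h w ⟨0, by norm_num, hw⟩, δ_congr fun u hu => ?_]
  refine correction_congr fun w' hw' => h w' ?_
  rcases owner_of_adj hu with e | e <;> rw [hw] at e <;> rcases hw' with e' | e'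
  · exact ⟨0, by norm_num, e'.trans e⟩
  · exact ⟨1, by norm_num, _, rfl, e ▸ e'⟩
  · exact ⟨1, by norm_num, _, e', e⟩
  · exact ⟨2, by norm_num, _, ⟨_, rfl, e'⟩, e⟩

/-- After the corrections, the syndrome is the lift of a syndrome of at most half the weight. -/
theorem exists_add_δ_correction_eq_lift (hm : 1 ≤ m) (hP : (RX m T).PathUnique)
    (hL : T.LinkConnected) (g : (RX m T).C 1) :
    ∃ ε : T.C 1, (RX m T).δ 1 g + (RX m T).δ 1 (T.correction m ((RX m T).δ 1 g)) =
        T.lift m 2 (T.δ 1 ε) ∧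
      2 * hammingNorm (T.δ 1 ε) ≤ hammingNorm ((RX m T).δ 1 g) := by
  have h₀ : ∀ v, T.deg v = 0 → ∃ f, T.Fills m v ((RX m T).δ 1 g) f :=
    fun v hv => exists_fills_x hm hP g hv
  have hv : ∀ w : (RX m T).VDeg 2, T.deg (T.owner m w.1) = 0 →
      (RX m T).δ 1 (g + T.round m 0 ((RX m T).δ 1 g)) w = 0 := by
    intro w hw
    rw [map_add]
    exact add_δ_round h₀ hw
  obtain ⟨G, hG, hG₀⟩ := exists_vanishing hP hL _ hv
  have h₁ : ∀ v, T.deg v = 1 → ∃ f, T.Fills m v ((RX m T).δ 1 G) f :=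
    fun v hv => exists_fills_q hm hG₀ hv
  have hlift := eq_lift hm (g := G + T.round m 1 ((RX m T).δ 1 G))
    (fun u hu => by rw [Pi.add_apply, hG₀ u hu, round_apply_of_ne _ (by omega), add_zero])
    (fun w hw => by rw [map_add]; exact add_δ_round h₁ hw)
  have hle₀ := hammingNorm_add_δ_round_le h₀
  have hle₁ := hammingNorm_add_δ_round_le h₁
  generalize (fun q : T.VDeg 1 => ev (G + T.round m 1 ((RX m T).δ 1 G)) (.onVertex q.1 0)) = ε
    at hlift
  rw [map_add] at hG
  have hfin : (RX m T).δ 1 G + (RX m T).δ 1 (T.round m 1 ((RX m T).δ 1 G)) =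
      T.lift m 2 (T.δ 1 ε) := by
    rw [← map_add, hlift, δ_lift hm]
  refine ⟨ε, ?_, ?_⟩
  · rw [correction, map_add, ← hG, ← add_assoc, ← hG, hfin]
  · rw [← hG] at hle₀
    rw [hfin] at hle₁
    exact (two_mul_hammingNorm_le ε).trans (hle₁.trans hle₀)

theorem exists_coarse_graining (hm : 1 ≤ m) (hP : (RX m T).PathUnique) (hL : T.LinkConnected) :
    ∃ cg : (RX m T).B2 → T.B2 × (RX m T).C 1,
      T.CorrectionLocal m (fun σ => (cg σ).2) ∧
      T.SyndromeLocal m (fun σ => (cg σ).1) ∧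
      ∀ σ : (RX m T).B2,
        (σ : (RX m T).C 2) = (RX m T).δ 1 (cg σ).2 + T.lift m 2 (cg σ).1 ∧
        2 * hammingNorm ((cg σ).1 : T.C 2) ≤ hammingNorm (σ : (RX m T).C 2) := by
  have hex : ∀ σ : (RX m T).B2, ∃ s : T.B2,
      (σ : (RX m T).C 2) + (RX m T).δ 1 (T.correction m σ) = T.lift m 2 s ∧
      2 * hammingNorm (s : T.C 2) ≤ hammingNorm (σ : (RX m T).C 2) := by
    rintro ⟨_, g, rfl⟩
    obtain ⟨ε, h, h'⟩ := exists_add_δ_correction_eq_lift hm hP hL g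
    exact ⟨⟨_, ε, rfl⟩, h, h'⟩
  choose s hs hle using hex
  refine ⟨fun σ => (s σ, T.correction m σ), correctionLocal_of fun v σ τ h => ?_,
    syndromeLocal_of fun z σ τ h => ?_, fun σ => ⟨?_, hle σ⟩⟩
  · funext u
    simp only [restr]
    split_ifs with hu
    · refine correction_congr fun w hw => ?_
      rw [hu] at hw
      rcases hw with hw | hw
      exacts [eq_of_nearby_eq (n := 0) h hw (by norm_num),
        eq_of_nearby_eq (n := 1) h ⟨_, rfl, hw⟩ le_rfl]
    · rfl
  -- Over such a point the coarse value is read off the corrected syndrome, which is local although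
  -- `s` was chosen globally. Without one, the coarse syndrome vanishes at `z` as a coboundary.
  · by_cases hz : ∃ w : (RX m T).VDeg 2, w.1.1 = .onVertex z.1 0
    · obtain ⟨w, hw⟩ := hz
      have ho : T.owner m w.1 = z.1 := congrArg T.labelOwner hw
      have hσ : ∀ σ, (s σ).1 z = ((σ : (RX m T).C 2) + (RX m T).δ 1 (T.correction m σ)) w := by
        intro σ
        rw [hs, lift_apply_of_deg _ _ (by rw [ho, z.2])]
        simp only [ho]
      show (s σ).1 z = (s τ).1 z
      rw [hσ, hσ]
      exact add_δ_correction_congr ho fun w' ⟨n, hn, hw'⟩ => eq_of_nearby_eq h hw' hn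
    · have h₀ : ∀ σ, (s σ).1 z = 0 := by
        intro σ
        obtain ⟨ε, hε⟩ := (s σ).2
        by_contra h
        rw [← hε] at h
        exact hz (exists_vertex_over m h (.inl rfl))
      exact (h₀ σ).trans (h₀ τ).symm
  · rw [← hs]
    funext w
    simp only [Pi.add_apply]
    grind

end TannerComplex

end

theorem mainTheorem4 (m : ℕ) (hm : 1 ≤ m) (k : ℕ) (T : TannerComplex)
    (hT : T = TannerComplex.evenLevel m k) :
    ∃ cg : (TannerComplex.RX m T).B2 → T.B2 × (TannerComplex.RX m T).C 1,
      T.CorrectionLocal m (fun σ => (cg σ).2) ∧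
      T.SyndromeLocal m (fun σ => (cg σ).1) ∧
      ∀ σ : (TannerComplex.RX m T).B2,
        (σ : (TannerComplex.RX m T).C 2) =
          (TannerComplex.RX m T).δ 1 (cg σ).2 + T.lift m 2 (cg σ).1 ∧
        (hammingNorm ((cg σ).1 : T.C 2) : ℝ) ≤
          1 / 2 * (hammingNorm (σ : (TannerComplex.RX m T).C 2) : ℝ) := by
  subst hT
  obtain ⟨hP, hL⟩ := TannerComplex.evenLevel_invariants hm k
  obtain ⟨cg, hf, hs, h⟩ := TannerComplex.exists_coarse_graining hm (hP.RX hm) hL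
  refine ⟨cg, hf, hs, fun σ => ⟨(h σ).1, ?_⟩⟩
  have h₂ : (2 : ℝ) * hammingNorm ((cg σ).1 : (TannerComplex.evenLevel m k).C 2) ≤
      hammingNorm (σ : (TannerComplex.RX m (TannerComplex.evenLevel m k)).C 2) := by
    exact_mod_cast (h σ).2
  linarith
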